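/- **Setting.** Fix an infinite set $\Delta$ of constants (finite binary strings); each sort (process ids, subjects, roles, actions, objects, tasks, data owners, purposes) has its own copy of it. *Policies.* A static database $I_{st}$ consists of finite relations $userRole(sub,role)$, $rolePerm(role,act,obj)$ (the RBAC policy), $uses(act,task,obj)$ and $accessibleFor(do,obj,purpose)$, together with the derived relation $auth(sub,act,obj)$, which holds iff some role of $sub$ carries the permission $(act,obj)$. $adom(I_{st})$ is its active domain, taken sort by sort. *Processes.* A process $\mathsf{proc}$ has a name (also the purpose of its requests), a finite list of temporal constraints, which are propositional LTL formulas over tasks (built with $\top,\neg,\wedge,\mathsf X,\mathsf U$), and finite lists of separation-of-duty (SoD) and binding-of-duty (BoD) pairs of tasks; either list may be empty. A task is a *duty task* if it occurs in such a pair. The size of $\mathsf{proc}$ is the length of its encoding as a word over a fixed finite alphabet (names bit by bit, formulas in prefix notation). *Completion.* A run is a nonempty finite sequence of requests $(pid,sub,task,do,purpose)$, one per instant. $\mathsf{proc}$ *can be successfully completed* given $I_{st}$ if there are an id $\mathsf{id}$, a run, and a choice of a subject $\sigma(t)\in adom(I_{st})$ for each duty task $t$ such that, calling relevant the requests of the run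 with $pid=\mathsf{id}$ and $purpose=\mathsf{proc}$: 1. the sequence of tasks of relevant requests (an instant whose request is not relevant performs no task) satisfies all the constraints of $\mathsf{proc}$ under the finite-trace semantics of LTL; 2. every relevant request has $sub,do\in adom(I_{st})$, and whenever $uses(act,task,obj)$ holds, so do $accessibleFor(do,obj,\mathsf{proc})$ and $auth(sub,act,obj)$; 3. every relevant request for a duty task $t$ has $sub=\sigma(t)$; 4. $\sigma(t)\neq\sigma(t')$ for each SoD pair $(t,t')$ and $\sigma(t)=\sigma(t')$ for each BoD pair $(t,t')$. *Formulas.* The first-order temporal formula $\Psi_{\mathsf{proc}}(id)$ consists of quantifiers $\exists sub_t$, one for each duty task $t$, in front of the conjunction of the translated constraints, the formulas $sub_t\neq sub_{t'}$ for the SoD pairs and $sub_t=sub_{t'}$ for the BoD pairs. A constraint is translated by replacing each positive occurrence of a task $t$ by $$\exists sub,do.\,\bigl(request(id,sub,t,do,\mathsf{proc})\wedge\forall act,obj.\,uses(act,t,obj)\to(accessibleFor(do,obj,\mathsf{proc})\wedge auth(sub,act,obj))\bigr)$$ (if $t$ is a duty task, $sub_t$ is used in place of the locally quantified $sub$), and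 each negative occurrence by $\exists sub,do.\,request(id,sub,t,do,\mathsf{proc})$. The formula $I_{st}$ is the conjunction of all facts of the static relations that hold and the negations of all those that do not hold, over the constants of $adom(I_{st})$, the tasks of $\mathsf{proc}$ and its name. Formulas are interpreted over nonempty finite traces of database instances with exactly one request tuple per instant; quantifiers range over $adom(I_{st})$, except that those over process ids would range over all of $\Delta$. Satisfiable means true at the first instant of some such trace. **Theorem.** Let $I_{st}$ be a fixed static database. * The problem of deciding, given a process $\mathsf{proc}$ with possibly SoD and BoD constraints, whether $\mathsf{proc}$ can be successfully completed given $I_{st}$ is in EXPSPACE: there is a deterministic Turing machine that, on every word $w$ over the encoding alphabet, halts and answers whether $w$ encodes a process that can be successfully completed given $I_{st}$, using space at most $2^{p(|w|)}$ for some polynomial $p$. * For every process $\mathsf{proc}$ and every process id $\mathsf{id}$, $\mathsf{proc}$ can be successfully completed given $I_{st}$ if and only if $\Psi_{\mathsf{proc}}[\mathsf{id}/id]\wedge\Box I_{st}$ is satisfiable. -/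

import Mathlib

namespace PurposeAware

/-! ### Exponential space -/

/-- The space occupied by a configuration of a multi-stack Turing machine: the total number of
symbols stored on its stacks (the input stack included). -/
def cfgSpace (tm : Turing.FinTM2) (c : tm.Cfg) : ℕ :=
  letI := tm.kFin
  ∑ k : tm.K, (c.stk k).length

open Classical in
/-- The deterministic machine `tm` (with finite alphabets, the input alphabet being `α`, and output
`true` / `false`) halts on every word with the answer whether the word belongs to `L`, and every
configuration it reaches on a word of length `n` occupies space at most `s n`. -/
def DecidesInSpace {α : Type} (tm : Turing.FinTM2) (inp : tm.Γ tm.k₀ ≃ α)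
    (out : tm.Γ tm.k₁ ≃ Bool) (L : Language α) (s : ℕ → ℕ) : Prop :=
  (∀ k, Finite (tm.Γ k)) ∧
  ∀ w : List α,
    Nonempty (Turing.TM2Outputs tm (w.map inp.symm) (some [out.symm (decide (w ∈ L))])) ∧
    ∀ c : tm.Cfg, StateTransition.Reaches tm.step (Turing.initList tm (w.map inp.symm)) c →
      cfgSpace tm c ≤ s w.length

/-- The complexity class EXPSPACE: languages decided by a deterministic machine in space
`2 ^ p n`, for some polynomial `p`. -/
def InEXPSPACE {α : Type} (L : Language α) : Prop :=
  ∃ (tm : Turing.FinTM2) (inp : tm.Γ tm.k₀ ≃ α) (out : tm.Γ tm.k₁ ≃ Bool) (p : Polynomial ℕ),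
    DecidesInSpace tm inp out L (fun n => 2 ^ p.eval n)

/-! ### Processes -/

/-- Constants are finite binary strings.  Every sort has its own copy of this infinite domain. -/
abbrev Name : Type := List Bool

/-- Propositional linear temporal logic; the atoms are tasks. -/
inductive LTL : Type where
  | tt : LTL
  | task (t : Name) : LTL
  | neg (φ : LTL) : LTL
  | and (φ ψ : LTL) : LTL
  | next (φ : LTL) : LTL
  | untl (φ ψ : LTL) : LTL

/-- Finite-trace semantics: `W i t` says that task `t` is performed at instant `i`. -/
def LTL.Sat {n : ℕ} (W : Fin n → Name → Prop) : LTL → Fin n → Prop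
  | .tt, _ => True
  | .task t, i => W i t
  | .neg φ, i => ¬ φ.Sat W i
  | .and φ ψ, i => φ.Sat W i ∧ ψ.Sat W i
  | .next φ, i => ∃ j : Fin n, j.val = i.val + 1 ∧ φ.Sat W j
  | .untl φ ψ, i => ∃ j : Fin n, i ≤ j ∧ ψ.Sat W j ∧ ∀ k : Fin n, i ≤ k → k < j → φ.Sat W k

/-- The tasks occurring in a formula. -/
def LTL.tasks : LTL → Finset Name
  | .tt => ∅
  | .task t => {t}
  | .neg φ => φ.tasks
  | .and φ ψ => φ.tasks ∪ ψ.tasks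
  | .next φ => φ.tasks
  | .untl φ ψ => φ.tasks ∪ ψ.tasks

/-- A process: its name (which is also the purpose its tasks are executed for), its temporal
constraints (read conjunctively), its separation-of-duty pairs of tasks and its binding-of-duty
pairs of tasks. -/
structure Proc : Type where
  name : Name
  constraints : List LTL
  sod : List (Name × Name)
  bod : List (Name × Name)

/-- The tasks that are involved in SoD or BoD constraints. -/
def Proc.dutyTasks (p : Proc) : List Name :=
  ((p.sod ++ p.bod).flatMap fun c => [c.1, c.2]).dedup

/-- All the tasks that the process mentions. -/
def Proc.tasks (p : Proc) : Finset Name :=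
  (p.constraints.map LTL.tasks).foldr (· ∪ ·) ∅ ∪ p.dutyTasks.toFinset

/-! ### Processes as words over a finite alphabet -/

/-- The alphabet in which processes are written down. -/
inductive Sym : Type where
  | zero | one | endName | tt | task | neg | and | next | untl | item | endList

/-- A name is written bit by bit and closed by an end marker. -/
def encodeName : Name → List Sym
  | [] => [.endName]
  | b :: x => (if b then .one else .zero) :: encodeName x

/-- Formulas are written in prefix notation. -/
def encodeLTL : LTL → List Sym
  | .tt => [.tt]
  | .task t => .task :: encodeName t
  | .neg φ => .neg :: encodeLTL φ
  | .and φ ψ => .and :: (encodeLTL φ ++ encodeLTL ψ)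
  | .next φ => .next :: encodeLTL φ
  | .untl φ ψ => .untl :: (encodeLTL φ ++ encodeLTL ψ)

/-- In a list every item is announced by a marker, and the list is closed by an end marker. -/
def encodeList {β : Type} (e : β → List Sym) : List β → List Sym
  | [] => [.endList]
  | b :: l => .item :: (e b ++ encodeList e l)

def encodePair (c : Name × Name) : List Sym := encodeName c.1 ++ encodeName c.2

/-- The word for a process; its length is the size of the process. -/
def Proc.encode (p : Proc) : List Sym :=
  encodeName p.name ++ (encodeList encodeLTL p.constraints ++
    (encodeList encodePair p.sod ++ encodeList encodePair p.bod))

theorem encodeName_prefix : ∀ (x y : Name) (u v : List Sym),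
    encodeName x ++ u = encodeName y ++ v → x = y ∧ u = v
  | [], [], u, v, h => by simpa [encodeName] using h
  | [], b :: y, u, v, h => by cases b <;> simp [encodeName] at h
  | a :: x, [], u, v, h => by cases a <;> simp [encodeName] at h
  | a :: x, b :: y, u, v, h => by
      have key : a = b ∧ encodeName x ++ u = encodeName y ++ v := by
        cases a <;> cases b <;> simp_all [encodeName]
      obtain ⟨h1, h2⟩ := encodeName_prefix x y u v key.2
      exact ⟨by rw [key.1, h1], h2⟩

theorem encodeLTL_prefix : ∀ (x y : LTL) (u v : List Sym),
    encodeLTL x ++ u = encodeLTL y ++ v → x = y ∧ u = v := by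
  intro x
  induction x with
  | tt => intro y u v h; cases y <;> simp_all [encodeLTL]
  | task t =>
    intro y u v h
    cases y <;> simp [encodeLTL] at h
    obtain ⟨h1, h2⟩ := encodeName_prefix _ _ _ _ h
    exact ⟨by rw [h1], h2⟩
  | neg φ ih =>
    intro y u v h
    cases y <;> simp [encodeLTL] at h
    obtain ⟨h1, h2⟩ := ih _ _ _ h
    exact ⟨by rw [h1], h2⟩
  | next φ ih =>
    intro y u v h
    cases y <;> simp [encodeLTL] at h
    obtain ⟨h1, h2⟩ := ih _ _ _ h
    exact ⟨by rw [h1], h2⟩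
  | and φ ψ ih1 ih2 =>
    intro y u v h
    cases y <;> simp [encodeLTL] at h
    obtain ⟨h1, h2⟩ := ih1 _ _ _ h
    obtain ⟨h3, h4⟩ := ih2 _ _ _ h2
    exact ⟨by rw [h1, h3], h4⟩
  | untl φ ψ ih1 ih2 =>
    intro y u v h
    cases y <;> simp [encodeLTL] at h
    obtain ⟨h1, h2⟩ := ih1 _ _ _ h
    obtain ⟨h3, h4⟩ := ih2 _ _ _ h2
    exact ⟨by rw [h1, h3], h4⟩

theorem encodePair_prefix (x y : Name × Name) (u v : List Sym)
    (h : encodePair x ++ u = encodePair y ++ v) : x = y ∧ u = v := by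
  simp only [encodePair, List.append_assoc] at h
  obtain ⟨h1, h2⟩ := encodeName_prefix _ _ _ _ h
  obtain ⟨h3, h4⟩ := encodeName_prefix _ _ _ _ h2
  exact ⟨Prod.ext h1 h3, h4⟩

theorem encodeList_prefix {β : Type} (e : β → List Sym)
    (he : ∀ x y u v, e x ++ u = e y ++ v → x = y ∧ u = v) :
    ∀ (l m : List β) (u v : List Sym),
      encodeList e l ++ u = encodeList e m ++ v → l = m ∧ u = v
  | [], [], u, v, h => by simpa [encodeList] using h
  | [], b :: m, u, v, h => by simp [encodeList] at h
  | a :: l, [], u, v, h => by simp [encodeList] at h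
  | a :: l, b :: m, u, v, h => by
      simp only [encodeList, List.cons_append, List.cons.injEq, true_and, List.append_assoc] at h
      obtain ⟨h1, h2⟩ := he _ _ _ _ h
      obtain ⟨h3, h4⟩ := encodeList_prefix e he l m u v h2
      exact ⟨by rw [h1, h3], h4⟩

/-- A word describes at most one process. -/
theorem Proc.encode_injective : Function.Injective Proc.encode := by
  rintro ⟨n, c, s, b⟩ ⟨n', c', s', b'⟩ h
  simp only [Proc.encode] at h
  obtain ⟨h1, h⟩ := encodeName_prefix _ _ _ _ h
  obtain ⟨h2, h⟩ := encodeList_prefix _ encodeLTL_prefix _ _ _ _ h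
  obtain ⟨h3, h⟩ := encodeList_prefix _ encodePair_prefix _ _ _ _ h
  obtain ⟨h4, -⟩ := encodeList_prefix _ encodePair_prefix b b' [] [] (by simpa using h)
  simp [h1, h2, h3, h4]

/-! ### The relational schema and the static policies -/

inductive Srt : Type where
  | process | subject | role | action | object | task | owner | purpose

/-- Relation symbols: the dynamic relation `request` and the static relations. -/
inductive Rel : Type where
  | request | userRole | rolePerm | auth | uses | accessibleFor

abbrev Rel.arity : Rel → ℕ
  | .request => 5
  | .userRole => 2
  | .rolePerm => 3
  | .auth => 3
  | .uses => 3
  | .accessibleFor => 3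

def Rel.sort : (r : Rel) → Fin r.arity → Srt
  | .request => ![.process, .subject, .task, .owner, .purpose]
  | .userRole => ![.subject, .role]
  | .rolePerm => ![.role, .action, .object]
  | .auth => ![.subject, .action, .object]
  | .uses => ![.action, .task, .object]
  | .accessibleFor => ![.owner, .object, .purpose]

/-- The static part of the schema. -/
def staticRels : List Rel := [.userRole, .rolePerm, .auth, .uses, .accessibleFor]

/-- A static database instance: an RBAC policy (user-role assignment and role-permission
assignment), the actions by which tasks use objects, and the purposes for which the objects of
data owners are accessible. -/
structure StaticDB : Type where
  /-- pairs (subject, role) -/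
  userRole : Finset (Name × Name)
  /-- triples (role, action, object) -/
  rolePerm : Finset (Name × Name × Name)
  /-- triples (action, task, object) -/
  uses : Finset (Name × Name × Name)
  /-- triples (owner, object, purpose) -/
  accessibleFor : Finset (Name × Name × Name)

/-- RBAC authorization: some role of the subject carries the permission. -/
def StaticDB.Auth (I : StaticDB) (sub act obj : Name) : Prop :=
  ∃ role, (sub, role) ∈ I.userRole ∧ (role, act, obj) ∈ I.rolePerm

/-- The static facts that hold in the instance. -/
def StaticDB.Holds (I : StaticDB) : (r : Rel) → (Fin r.arity → Name) → Prop
  | .request, _ => False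
  | .userRole, a => (a (0 : Fin 2), a (1 : Fin 2)) ∈ I.userRole
  | .rolePerm, a => (a (0 : Fin 3), a (1 : Fin 3), a (2 : Fin 3)) ∈ I.rolePerm
  | .auth, a => I.Auth (a (0 : Fin 3)) (a (1 : Fin 3)) (a (2 : Fin 3))
  | .uses, a => (a (0 : Fin 3), a (1 : Fin 3), a (2 : Fin 3)) ∈ I.uses
  | .accessibleFor, a => (a (0 : Fin 3), a (1 : Fin 3), a (2 : Fin 3)) ∈ I.accessibleFor

/-- The active domain of the static instance, sort by sort. -/
def StaticDB.adom (I : StaticDB) : Srt → Finset Name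
  | .process => ∅
  | .subject => I.userRole.image (·.1)
  | .role => I.userRole.image (·.2) ∪ I.rolePerm.image (·.1)
  | .action => I.rolePerm.image (·.2.1) ∪ I.uses.image (·.1)
  | .object => I.rolePerm.image (·.2.2) ∪ I.uses.image (·.2.2) ∪ I.accessibleFor.image (·.2.1)
  | .task => I.uses.image (·.2.1)
  | .owner => I.accessibleFor.image (·.1)
  | .purpose => I.accessibleFor.image (·.2.2)

/-! ### First-order temporal logic on finite traces of database instances -/

/-- Variables: the process id, the variables used for locally quantified subjects, data owners,
actions and objects, and for every task a variable for the subject in charge of it. -/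
inductive Var : Type where
  | id | sub | owner | act | obj
  | subOf (t : Name)
deriving DecidableEq

inductive Term : Type where
  | var (x : Var)
  | const (c : Name)

inductive Fml : Type where
  | tt : Fml
  | rel (r : Rel) (args : Fin r.arity → Term) : Fml
  | eq (a b : Term) : Fml
  | neg (φ : Fml) : Fml
  | and (φ ψ : Fml) : Fml
  | ex (s : Srt) (x : Var) (φ : Fml) : Fml
  | next (φ : Fml) : Fml
  | untl (φ ψ : Fml) : Fml

namespace Fml

def imp (φ ψ : Fml) : Fml := neg (and φ (neg ψ))

def all (s : Srt) (x : Var) (φ : Fml) : Fml := neg (ex s x (neg φ))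

def eventually (φ : Fml) : Fml := untl tt φ

def always (φ : Fml) : Fml := neg (eventually (neg φ))

def bigAnd (l : List Fml) : Fml := l.foldr and tt

end Fml

/-- A database instance (static and dynamic part). -/
abbrev Instance : Type := (r : Rel) → (Fin r.arity → Name) → Prop

def Term.eval (v : Var → Name) : Term → Name
  | .var x => v x
  | .const c => c

def Term.subst (x : Var) (c : Name) : Term → Term
  | .var y => if y = x then .const c else .var y
  | .const d => .const d

/-- `φ.subst x c` is `φ[c/x]`: the free occurrences of `x` are replaced by the constant `c`. -/
def Fml.subst (x : Var) (c : Name) : Fml → Fml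
  | .tt => .tt
  | .rel r args => .rel r fun i => (args i).subst x c
  | .eq a b => .eq (a.subst x c) (b.subst x c)
  | .neg φ => .neg (φ.subst x c)
  | .and φ ψ => .and (φ.subst x c) (ψ.subst x c)
  | .ex s y φ => .ex s y (if y = x then φ else φ.subst x c)
  | .next φ => .next (φ.subst x c)
  | .untl φ ψ => .untl (φ.subst x c) (ψ.subst x c)

/-- The range of the quantifiers of each sort: all (infinitely many) process ids for the sort of
processes, the active domain of the static instance for the other sorts. -/
def StaticDB.range (I : StaticDB) : Srt → Set Name
  | .process => Set.univ
  | s => ↑(I.adom s)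

/-- Truth of a formula at an instant of a finite trace, where the quantifiers of sort `s` range
over `D s` and `v` is the valuation of the free variables. -/
def Fml.Sat (D : Srt → Set Name) {n : ℕ} (T : Fin n → Instance) :
    Fml → (Var → Name) → Fin n → Prop
  | .tt, _, _ => True
  | .rel r args, v, i => T i r fun k => (args k).eval v
  | .eq a b, v, _ => a.eval v = b.eval v
  | .neg φ, v, i => ¬ φ.Sat D T v i
  | .and φ ψ, v, i => φ.Sat D T v i ∧ ψ.Sat D T v i
  | .ex s x φ, v, i => ∃ d ∈ D s, φ.Sat D T (Function.update v x d) i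
  | .next φ, v, i => ∃ j : Fin n, j.val = i.val + 1 ∧ φ.Sat D T v j
  | .untl φ ψ, v, i =>
      ∃ j : Fin n, i ≤ j ∧ ψ.Sat D T v j ∧ ∀ k : Fin n, i ≤ k → k < j → φ.Sat D T v k

/-- Satisfiability over nonempty finite traces in which exactly one request is made at each
instant (one task is performed at a time). -/
def Satisfiable (D : Srt → Set Name) (φ : Fml) : Prop :=
  ∃ (n : ℕ) (T : Fin (n + 1) → Instance) (v : Var → Name),
    (∀ i, ∃! a, T i .request a) ∧ φ.Sat D T v 0

/-! ### The formulas `Ψ_proc` and `□ I_st` -/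

/-- `request(id, sub, t, do, proc)`. -/
def requestFml (p : Proc) (sub : Term) (t : Name) : Fml :=
  .rel .request (![.var .id, sub, .const t, .var .owner, .const p.name] : Fin 5 → Term)

/-- `∀ act, obj. uses(act, t, obj) → (accessibleFor(do, obj, proc) ∧ auth(sub, act, obj))`. -/
def policyFml (p : Proc) (sub : Term) (t : Name) : Fml :=
  .all .action .act <| .all .object .obj <|
    .imp (.rel .uses (![.var .act, .const t, .var .obj] : Fin 3 → Term))
      (.and (.rel .accessibleFor (![.var .owner, .var .obj, .const p.name] : Fin 3 → Term))
        (.rel .auth (![sub, .var .act, .var .obj] : Fin 3 → Term)))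

/-- Task `t` is requested and the policies are met.  The subject is locally quantified, unless the
task is involved in an SoD or BoD constraint: then it is the across-state variable `subOf t`. -/
def performFml (p : Proc) (t : Name) : Fml :=
  if t ∈ p.dutyTasks then
    .ex .owner .owner (.and (requestFml p (.var (.subOf t)) t) (policyFml p (.var (.subOf t)) t))
  else
    .ex .subject .sub <| .ex .owner .owner <|
      .and (requestFml p (.var .sub) t) (policyFml p (.var .sub) t)

/-- Task `t` is requested (by anybody). -/
def requestedFml (p : Proc) (t : Name) : Fml :=
  .ex .subject .sub <| .ex .owner .owner <| requestFml p (.var .sub) t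

/-- First-order translation of a temporal constraint.  The Boolean is the polarity of the
occurrence: a positive occurrence of a task says that the task is requested in compliance with the
policies, a negative occurrence that it is requested. -/
def translate (p : Proc) : Bool → LTL → Fml
  | _, .tt => .tt
  | true, .task t => performFml p t
  | false, .task t => requestedFml p t
  | b, .neg φ => .neg (translate p (!b) φ)
  | b, .and φ ψ => .and (translate p b φ) (translate p b ψ)
  | b, .next φ => .next (translate p b φ)
  | b, .untl φ ψ => .untl (translate p b φ) (translate p b ψ)

/-- The formula `Ψ_proc(id)`, whose only free variable is `id`: the subjects in charge of the tasks
involved in SoD and BoD constraints are quantified in front of the temporal operators. -/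
def Psi (p : Proc) : Fml :=
  p.dutyTasks.foldr (fun t φ => .ex .subject (.subOf t) φ)
    (.and (.bigAnd (p.constraints.map (translate p true)))
      (.and
        (.bigAnd (p.sod.map fun c => .neg (.eq (.var (.subOf c.1)) (.var (.subOf c.2)))))
        (.bigAnd (p.bod.map fun c => .eq (.var (.subOf c.1)) (.var (.subOf c.2))))))

/-- The constants of the decision problem: the active domain of the static instance, the tasks of
the process and its name. -/
def constants (I : StaticDB) (p : Proc) : Srt → Finset Name
  | .task => I.adom .task ∪ p.tasks
  | .purpose => insert p.name (I.adom .purpose)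
  | s => I.adom s

open Classical in
/-- The static instance as a formula: the conjunction of all positive and, by complete
information, of all negative facts over the domain `D`. -/
noncomputable def StaticDB.toFml (I : StaticDB) (D : Srt → Finset Name) : Fml :=
  .bigAnd <| staticRels.flatMap fun r =>
    (Fintype.piFinset fun i => D (r.sort i)).toList.map fun a =>
      if I.Holds r a then .rel r (fun i => .const (a i))
      else .neg (.rel r fun i => .const (a i))

/-- `Ψ_proc[id/id] ∧ □ I_st`. -/
noncomputable def completionFml (I : StaticDB) (p : Proc) (id : Name) : Fml :=
  .and ((Psi p).subst .id id) (.always (I.toFml (constants I p)))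

/-! ### Successful completion of a process -/

/-- A request: subject `sub` asks to execute `task` on behalf of the data owner `owner` for
`purpose`, in the process instance `pid`. -/
structure Request : Type where
  pid : Name
  sub : Name
  task : Name
  owner : Name
  purpose : Name

/-- The request belongs to the instance `id` of the process `p`. -/
def Request.IsOf (q : Request) (p : Proc) (id : Name) : Prop :=
  q.pid = id ∧ q.purpose = p.name

/-- The request complies with the policies: the subject and the owner are known, and the subject is
authorized for each action the task performs on each object, the object being accessible for the
purpose. -/
def Request.Allowed (I : StaticDB) (q : Request) : Prop :=
  q.sub ∈ I.adom .subject ∧ q.owner ∈ I.adom .owner ∧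
    ∀ act obj, (act, q.task, obj) ∈ I.uses →
      (q.owner, obj, q.purpose) ∈ I.accessibleFor ∧ I.Auth q.sub act obj

/-- The run (one request per instant, possibly interleaved with requests of other process
instances) successfully executes the instance `id` of `p` under the policies `I`, where `charge`
tells which subject is in charge of each of the tasks involved in SoD and BoD constraints. -/
structure Completes (I : StaticDB) (p : Proc) (id : Name) {n : ℕ}
    (run : Fin (n + 1) → Request) (charge : Name → Name) : Prop where
  /-- the sequence of performed tasks satisfies the temporal constraints -/
  constraints : ∀ φ ∈ p.constraints,
    φ.Sat (fun i t => (run i).IsOf p id ∧ (run i).task = t) 0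
  /-- all the requests of the process instance comply with the policies -/
  allowed : ∀ i, (run i).IsOf p id → (run i).Allowed I
  /-- each task involved in SoD or BoD constraints is performed by the subject in charge only -/
  charge_mem : ∀ t ∈ p.dutyTasks, charge t ∈ I.adom .subject
  charge_eq : ∀ i, (run i).IsOf p id → (run i).task ∈ p.dutyTasks →
    (run i).sub = charge (run i).task
  sod : ∀ c ∈ p.sod, charge c.1 ≠ charge c.2
  bod : ∀ c ∈ p.bod, charge c.1 = charge c.2

/-- The process can be successfully completed given the policies. -/
def CanComplete (I : StaticDB) (p : Proc) : Prop :=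
  ∃ (id : Name) (n : ℕ) (run : Fin (n + 1) → Request) (charge : Name → Name),
    Completes I p id run charge

/-- Proc completion as a decision problem on words, for fixed policies. -/
def completionProblem (I : StaticDB) : Language Sym :=
  {w | ∃ p : Proc, p.encode = w ∧ CanComplete I p}

end PurposeAware

/-! Upper bound. The static database is fixed, so a finite control may depend on it. A process asks
the database only whether a task can be performed for its purpose, possibly by a prescribed subject.
Names longer than every name in the database behave alike there, so truncated names suffice
(`StaticDB.Performable.of_trunc_eq`).

Finite-trace LTL can be evaluated backwards in time: the values at an instant depend on the task
performed then and on the values at the following instant. One right-to-left pass over the encoding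
therefore processes one instant, with the values of the subformulas and the subjects in charge
stored as annotations of the symbols (`pass_cells`). The same pass parses the word. A guess is a
sequence of letters (task name, mode): choose subjects for the duty tasks, then guess the trace from
its last instant to its first. Some sequence of letters is accepted iff the process can be completed
(`canComplete_of_accepts`, `exists_accepts_of_canComplete`).

On words of length `n` there are only exponentially many annotations, so by cutting out loops a
shortest accepting sequence is exponentially short (`exists_short_accepts`). Written on a tape it
fits into exponential space, and a deterministic machine tries all tapes of that length with an
odometer; Savitch's theorem is not needed. The machine is written as a structured program with a
total-correctness calculus that also bounds the stack heights, and `StackProg.inEXPSPACE` compiles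
it to a Turing machine.

Logical characterisation. In the trace of a successful run every relevant request complies with the
policies, so the positive and the negative translation of a task agree and the formula holds
(`sat_translate_iff`). Conversely, in a model, the requests that violate a policy or come from the
wrong subject are handed over to another process id. Positive atoms survive this and negative ones
only become easier to satisfy, so the constraints hold of the remaining run
(`sat_of_sat_translate`). The choice of process id is immaterial by renaming. -/

/-! ### A structured programming language for stack machines -/

/-- While programs acting on finitely many stacks (`Γ k` is the alphabet of stack `k`) and on a
register of type `σ`. -/
inductive StackProg (K : Type) (Γ : K → Type) (σ : Type) : Type
  | push (k : K) (f : σ → Γ k)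
  | pop (k : K) (f : σ → Option (Γ k) → σ)
  | peek (k : K) (f : σ → Option (Γ k) → σ)
  | load (f : σ → σ)
  | seq (P Q : StackProg K Γ σ)
  | ite (c : σ → Bool) (P Q : StackProg K Γ σ)
  | loop (c : σ → Bool) (P : StackProg K Γ σ)

namespace StackProg

open Turing Function

variable {K : Type} {Γ : K → Type} {σ : Type}

/-- `Exec B P v S v' S'`: started in register state `v` with stacks `S`, the program `P` terminates
in `v'` and `S'`, and no stack is ever pushed to a height above `B`. -/
inductive Exec [DecidableEq K] (B : ℕ) : StackProg K Γ σ →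
    σ → (∀ k, List (Γ k)) → σ → (∀ k, List (Γ k)) → Prop
  | push {k f v S} : (S k).length < B → Exec B (push k f) v S v (update S k (f v :: S k))
  | pop {k f v S} : Exec B (pop k f) v S (f v (S k).head?) (update S k (S k).tail)
  | peek {k f v S} : Exec B (peek k f) v S (f v (S k).head?) S
  | load {f v S} : Exec B (load f) v S (f v) S
  | seq {P Q v₁ S₁ v₂ S₂ v₃ S₃} : Exec B P v₁ S₁ v₂ S₂ → Exec B Q v₂ S₂ v₃ S₃ →
      Exec B (seq P Q) v₁ S₁ v₃ S₃
  | ite_true {c P Q v S v' S'} : c v = true → Exec B P v S v' S' → Exec B (ite c P Q) v S v' S'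
  | ite_false {c P Q v S v' S'} : c v = false → Exec B Q v S v' S' → Exec B (ite c P Q) v S v' S'
  | loop_true {c P v₁ S₁ v₂ S₂ v₃ S₃} : c v₁ = true → Exec B P v₁ S₁ v₂ S₂ →
      Exec B (loop c P) v₂ S₂ v₃ S₃ → Exec B (loop c P) v₁ S₁ v₃ S₃
  | loop_false {c P v S} : c v = false → Exec B (loop c P) v S v S

/-- Total correctness: the program terminates within the space bound, and the postcondition holds
afterwards. -/
def Wp [DecidableEq K] (B : ℕ) (P : StackProg K Γ σ) (Q : σ → (∀ k, List (Γ k)) → Prop) (v : σ)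
    (S : ∀ k, List (Γ k)) : Prop :=
  ∃ v' S', Exec B P v S v' S' ∧ Q v' S'

section Wp

variable [DecidableEq K] {B : ℕ} {Q R : σ → (∀ k, List (Γ k)) → Prop} {v : σ}
  {S : ∀ k, List (Γ k)}

theorem Wp.mono {P : StackProg K Γ σ} (h : Wp B P Q v S) (hQR : ∀ v S, Q v S → R v S) :
    Wp B P R v S := by
  obtain ⟨v', S', h1, h2⟩ := h
  exact ⟨v', S', h1, hQR _ _ h2⟩

theorem wp_push {k : K} {f : σ → Γ k} :
    Wp B (push k f) Q v S ↔ (S k).length < B ∧ Q v (update S k (f v :: S k)) := by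
  constructor
  · rintro ⟨_, _, ⟨h⟩, hQ⟩
    exact ⟨by assumption, hQ⟩
  · rintro ⟨h, hQ⟩
    exact ⟨_, _, .push h, hQ⟩

theorem wp_pop {k : K} {f : σ → Option (Γ k) → σ} :
    Wp B (pop k f) Q v S ↔ Q (f v (S k).head?) (update S k (S k).tail) := by
  constructor
  · rintro ⟨_, _, ⟨⟩, hQ⟩
    exact hQ
  · intro hQ
    exact ⟨_, _, .pop, hQ⟩

theorem wp_peek {k : K} {f : σ → Option (Γ k) → σ} :
    Wp B (peek k f) Q v S ↔ Q (f v (S k).head?) S := by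
  constructor
  · rintro ⟨_, _, ⟨⟩, hQ⟩
    exact hQ
  · intro hQ
    exact ⟨_, _, .peek, hQ⟩

theorem wp_load {f : σ → σ} : Wp B (load f) Q v S ↔ Q (f v) S := by
  constructor
  · rintro ⟨_, _, ⟨⟩, hQ⟩
    exact hQ
  · intro hQ
    exact ⟨_, _, .load, hQ⟩

theorem wp_seq {P P' : StackProg K Γ σ} :
    Wp B (seq P P') Q v S ↔ Wp B P (Wp B P' Q) v S := by
  constructor
  · rintro ⟨_, _, ⟨⟩, hQ⟩
    exact ⟨_, _, by assumption, _, _, by assumption, hQ⟩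
  · rintro ⟨_, _, h, _, _, h', hQ⟩
    exact ⟨_, _, .seq h h', hQ⟩

theorem wp_ite {c : σ → Bool} {P P' : StackProg K Γ σ} :
    Wp B (ite c P P') Q v S ↔ if c v = true then Wp B P Q v S else Wp B P' Q v S := by
  split_ifs with hc
  · constructor
    · rintro ⟨_, _, h, hQ⟩
      cases h with
      | ite_true _ h => exact ⟨_, _, h, hQ⟩
      | ite_false hc' _ => simp [hc] at hc'
    · rintro ⟨_, _, h, hQ⟩
      exact ⟨_, _, .ite_true hc h, hQ⟩
  · constructor
    · rintro ⟨_, _, h, hQ⟩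
      cases h with
      | ite_true hc' _ => exact absurd hc' hc
      | ite_false _ h => exact ⟨_, _, h, hQ⟩
    · rintro ⟨_, _, h, hQ⟩
      exact ⟨_, _, .ite_false (by simpa using hc) h, hQ⟩

theorem wp_loop_true {c : σ → Bool} {P : StackProg K Γ σ} (hc : c v = true)
    (h : Wp B P (Wp B (loop c P) Q) v S) : Wp B (loop c P) Q v S := by
  obtain ⟨_, _, h, _, _, h', hQ⟩ := h
  exact ⟨_, _, .loop_true hc h h', hQ⟩

theorem wp_loop_false {c : σ → Bool} {P : StackProg K Γ σ} (hc : c v = false) (h : Q v S) :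
    Wp B (loop c P) Q v S :=
  ⟨_, _, .loop_false hc, h⟩

/-- A loop with an invariant and a variant. -/
theorem wp_loop {c : σ → Bool} {P : StackProg K Γ σ} (Inv : ℕ → σ → (∀ k, List (Γ k)) → Prop)
    (hstep : ∀ n v S, Inv n v S → c v = true → Wp B P (fun v S => ∃ m < n, Inv m v S) v S)
    (hend : ∀ n v S, Inv n v S → c v = false → Q v S) :
    ∀ (n : ℕ) {v : σ} {S : ∀ k, List (Γ k)}, Inv n v S → Wp B (loop c P) Q v S := by
  intro n
  induction n using Nat.strong_induction_on with
  | _ n ih =>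
    intro v S h
    cases hc : c v with
    | true =>
      refine wp_loop_true hc ((hstep n v S h hc).mono ?_)
      rintro v' S' ⟨m, hm, h'⟩
      exact ih m hm h'
    | false => exact wp_loop_false hc (hend n v S h hc)

/-- `each k g c P` pops the stack `k` into the register by `g` until it is empty (which `c`
detects), and runs `P` after each successful pop. -/
def each (k : K) (g : σ → Option (Γ k) → σ) (c : σ → Bool) (P : StackProg K Γ σ) :
    StackProg K Γ σ :=
  seq (pop k g) (loop c (seq P (pop k g)))

/-- The invariant is indexed by what is left on stack `k`, and this list is itself the variant, so
termination needs no further argument. -/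
theorem wp_each {k : K} {g : σ → Option (Γ k) → σ} {c : σ → Bool} {P : StackProg K Γ σ}
    (Inv : List (Γ k) → σ → (∀ k, List (Γ k)) → Prop) (l : List (Γ k))
    (hk : ∀ l v S, Inv l v S → S k = l)
    (hc : ∀ v a, c (g v a) = a.isSome)
    (hstep : ∀ a l v S, Inv (a :: l) v S → Wp B P (Inv l) (g v (some a)) (update S k l))
    (hend : ∀ v S, Inv [] v S → Q (g v none) S)
    (h : Inv l v S) : Wp B (each k g c P) Q v S := by
  rw [each, wp_seq, wp_pop]
  induction l generalizing v S with
  | nil =>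
    have h1 := hk _ _ _ h
    have h2 : update S k (S k).tail = S := by rw [h1, List.tail_nil, ← h1, update_eq_self]
    rw [h2, h1]
    exact wp_loop_false (hc _ _) (hend _ _ h)
  | cons a l ih =>
    have h1 := hk _ _ _ h
    rw [h1]
    refine wp_loop_true (hc _ _) ?_
    rw [wp_seq]
    refine (hstep a l v S h).mono ?_
    intro v' S' h'
    rw [wp_pop]
    exact ih h'

/-- `rep n P` runs `P` for `n` times. -/
def rep (n : ℕ) (P : StackProg K Γ σ) : StackProg K Γ σ :=
  match n with
  | 0 => load id
  | n + 1 => seq P (rep n P)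

theorem wp_rep {P : StackProg K Γ σ} (Inv : ℕ → σ → (∀ k, List (Γ k)) → Prop) (n : ℕ)
    (hstep : ∀ n v S, Inv (n + 1) v S → Wp B P (Inv n) v S)
    (hend : ∀ v S, Inv 0 v S → Q v S) (h : Inv n v S) : Wp B (rep n P) Q v S := by
  induction n generalizing v S with
  | zero => exact wp_load.2 (hend _ _ h)
  | succ n ih => exact wp_seq.2 ((hstep n v S h).mono fun _ _ h' => ih h')

end Wp

/-! ### Compilation -/

/-- The control points of a program. -/
def Label : StackProg K Γ σ → Type
  | push _ _ => Unit
  | pop _ _ => Unit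
  | peek _ _ => Unit
  | load _ => Unit
  | seq P Q => Label P ⊕ Label Q
  | ite _ P Q => Option (Label P ⊕ Label Q)
  | loop _ P => Option (Label P)

theorem finite_label : ∀ P : StackProg K Γ σ, Finite (Label P)
  | push _ _ => inferInstanceAs (Finite Unit)
  | pop _ _ => inferInstanceAs (Finite Unit)
  | peek _ _ => inferInstanceAs (Finite Unit)
  | load _ => inferInstanceAs (Finite Unit)
  | seq P Q =>
    have := finite_label P
    have := finite_label Q
    inferInstanceAs (Finite (Label P ⊕ Label Q))
  | ite _ P Q =>
    have := finite_label P
    have := finite_label Q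
    inferInstanceAs (Finite (Option (Label P ⊕ Label Q)))
  | loop _ P =>
    have := finite_label P
    inferInstanceAs (Finite (Option (Label P)))

def entry : ∀ P : StackProg K Γ σ, Label P
  | push _ _ => ()
  | pop _ _ => ()
  | peek _ _ => ()
  | load _ => ()
  | seq P _ => Sum.inl (entry P)
  | ite _ _ _ => none
  | loop _ _ => none

/-- The statement at a control point of a program which is embedded by `inj` into a larger one and
continues at `exit`. -/
def code {Λ : Type} : ∀ P : StackProg K Γ σ, (Label P → Λ) → Λ → Label P → TM2.Stmt Γ Λ σ
  | push k f, _, exit, _ => .push k f (.goto fun _ => exit)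
  | pop k f, _, exit, _ => .pop k f (.goto fun _ => exit)
  | peek k f, _, exit, _ => .peek k f (.goto fun _ => exit)
  | load f, _, exit, _ => .load f (.goto fun _ => exit)
  | seq P Q, inj, exit, l =>
    match l with
    | Sum.inl l => code P (fun l => inj (Sum.inl l)) (inj (Sum.inr (entry Q))) l
    | Sum.inr l => code Q (fun l => inj (Sum.inr l)) exit l
  | ite c P Q, inj, exit, l =>
    match l with
    | none => .branch c (.goto fun _ => inj (some (Sum.inl (entry P))))
        (.goto fun _ => inj (some (Sum.inr (entry Q))))
    | some (Sum.inl l) => code P (fun l => inj (some (Sum.inl l))) exit l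
    | some (Sum.inr l) => code Q (fun l => inj (some (Sum.inr l))) exit l
  | loop c P, inj, exit, l =>
    match l with
    | none => .branch c (.goto fun _ => inj (some (entry P))) (.goto fun _ => exit)
    | some l => code P (fun l => inj (some l)) (inj none) l

/-- Reachability through configurations whose stacks have height at most `B`. -/
def BReach [DecidableEq K] {Λ : Type} (B : ℕ) (m : Λ → TM2.Stmt Γ Λ σ) :
    TM2.Cfg Γ Λ σ → TM2.Cfg Γ Λ σ → Prop :=
  Relation.ReflTransGen fun a b => TM2.step m a = some b ∧ ∀ k, (b.stk k).length ≤ B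

section

variable [DecidableEq K]

theorem Exec.bound {B : ℕ} {P : StackProg K Γ σ} {v S v' S'} (h : Exec B P v S v' S')
    (hS : ∀ k, (S k).length ≤ B) : ∀ k, (S' k).length ≤ B := by
  induction h with
  | @push k f v S hlt =>
    intro j
    rcases eq_or_ne j k with rfl | hj
    · simpa using hlt
    · simpa [update_of_ne hj] using hS j
  | @pop k f v S =>
    intro j
    rcases eq_or_ne j k with rfl | hj
    · simpa using (Nat.sub_le _ _).trans (hS j)
    · simpa [update_of_ne hj] using hS j
  | peek | load | loop_false => exact hS
  | seq _ _ ih1 ih2 => exact ih2 (ih1 hS)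
  | ite_true _ _ ih => exact ih hS
  | ite_false _ _ ih => exact ih hS
  | loop_true _ _ _ ih1 ih2 => exact ih2 (ih1 hS)

/-- Correctness of compilation. `exit` has to vary in the induction: the first half of a sequence
exits to the entry of the second half, and a loop body exits to the loop test. -/
theorem Exec.reach {B : ℕ} {P : StackProg K Γ σ} {v S v' S'} (h : Exec B P v S v' S')
    (hS : ∀ k, (S k).length ≤ B) {Λ : Type} (m : Λ → TM2.Stmt Γ Λ σ) (inj : Label P → Λ)
    (exit : Λ) (hm : ∀ l, m (inj l) = code P inj exit l) :
    BReach B m ⟨some (inj (entry P)), v, S⟩ ⟨some exit, v', S'⟩ := by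
  induction h generalizing exit with
  | @push k f v S hlt =>
    exact .single ⟨by simp [TM2.step, hm, code], (Exec.push (f := f) (v := v) hlt).bound hS⟩
  | @pop k f v S =>
    exact .single ⟨by simp [TM2.step, hm, code], (Exec.pop (f := f) (v := v)).bound hS⟩
  | peek => exact .single ⟨by simp [TM2.step, hm, code], hS⟩
  | load => exact .single ⟨by simp [TM2.step, hm, code], hS⟩
  | seq h1 h2 ih1 ih2 =>
    exact (ih1 hS _ _ fun l => hm (Sum.inl l)).trans
      (ih2 (h1.bound hS) (fun l => inj (Sum.inr l)) exit fun l => hm (Sum.inr l))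
  | ite_true hc h ih =>
    refine .head ⟨?_, hS⟩ (ih hS (fun l => inj (some (Sum.inl l))) exit
      fun l => hm (some (Sum.inl l)))
    change some (TM2.stepAux (m (inj none)) _ _) = _
    rw [hm none]
    simp [code, hc]
  | ite_false hc h ih =>
    refine .head ⟨?_, hS⟩ (ih hS (fun l => inj (some (Sum.inr l))) exit
      fun l => hm (some (Sum.inr l)))
    change some (TM2.stepAux (m (inj none)) _ _) = _
    rw [hm none]
    simp [code, hc]
  | loop_true hc h1 h2 ih1 ih2 =>
    refine .head ⟨?_, hS⟩ ((ih1 hS (fun l => inj (some l)) (inj none)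
      fun l => hm (some l)).trans (ih2 (h1.bound hS) inj exit hm))
    change some (TM2.stepAux (m (inj none)) _ _) = _
    rw [hm none]
    simp [code, hc]
  | loop_false hc =>
    refine .single ⟨?_, hS⟩
    change some (TM2.stepAux (m (inj none)) _ _) = _
    rw [hm none]
    simp [code, hc]

end

/-- If a halting computation stays within a bound, so does every configuration on the way. -/
theorem BReach.all [DecidableEq K] {Λ : Type} {B : ℕ} {m : Λ → TM2.Stmt Γ Λ σ}
    {a h : TM2.Cfg Γ Λ σ} (hr : BReach B m a h) (hh : TM2.step m h = none)
    (ha : ∀ k, (a.stk k).length ≤ B) {c : TM2.Cfg Γ Λ σ}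
    (hc : StateTransition.Reaches (TM2.step m) a c) : ∀ k, (c.stk k).length ≤ B := by
  induction hr using Relation.ReflTransGen.head_induction_on with
  | refl =>
    rcases Relation.ReflTransGen.cases_head hc with rfl | ⟨d, hd, _⟩
    · exact ha
    · simp [hh] at hd
  | head hab _ ih =>
    rcases Relation.ReflTransGen.cases_head hc with rfl | ⟨d, hd, hdc⟩
    · exact ha
    -- The machine is deterministic, so the first step towards `c` is the first step of the bounded
    -- computation.
    · rw [hab.1, Option.mem_some_iff] at hd
      subst hd
      exact ih hab.2 hdc

/-- The left side is the form in which `initList` and `haltList` describe their stacks. -/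
theorem dite_eq_update [DecidableEq K] (j : K) (l : List (Γ j)) (k : K) :
    (if h : k = j then (by rw [h]; exact l : List (Γ k)) else [])
      = update (fun k => ([] : List (Γ k))) j l k := by
  by_cases hk : k = j
  · subst hk
    simp
  · simp [hk]

/-- The program as a bundled machine. -/
noncomputable def machine [DecidableEq K] [Fintype K] [∀ k, Finite (Γ k)] [Finite σ]
    (P : StackProg K Γ σ) (k₀ k₁ : K) (v₀ : σ) : FinTM2 :=
  letI := finite_label P
  letI : Fintype (Option (Label P)) := Fintype.ofFinite _
  letI : Fintype σ := Fintype.ofFinite _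
  letI : Fintype (Γ k₀) := Fintype.ofFinite _
  { K := K, k₀ := k₀, k₁ := k₁, Γ := Γ, Λ := Option (Label P), main := some (entry P), σ := σ
    initialState := v₀
    m := fun
      -- `haltList` demands the initial register state, so the register is reset before halting.
      | none => .load (fun _ => v₀) .halt
      | some l => code P some none l }

open PurposeAware

open Classical in
/-- A language is decided in exponential space if some program decides it with stacks of
exponential height. -/
theorem inEXPSPACE [DecidableEq K] [Fintype K] [∀ k, Finite (Γ k)] [Finite σ]
    (P : StackProg K Γ σ) {k₀ k₁ : K} (v₀ : σ) {α : Type} (inp : Γ k₀ ≃ α) (out : Γ k₁ ≃ Bool)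
    (L : Language α) (B : ℕ → ℕ) (hB : ∀ n, n ≤ B n) (p : Polynomial ℕ)
    (hp : ∀ n, Fintype.card K * B n ≤ 2 ^ p.eval n)
    (hP : ∀ w : List α, Wp (B w.length) P
      (fun _ S => S = update (fun _ => []) k₁ [out.symm (decide (w ∈ L))]) v₀
      (update (fun _ => []) k₀ (w.map inp.symm))) :
    InEXPSPACE L := by
  refine ⟨machine P k₀ k₁ v₀, inp, out, p,
    inferInstanceAs (∀ k, Finite (Γ k)), fun w => ?_⟩
  obtain ⟨v', S', h, hS'⟩ := hP w
  have hi : initList (machine P k₀ k₁ v₀) (w.map inp.symm)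
      = ⟨some (some (entry P)), v₀, update (fun _ => []) k₀ (w.map inp.symm)⟩ := by
    unfold initList
    congr 1
    exact funext (dite_eq_update k₀ (w.map inp.symm))
  have hf : haltList (machine P k₀ k₁ v₀) [out.symm (decide (w ∈ L))]
      = ⟨none, v₀, update (fun _ => []) k₁ [out.symm (decide (w ∈ L))]⟩ := by
    unfold haltList
    congr 1
    exact funext (dite_eq_update k₁ [out.symm (decide (w ∈ L))])
  have hS : ∀ k, ((update (fun _ => []) k₀ (w.map inp.symm) : ∀ k, List (Γ k)) k).length
      ≤ B w.length := by
    intro k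
    by_cases hk : k = k₀
    · subst hk
      simpa using hB _
    · simp [hk]
  -- The compiled program exits at the label `none`; the halting statement stored there accounts for
  -- one more step.
  have h1 := h.reach hS (machine P k₀ k₁ v₀).m some none fun l => rfl
  have h2 : BReach (B w.length) (machine P k₀ k₁ v₀).m
      (initList (machine P k₀ k₁ v₀) (w.map inp.symm))
      (haltList (machine P k₀ k₁ v₀) [out.symm (decide (w ∈ L))]) := by
    rw [hi, hf]
    refine h1.tail ⟨?_, ?_⟩
    · rw [hS']
      rfl
    · exact hS' ▸ h.bound hS
  have h3 : (machine P k₀ k₁ v₀).step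
      (haltList (machine P k₀ k₁ v₀) [out.symm (decide (w ∈ L))]) = none := by
    rw [hf]
    rfl
  constructor
  · have h4 : StateTransition.Reaches (machine P k₀ k₁ v₀).step
        (initList (machine P k₀ k₁ v₀) (w.map inp.symm))
        (haltList (machine P k₀ k₁ v₀) [out.symm (decide (w ∈ L))]) :=
      Relation.ReflTransGen.mono (fun _ _ h => h.1) _ _ h2
    obtain ⟨n, hn⟩ : ∃ n, (flip bind (machine P k₀ k₁ v₀).step)^[n]
        (some (initList (machine P k₀ k₁ v₀) (w.map inp.symm)))
        = some (haltList (machine P k₀ k₁ v₀) [out.symm (decide (w ∈ L))]) := by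
      generalize haltList (machine P k₀ k₁ v₀) [out.symm (decide (w ∈ L))] = c at h4
      induction h4 with
      | refl => exact ⟨0, rfl⟩
      | tail _ hbc ih =>
        obtain ⟨n, hn⟩ := ih
        refine ⟨n + 1, ?_⟩
        rw [iterate_succ_apply', hn]
        exact hbc
    exact ⟨⟨n, hn⟩⟩
  · intro c hc
    have h5 : ∀ k, (c.stk k).length ≤ B w.length :=
      BReach.all h2 h3 (by rw [hi]; exact hS) hc
    refine le_trans ?_ (hp w.length)
    have h6 : cfgSpace (machine P k₀ k₁ v₀) c ≤ ∑ _k : K, B w.length :=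
      Finset.sum_le_sum fun k _ => h5 k
    simpa using h6

end StackProg

/-! ### One instant, evaluated in one pass over the encoding -/

namespace PurposeAware

/-! ### Annotated words and the evaluation of one instant -/

/-- A finite abstraction of names, together with the question whether, for a purpose, a task can be
performed, possibly by a given subject only. -/
structure Oracle (S T : Type) : Type where
  nil : T
  cons : Bool → T → T
  perf : T → T → Option S → Bool

/-- A right fold, so that the abstraction can be updated bit by bit while a name is read from its
last bit to its first. -/
def Oracle.tr {S T : Type} (O : Oracle S T) (x : Name) : T := x.foldr O.cons O.nil

/-- What is done with the current task name `X`: put a subject (or nobody) in charge of `X`, let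
an instant pass in which no task is performed, or perform `X`. -/
inductive Mode (S : Type) : Type where
  | assign (o : Option S)
  | idle
  | perform

def Mode.isEval {S : Type} : Mode S → Bool
  | .assign _ => false
  | _ => true

def Mode.isPerform {S : Type} : Mode S → Bool
  | .perform => true
  | _ => false

/-- The subject in charge of a task after the step; `e` tells whether the task is `X`. -/
def Mode.reassign {S : Type} (m : Mode S) (e : Bool) (old : Option S) : Option S :=
  match m with
  | .assign o => if e then o else old
  | _ => old

/-- A symbol with its annotations: the truth value, at the following instant, of the formula that
starts here, and the subject in charge of the task that has been written down next to it. -/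
structure Cell (S : Type) : Type where
  sym : Sym
  val : Bool
  sub : Option S

def Cell.plain {S : Type} (s : Sym) : Cell S := ⟨s, false, none⟩

/-- The phases of reading the encoding of a process from right to left. -/
inductive Phase : Type where
  | start
  | list (sod : Bool)
  | snd (sod : Bool)
  | fst (sod : Bool)
  | form
  | leaf
  | fail

def Phase.isName : Phase → Bool
  | .snd _ => true
  | .fst _ => true
  | .leaf => true
  | _ => false

structure Ctl (S : Type) : Type where
  phase : Phase
  /-- the subject in charge of `X`, if `X` is a duty task -/
  duty : Option S
  /-- the subject in charge of the second task of the current pair -/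
  partner : Option S
  /-- all constraints read so far hold -/
  ok : Bool

def Ctl.init {S : Type} : Ctl S := ⟨.start, none, none, true⟩

def Sym.bit : Sym → Option Bool
  | .zero => some false
  | .one => some true
  | _ => none

/-- A list marker asks for two values although a constraint supplies one: the second attempt must
fail, which shows that exactly one value was there. -/
def Sym.pops : Sym → ℕ
  | .neg => 1
  | .next => 1
  | .and => 2
  | .untl => 2
  | .item => 2
  | _ => 0

open Classical in
-- A task without a subject violates both kinds of pairs, so acceptance forces every duty task to
-- have somebody in charge.
noncomputable def pairOk {S : Type} (sod : Bool) (a b : Option S) : Bool :=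
  decide (∃ x y, a = some x ∧ b = some y ∧ if sod then x ≠ y else x = y)

variable {S T : Type}

/-- An assignment step sets all values to false, which are the values on the empty trace. The stored
value from before the step is handed on as well, because an enclosing `next` needs it. -/
def emit (m : Mode S) (c : Ctl S) (x : Cell S) (v : Bool) :
    Ctl S × Cell S × Option (Bool × Bool) :=
  ({ c with phase := .form }, { x with val := m.isEval && v }, some (m.isEval && v, x.val))

/-- Continue with the operand `r`, and fail if there is none. -/
def unary (r : Option (Bool × Bool)) (c : Ctl S) (x : Cell S)
    (f : Bool → Bool → Ctl S × Cell S × Option (Bool × Bool)) :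
    Ctl S × Cell S × Option (Bool × Bool) :=
  match r with
  | some (v, old) => f v old
  | none => ({ c with phase := .fail }, x, none)

/-- The finite control: reading the cell `x`, which is not a bit of a name.  Here `e` tells whether
the name just read is `X`, `cur` is its abstraction, and `r1`, `r2` are the values taken from the
evaluation stack.  The result is the new control state, the updated cell, and the value for the
evaluation stack. -/
noncomputable def act (O : Oracle S T) (pn : Option T) (m : Mode S) (e : Bool) (cur : T)
    (r1 r2 : Option (Bool × Bool)) (c : Ctl S) (x : Cell S) :
    Ctl S × Cell S × Option (Bool × Bool) :=
  match c.phase, x.sym with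
  -- From right to left the BoD list comes first (flag `false`), then the SoD list (flag `true`),
  -- the constraints, and finally the process name.
  | .start, .endList => ({ c with phase := .list false }, x, none)
  | .list b, .endName => ({ c with phase := .snd b }, x, none)
  | .list false, .endList => ({ c with phase := .list true }, x, none)
  | .list true, .endList => ({ c with phase := .form }, x, none)
  -- A name is complete only when the symbol to its left arrives. For the second name of a pair this
  -- is the end marker of the first name; for the first name it is `item`. These two cells store the
  -- subjects.
  | .snd b, .endName =>
    ({ c with
        phase := .fst b
        partner := m.reassign e x.sub
        duty := if e then m.reassign e x.sub else c.duty },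
      { x with sub := m.reassign e x.sub }, none)
  | .fst b, .item =>
    ({ c with
        phase := .list b
        ok := c.ok && pairOk b (m.reassign e x.sub) c.partner
        duty := if e then m.reassign e x.sub else c.duty },
      { x with sub := m.reassign e x.sub }, none)
  | .form, .tt => emit m c x true
  | .form, .neg => unary r1 c x fun v _ => emit m c x (!v)
  | .form, .next => unary r1 c x fun _ old => emit m c x old
  | .form, .and => unary r1 c x fun v _ => unary r2 c x fun v' _ => emit m c x (v && v')
  | .form, .untl =>
    -- Expansion law of until: `x.val` is the value of this very formula at the following instant.
    unary r1 c x fun v _ => unary r2 c x fun v' _ => emit m c x (v' || (v && x.val))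
  | .form, .item =>
    unary r1 c x fun v _ =>
      if r2 = none then ({ c with ok := c.ok && v }, x, none)
      else ({ c with phase := .fail }, x, none)
  -- The name may be an atom or the process name. A `task` symbol to its left decides for the
  -- former; the latter ends the word.
  | .form, .endName => ({ c with phase := .leaf }, x, none)
  -- The duty lists lie to the right of all formulas, so `c.duty` is final here. The process name
  -- lies to the left, so the purpose `pn` has to come from an earlier pass.
  | .leaf, .task => emit m c x (e && m.isPerform && pn.any fun t => O.perf t cur c.duty)
  | _, _ => ({ c with phase := .fail }, x, none)

def Ctl.readBit (c : Ctl S) : Ctl S :=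
  { c with phase := if c.phase.isName then c.phase else .fail }

/-- The state while an annotated word is read from right to left. -/
structure PassSt (S : Type) : Type where
  ctl : Ctl S
  name : Name
  vals : List (Bool × Bool)
  out : List (Cell S)

noncomputable def passStep (O : Oracle S T) (pn : Option T) (m : Mode S) (X : Name) (x : Cell S)
    (s : PassSt S) : PassSt S :=
  match x.sym.bit with
  | some b => ⟨s.ctl.readBit, b :: s.name, s.vals, x :: s.out⟩
  | none =>
    let r1 := if 1 ≤ x.sym.pops then s.vals.head? else none
    let l1 := if 1 ≤ x.sym.pops then s.vals.tail else s.vals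
    let r2 := if 2 ≤ x.sym.pops then l1.head? else none
    let l2 := if 2 ≤ x.sym.pops then l1.tail else l1
    let a := act O pn m (decide (s.name = X)) (O.tr s.name) r1 r2 s.ctl x
    ⟨a.1, [], a.2.2.toList ++ l2, a.2.1 :: s.out⟩

def PassSt.init : PassSt S := ⟨Ctl.init, [], [], []⟩

noncomputable def pass (O : Oracle S T) (pn : Option T) (m : Mode S) (X : Name)
    (u : List (Cell S)) : PassSt S :=
  u.foldr (passStep O pn m X) PassSt.init

open Classical in
-- Phase `leaf` with no pending value at the left end of the word means that the last name is the
-- process name and the word is a complete encoding.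
noncomputable def PassSt.accepts (m : Mode S) (s : PassSt S) : Bool :=
  m.isEval && s.ctl.ok && decide (s.ctl.phase = .leaf) && s.vals.isEmpty

/-! ### Only encodings are accepted -/

theorem act_sym (O : Oracle S T) (pn : Option T) (m : Mode S) (e : Bool) (cur : T)
    (r1 r2 : Option (Bool × Bool)) (c : Ctl S) (x : Cell S) :
    (act O pn m e cur r1 r2 c x).2.1.sym = x.sym := by
  unfold act emit unary
  repeat' split
  all_goals rfl

theorem passStep_out (O : Oracle S T) (pn : Option T) (m : Mode S) (X : Name) (x : Cell S)
    (s : PassSt S) :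
    (passStep O pn m X x s).out.map Cell.sym = x.sym :: s.out.map Cell.sym := by
  unfold passStep
  split
  · rfl
  · simp [act_sym]

theorem pass_out_sym (O : Oracle S T) (pn : Option T) (m : Mode S) (X : Name)
    (u : List (Cell S)) : (pass O pn m X u).out.map Cell.sym = u.map Cell.sym := by
  induction u with
  | nil => rfl
  | cons x u ih =>
    rw [List.map_cons, ← ih]
    exact passStep_out _ _ _ _ _ _

theorem length_pass_out (O : Oracle S T) (pn : Option T) (m : Mode S) (X : Name)
    (u : List (Cell S)) : (pass O pn m X u).out.length = u.length := by
  simpa using congrArg List.length (pass_out_sym O pn m X u)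

theorem length_passStep_vals (O : Oracle S T) (pn : Option T) (m : Mode S) (X : Name)
    (x : Cell S) (s : PassSt S) :
    (passStep O pn m X x s).vals.length ≤ s.vals.length + 1 := by
  unfold passStep
  split
  · simp
  · simp only [List.length_append, Option.length_toList]
    split_ifs <;> (try simp only [List.length_tail]) <;> omega

/-- Bounds the height of the evaluation stack, also on words that encode nothing. -/
theorem length_pass_vals (O : Oracle S T) (pn : Option T) (m : Mode S) (X : Name)
    (u : List (Cell S)) : (pass O pn m X u).vals.length ≤ u.length := by
  induction u with
  | nil => simp [pass, PassSt.init]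
  | cons x u ih => exact (length_passStep_vals _ _ _ _ _ _).trans (Nat.succ_le_succ ih)

/-- The words for the BoD list, or for the SoD and the BoD list. -/
def DutyWord (sod : Bool) (u : List Sym) : Prop :=
  ∃ l l', u = if sod then encodeList encodePair l ++ encodeList encodePair l'
    else encodeList encodePair l

/-- A sequence of `n` formulas, followed by a list of constraints and the duty lists. -/
def FormWord (n : ℕ) (u : List Sym) : Prop :=
  ∃ (l cs : List LTL) (v : List Sym), l.length = n ∧ DutyWord true v ∧
    u = l.flatMap encodeLTL ++ (encodeList encodeLTL cs ++ v)

/-- What has been read, in each of the phases. -/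
def Read (c : Phase) (n : ℕ) (x : Name) (u : List Sym) : Prop :=
  match c with
  | .start => u = [] ∧ n = 0
  | .list b => DutyWord b u ∧ n = 0
  | .snd b => (∃ v, DutyWord b v ∧ u = encodeName x ++ v) ∧ n = 0
  | .fst b => (∃ y v, DutyWord b v ∧ u = encodeName x ++ (encodeName y ++ v)) ∧ n = 0
  | .form => FormWord n u
  | .leaf => ∃ v, FormWord n v ∧ u = encodeName x ++ v
  | .fail => True

/-- This lemma and the following ones are the grammar rules that the parsing invariant `Read` goes
through. -/
theorem DutyWord.cons {b : Bool} {v : List Sym} (h : DutyWord b v) (x y : Name) :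
    DutyWord b (.item :: (encodeName x ++ (encodeName y ++ v))) := by
  obtain ⟨l, l', rfl⟩ := h
  refine ⟨(x, y) :: l, l', ?_⟩
  cases b <;> simp [encodeList, encodePair]

theorem DutyWord.endList {v : List Sym} (h : DutyWord false v) : DutyWord true (.endList :: v) := by
  obtain ⟨l, l', rfl⟩ := h
  exact ⟨[], l, by simp [encodeList]⟩

theorem FormWord.tt {n : ℕ} {v : List Sym} (h : FormWord n v) : FormWord (n + 1) (.tt :: v) := by
  obtain ⟨l, cs, v, rfl, hv, rfl⟩ := h
  exact ⟨.tt :: l, cs, v, by simp, hv, by simp [encodeLTL]⟩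

theorem FormWord.task {n : ℕ} {v : List Sym} (h : FormWord n v) (x : Name) :
    FormWord (n + 1) (.task :: (encodeName x ++ v)) := by
  obtain ⟨l, cs, v, rfl, hv, rfl⟩ := h
  exact ⟨.task x :: l, cs, v, by simp, hv, by simp [encodeLTL]⟩

theorem FormWord.neg {n : ℕ} {v : List Sym} (h : FormWord (n + 1) v) :
    FormWord (n + 1) (.neg :: v) := by
  obtain ⟨l, cs, v, hl, hv, rfl⟩ := h
  obtain ⟨a, l, rfl⟩ := List.exists_cons_of_length_eq_add_one hl
  exact ⟨.neg a :: l, cs, v, by simpa using hl, hv, by simp [encodeLTL]⟩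

theorem FormWord.next {n : ℕ} {v : List Sym} (h : FormWord (n + 1) v) :
    FormWord (n + 1) (.next :: v) := by
  obtain ⟨l, cs, v, hl, hv, rfl⟩ := h
  obtain ⟨a, l, rfl⟩ := List.exists_cons_of_length_eq_add_one hl
  exact ⟨.next a :: l, cs, v, by simpa using hl, hv, by simp [encodeLTL]⟩

theorem FormWord.and {n : ℕ} {v : List Sym} (h : FormWord (n + 2) v) :
    FormWord (n + 1) (.and :: v) := by
  obtain ⟨l, cs, v, hl, hv, rfl⟩ := h
  obtain ⟨a, l, rfl⟩ := List.exists_cons_of_length_eq_add_one hl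
  obtain ⟨b, l, rfl⟩ := List.exists_cons_of_length_eq_add_one (by simpa using hl)
  exact ⟨.and a b :: l, cs, v, by simpa using hl, hv, by simp [encodeLTL]⟩

theorem FormWord.untl {n : ℕ} {v : List Sym} (h : FormWord (n + 2) v) :
    FormWord (n + 1) (.untl :: v) := by
  obtain ⟨l, cs, v, hl, hv, rfl⟩ := h
  obtain ⟨a, l, rfl⟩ := List.exists_cons_of_length_eq_add_one hl
  obtain ⟨b, l, rfl⟩ := List.exists_cons_of_length_eq_add_one (by simpa using hl)
  exact ⟨.untl a b :: l, cs, v, by simpa using hl, hv, by simp [encodeLTL]⟩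

theorem FormWord.item {v : List Sym} (h : FormWord 1 v) : FormWord 0 (.item :: v) := by
  obtain ⟨l, cs, v, hl, hv, rfl⟩ := h
  obtain ⟨a, rfl⟩ := List.length_eq_one_iff.1 hl
  exact ⟨[], a :: cs, v, rfl, hv, by simp [encodeList]⟩

theorem DutyWord.formWord {v : List Sym} (h : DutyWord true v) : FormWord 0 (.endList :: v) :=
  ⟨[], [], v, rfl, h, by simp [encodeList]⟩

/-- Every admissible transition of the control applies a grammar rule. All others lead to `fail`,
which is never left and about which nothing is claimed. -/
theorem read_passStep (O : Oracle S T) (pn : Option T) (m : Mode S) (X : Name) (x : Cell S)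
    (s : PassSt S) (u : List Sym) (h : Read s.ctl.phase s.vals.length s.name u) :
    Read (passStep O pn m X x s).ctl.phase (passStep O pn m X x s).vals.length
      (passStep O pn m X x s).name (x.sym :: u) := by
  obtain ⟨⟨ph, duty, partner, ok⟩, nm, V, out⟩ := s
  obtain ⟨sym, val, sub⟩ := x
  simp only at h
  cases sym
  case zero =>
    cases ph <;> simp_all [passStep, Sym.bit, Ctl.readBit, Phase.isName, Read, encodeName]
  case one =>
    cases ph <;> simp_all [passStep, Sym.bit, Ctl.readBit, Phase.isName, Read, encodeName]
  case endName =>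
    cases ph <;> simp_all [passStep, Sym.bit, act, Sym.pops, Read, encodeName]
    obtain ⟨v, hv, rfl⟩ := h.1
    exact ⟨_, v, hv, rfl⟩
  case tt =>
    cases ph <;> simp_all [passStep, Sym.bit, act, Sym.pops, Read, emit]
    exact h.tt
  case task =>
    cases ph <;> simp_all [passStep, Sym.bit, act, Sym.pops, Read, emit]
    obtain ⟨v, h, rfl⟩ := h
    exact h.task _
  case neg =>
    cases ph <;> rcases V with _ | ⟨⟨a, b⟩, V⟩ <;>
      simp_all [passStep, Sym.bit, act, unary, Sym.pops, Read, emit]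
    exact h.neg
  case next =>
    cases ph <;> rcases V with _ | ⟨⟨a, b⟩, V⟩ <;>
      simp_all [passStep, Sym.bit, act, unary, Sym.pops, Read, emit]
    exact h.next
  case and =>
    cases ph <;> rcases V with _ | ⟨⟨a, b⟩, _ | ⟨⟨a', b'⟩, V⟩⟩ <;>
      simp_all [passStep, Sym.bit, act, unary, Sym.pops, Read, emit]
    exact h.and
  case untl =>
    cases ph <;> rcases V with _ | ⟨⟨a, b⟩, _ | ⟨⟨a', b'⟩, V⟩⟩ <;>
      simp_all [passStep, Sym.bit, act, unary, Sym.pops, Read, emit]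
    exact h.untl
  case item =>
    cases ph <;> rcases V with _ | ⟨⟨a, b⟩, _ | ⟨⟨a', b'⟩, V⟩⟩ <;>
      simp_all [passStep, Sym.bit, act, unary, Sym.pops, Read]
    · obtain ⟨y, v, h, rfl⟩ := h
      exact h.cons _ _
    · exact h.item
  case endList =>
    rcases ph with _ | (_ | _) | _ | _ | _ | _ | _ <;>
      simp_all [passStep, Sym.bit, act, Sym.pops, Read]
    · exact ⟨[], [], rfl⟩
    · exact h.1.endList
    · exact h.1.formWord

theorem read_pass (O : Oracle S T) (pn : Option T) (m : Mode S) (X : Name) (u : List (Cell S)) :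
    Read (pass O pn m X u).ctl.phase (pass O pn m X u).vals.length (pass O pn m X u).name
      (u.map Cell.sym) := by
  induction u with
  | nil => simp [pass, PassSt.init, Read, Ctl.init]
  | cons x u ih => exact read_passStep _ _ _ _ _ _ _ ih

/-- Thanks to this the machine needs no separate syntax check of its input. -/
theorem exists_encode_of_accepts {O : Oracle S T} {pn : Option T} {m : Mode S} {X : Name}
    {u : List (Cell S)} (h : (pass O pn m X u).accepts m = true) :
    ∃ p : Proc, p.encode = u.map Cell.sym := by
  have h1 := read_pass O pn m X u
  simp only [PassSt.accepts, Bool.and_eq_true, decide_eq_true_eq, List.isEmpty_iff] at h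
  rw [h.1.2, h.2] at h1
  obtain ⟨v, ⟨l, cs, v, hl, ⟨sod, bod, rfl⟩, rfl⟩, h1⟩ := h1
  rw [List.length_nil, List.length_eq_zero_iff] at hl
  subst hl
  exact ⟨⟨_, cs, sod, bod⟩, by simpa [Proc.encode] using h1.symm⟩

/-! ### Reading the encoding of a process -/

def bitCell (b : Bool) : Cell S := .plain (if b then .one else .zero)

/-- A name, with the annotation `o` at its end marker. -/
def cellsName (o : Option S) (x : Name) : List (Cell S) := x.map bitCell ++ [⟨.endName, false, o⟩]

def cellsLTL (h : LTL → Bool) : LTL → List (Cell S)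
  | .tt => [⟨.tt, h .tt, none⟩]
  | .task t => ⟨.task, h (.task t), none⟩ :: cellsName none t
  | .neg φ => ⟨.neg, h (.neg φ), none⟩ :: cellsLTL h φ
  | .and φ ψ => ⟨.and, h (.and φ ψ), none⟩ :: (cellsLTL h φ ++ cellsLTL h ψ)
  | .next φ => ⟨.next, h (.next φ), none⟩ :: cellsLTL h φ
  | .untl φ ψ => ⟨.untl, h (.untl φ ψ), none⟩ :: (cellsLTL h φ ++ cellsLTL h ψ)

def cellsConstraints (h : LTL → Bool) : List LTL → List (Cell S)
  | [] => [.plain .endList]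
  | φ :: l => .plain .item :: (cellsLTL h φ ++ cellsConstraints h l)

/-- Each subject sits on the cell immediately to the left of its task name, where a right-to-left
reader has just completed that name. -/
def cellsPairs (τ : Name → Option S) : List (Name × Name) → List (Cell S)
  | [] => [.plain .endList]
  | c :: l => ⟨.item, false, τ c.1⟩ ::
      (cellsName (τ c.2) c.1 ++ (cellsName none c.2 ++ cellsPairs τ l))

/-- The encoding of a process, annotated by the subjects in charge and by truth values. -/
def Proc.cells (τ : Name → Option S) (h : LTL → Bool) (p : Proc) : List (Cell S) :=
  cellsName none p.name ++ (cellsConstraints h p.constraints ++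
    (cellsPairs τ p.sod ++ cellsPairs τ p.bod))

theorem map_plain_encodeName (x : Name) :
    (encodeName x).map Cell.plain = (cellsName none x : List (Cell S)) := by
  induction x with
  | nil => rfl
  | cons b x ih => simpa [encodeName, cellsName, bitCell] using ih

theorem map_plain_encodeLTL (φ : LTL) :
    (encodeLTL φ).map Cell.plain = (cellsLTL (fun _ => false) φ : List (Cell S)) := by
  induction φ <;> simp_all [encodeLTL, cellsLTL, map_plain_encodeName, Cell.plain]

theorem map_plain_constraints (l : List LTL) :
    (encodeList encodeLTL l).map Cell.plain
      = (cellsConstraints (fun _ => false) l : List (Cell S)) := by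
  induction l <;> simp_all [encodeList, cellsConstraints, map_plain_encodeLTL]

theorem map_plain_pairs (l : List (Name × Name)) :
    (encodeList encodePair l).map Cell.plain
      = (cellsPairs (fun _ => none) l : List (Cell S)) := by
  induction l <;>
    simp_all [encodeList, cellsPairs, encodePair, map_plain_encodeName, Cell.plain]

/-- The bare input is the annotated encoding with nobody in charge and an empty future. -/
theorem map_plain_encode (p : Proc) :
    p.encode.map Cell.plain = (p.cells (fun _ => none) (fun _ => false) : List (Cell S)) := by
  simp [Proc.encode, Proc.cells, map_plain_encodeName, map_plain_constraints, map_plain_pairs]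

/-- The truth values of formulas after a step, from the truth values `h` before; `ev` tells whether
an instant is evaluated, and `a` which tasks are performed. -/
def stepVal (ev : Bool) (a : Name → Bool) (h : LTL → Bool) : LTL → Bool
  | .tt => ev
  | .task t => ev && a t
  | .neg φ => ev && !stepVal ev a h φ
  | .and φ ψ => ev && (stepVal ev a h φ && stepVal ev a h ψ)
  | .next φ => ev && h φ
  | .untl φ ψ => ev && (stepVal ev a h ψ || (stepVal ev a h φ && h (.untl φ ψ)))

/-- The subjects in charge after a step. -/
def reassign (m : Mode S) (X : Name) (τ : Name → Option S) (x : Name) : Option S :=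
  m.reassign (decide (x = X)) (τ x)

section Reading

variable (O : Oracle S T) (pn : Option T) (m : Mode S) (X : Name)

theorem foldr_bitCell (s : PassSt S) (hs : s.ctl.phase.isName = true) (x : Name) :
    (x.map bitCell).foldr (passStep O pn m X) s
      = ⟨s.ctl, x ++ s.name, s.vals, x.map bitCell ++ s.out⟩ := by
  induction x with
  | nil => rfl
  | cons b x ih =>
    rw [List.map_cons, List.foldr_cons, ih]
    cases b <;> simp [passStep, bitCell, Cell.plain, Sym.bit, Ctl.readBit, hs]

/-- The tasks that an instant performs. -/
def performed (O : Oracle S T) (pn : Option T) (m : Mode S) (X : Name) (duty : Option S)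
    (t : Name) : Bool :=
  decide (t = X) && m.isPerform && pn.any fun c => O.perf c (O.tr t) duty

/-- Prefix notation read backwards is postfix evaluation: the pending values `V` stay untouched
below one new entry, and the stored values are replaced in the same sweep. -/
theorem foldr_cellsLTL (h : LTL → Bool) (d q : Option S) (ok : Bool) (φ : LTL) (nm : Name)
    (V : List (Bool × Bool)) (o : List (Cell S)) :
    (cellsLTL h φ).foldr (passStep O pn m X) ⟨⟨.form, d, q, ok⟩, nm, V, o⟩
      = ⟨⟨.form, d, q, ok⟩, [], (stepVal m.isEval (performed O pn m X d) h φ, h φ) :: V,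
          cellsLTL (stepVal m.isEval (performed O pn m X d) h) φ ++ o⟩ := by
  induction φ generalizing nm V o with
  | tt => simp [cellsLTL, passStep, Sym.bit, act, Sym.pops, emit, stepVal]
  | task t =>
    simp only [cellsLTL, cellsName, List.foldr_cons, List.foldr_append, List.foldr_nil]
    have h1 : passStep O pn m X ⟨.endName, false, none⟩ ⟨⟨.form, d, q, ok⟩, nm, V, o⟩
        = ⟨⟨.leaf, d, q, ok⟩, [], V, ⟨.endName, false, none⟩ :: o⟩ := by
      simp [passStep, Sym.bit, act, Sym.pops]
    rw [h1, foldr_bitCell _ _ _ _ _ rfl]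
    simp [passStep, Sym.bit, act, Sym.pops, emit, stepVal, performed]
  | neg φ ih =>
    simp only [cellsLTL, List.foldr_cons, ih]
    simp [passStep, Sym.bit, act, unary, Sym.pops, emit, stepVal]
  | next φ ih =>
    simp only [cellsLTL, List.foldr_cons, ih]
    simp [passStep, Sym.bit, act, unary, Sym.pops, emit, stepVal]
  | and φ ψ ih1 ih2 =>
    simp only [cellsLTL, List.foldr_cons, List.foldr_append, ih1, ih2]
    simp [passStep, Sym.bit, act, unary, Sym.pops, emit, stepVal]
  | untl φ ψ ih1 ih2 =>
    simp only [cellsLTL, List.foldr_cons, List.foldr_append, ih1, ih2]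
    simp [passStep, Sym.bit, act, unary, Sym.pops, emit, stepVal]

theorem foldr_cellsConstraints (h : LTL → Bool) (d q : Option S) (ok : Bool) (l : List LTL)
    (nm : Name) (o : List (Cell S)) :
    (cellsConstraints h l).foldr (passStep O pn m X) ⟨⟨.list true, d, q, ok⟩, nm, [], o⟩
      = ⟨⟨.form, d, q, ok && l.all (stepVal m.isEval (performed O pn m X d) h)⟩, [], [],
          cellsConstraints (stepVal m.isEval (performed O pn m X d) h) l ++ o⟩ := by
  induction l with
  | nil => simp [cellsConstraints, passStep, Sym.bit, act, Sym.pops, Cell.plain]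
  | cons φ l ih =>
    simp only [cellsConstraints, List.foldr_cons, List.foldr_append, ih, foldr_cellsLTL]
    simp only [passStep, Sym.bit, act, unary, Sym.pops, Cell.plain]
    simp [Bool.and_assoc, Bool.and_comm]

/-- The subject in charge of `X`, if `X` is one of the tasks of the given pairs. -/
def dutyOf (τ : Name → Option S) (d : Option S) (l : List (Name × Name)) : Option S :=
  if X ∈ l.flatMap (fun c => [c.1, c.2]) then τ X else d

/-- The two duty lists differ only in how their closing marker is entered, and this is the
hypothesis `hs`. The final partner is left unspecified, since it is overwritten before its next use.
-/
theorem foldr_cellsPairs (τ : Name → Option S) (b : Bool) (l : List (Name × Name))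
    (s : PassSt S) (d q : Option S) (ok : Bool) (o : List (Cell S))
    (hs : passStep O pn m X (.plain .endList) s
      = ⟨⟨.list b, d, q, ok⟩, [], [], .plain .endList :: o⟩) :
    ∃ q', (cellsPairs τ l).foldr (passStep O pn m X) s
      = ⟨⟨.list b, dutyOf X (reassign m X τ) d l, q',
          ok && l.all fun c => pairOk b (reassign m X τ c.1) (reassign m X τ c.2)⟩, [], [],
          cellsPairs (reassign m X τ) l ++ o⟩ := by
  induction l with
  | nil => exact ⟨q, by simp [cellsPairs, hs, dutyOf]⟩
  | cons c l ih =>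
    obtain ⟨q', ih⟩ := ih
    refine ⟨reassign m X τ c.2, ?_⟩
    simp only [cellsPairs, cellsName, List.foldr_cons, List.foldr_append, List.foldr_nil, ih]
    generalize hok : (ok && l.all fun c => pairOk b (reassign m X τ c.1) (reassign m X τ c.2))
      = ok'
    generalize hd : dutyOf X (reassign m X τ) d l = d'
    have h1 : ∀ o, passStep O pn m X ⟨.endName, false, none⟩ ⟨⟨.list b, d', q', ok'⟩, [], [], o⟩
        = ⟨⟨.snd b, d', q', ok'⟩, [], [], ⟨.endName, false, none⟩ :: o⟩ := by
      simp [passStep, Sym.bit, act, Sym.pops]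
    rw [h1, foldr_bitCell _ _ _ _ ⟨⟨.snd b, d', q', ok'⟩, [], [], _⟩ rfl]
    have h2 : ∀ o, passStep O pn m X ⟨.endName, false, τ c.2⟩
        ⟨⟨.snd b, d', q', ok'⟩, c.2 ++ [], [], o⟩
        = ⟨⟨.fst b, if c.2 = X then reassign m X τ c.2 else d', reassign m X τ c.2, ok'⟩, [], [],
          ⟨.endName, false, reassign m X τ c.2⟩ :: o⟩ := by
      simp [passStep, Sym.bit, act, Sym.pops, reassign]
    rw [h2, foldr_bitCell _ _ _ _ ⟨⟨.fst b, _, _, ok'⟩, [], [], _⟩ rfl]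
    simp only [passStep, Sym.bit, act, Sym.pops, reassign, PassSt.mk.injEq, Ctl.mk.injEq]
    refine ⟨⟨trivial, ?_, trivial, ?_⟩, trivial, by simp, ?_⟩
    · subst hd
      have key : X ∈ (c :: l).flatMap (fun c => [c.1, c.2])
          ↔ c.1 = X ∨ c.2 = X ∨ X ∈ l.flatMap fun c => [c.1, c.2] := by
        rw [List.flatMap_cons, List.mem_append, List.mem_cons, List.mem_singleton, or_assoc,
          @eq_comm _ X c.1, @eq_comm _ X c.2]
      simp only [dutyOf, key, reassign, decide_eq_true_eq]
      by_cases h1 : c.1 = X <;> by_cases h2 : c.2 = X <;> simp only [h1, h2, if_true, if_false,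
        true_or, or_true, false_or, decide_true, List.append_nil]
    · simp [← hok, reassign, Bool.and_comm, Bool.and_left_comm]
    · simp

theorem dutyOf_dutyOf (τ : Name → Option S) (p : Proc) :
    dutyOf X τ (dutyOf X τ none p.bod) p.sod = if X ∈ p.dutyTasks then τ X else none := by
  simp only [dutyOf, Proc.dutyTasks, List.flatMap_append, List.mem_dedup, List.mem_append]
  by_cases h1 : X ∈ p.sod.flatMap fun c => [c.1, c.2] <;>
    by_cases h2 : X ∈ p.bod.flatMap fun c => [c.1, c.2] <;> simp only [h1, h2, if_true, if_false,
      or_true, or_false]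

/-- Annotated encodings of `p` are closed under passes, so from here on a pass is just an update of
the pair `(τ, h)` together with an acceptance test. -/
theorem pass_cells (τ : Name → Option S) (h : LTL → Bool) (p : Proc) :
    ∃ q, pass O pn m X (p.cells τ h)
      = ⟨⟨.leaf, if X ∈ p.dutyTasks then reassign m X τ X else none, q,
          (p.sod.all fun c => pairOk true (reassign m X τ c.1) (reassign m X τ c.2)) &&
          (p.bod.all fun c => pairOk false (reassign m X τ c.1) (reassign m X τ c.2)) &&
          p.constraints.all (stepVal m.isEval (performed O pn m X
            (if X ∈ p.dutyTasks then reassign m X τ X else none)) h)⟩,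
        p.name, [],
        p.cells (reassign m X τ) (stepVal m.isEval (performed O pn m X
            (if X ∈ p.dutyTasks then reassign m X τ X else none)) h)⟩ := by
  simp only [pass, Proc.cells, List.foldr_append]
  obtain ⟨q1, h1⟩ := foldr_cellsPairs O pn m X τ false p.bod PassSt.init none none true []
    (by simp [passStep, Sym.bit, act, Sym.pops, PassSt.init, Ctl.init, Cell.plain])
  rw [h1, Bool.true_and, List.append_nil]
  obtain ⟨q2, h2⟩ := foldr_cellsPairs O pn m X τ true p.sod
    ⟨⟨.list false, dutyOf X (reassign m X τ) none p.bod, q1,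
      p.bod.all fun c => pairOk false (reassign m X τ c.1) (reassign m X τ c.2)⟩, [], [],
      cellsPairs (reassign m X τ) p.bod⟩ _ _ _ _
    (by simp only [passStep, Sym.bit, act, Sym.pops, Cell.plain]; rfl)
  rw [h2, dutyOf_dutyOf, foldr_cellsConstraints]
  refine ⟨q2, ?_⟩
  simp only [cellsName, List.foldr_append, List.foldr_cons, List.foldr_nil]
  have h1 : ∀ d q ok o, passStep O pn m X ⟨.endName, false, none⟩ ⟨⟨.form, d, q, ok⟩, [], [], o⟩
      = ⟨⟨.leaf, d, q, ok⟩, [], [], ⟨.endName, false, none⟩ :: o⟩ := by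
    simp [passStep, Sym.bit, act, Sym.pops]
  rw [h1, foldr_bitCell _ _ _ _ _ rfl]
  simp [Bool.and_comm]

end Reading

end PurposeAware

/-! ### Accepting sequences of passes and successful runs -/

namespace PurposeAware

/-! ### Temporal logic on lists of instants -/

theorem LTL.sat_untl_iff {n : ℕ} (W : Fin n → Name → Prop) (φ ψ : LTL) (i : Fin n) :
    (LTL.untl φ ψ).Sat W i ↔ ψ.Sat W i ∨
      (φ.Sat W i ∧ ∃ j : Fin n, j.val = i.val + 1 ∧ (LTL.untl φ ψ).Sat W j) := by
  simp only [LTL.Sat]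
  constructor
  · rintro ⟨j, hij, hj, hk⟩
    rcases hij.eq_or_lt with rfl | hlt
    · exact Or.inl hj
    · refine Or.inr ⟨hk i le_rfl hlt, ⟨i.val + 1, by omega⟩, rfl, j, ?_, hj, ?_⟩
      · exact Fin.mk_le_of_le_val hlt
      · intro k hik hkj
        have : i.val + 1 ≤ k.val := hik
        exact hk k (by rw [Fin.le_def]; omega) hkj
  · rintro (h | ⟨h, j, hj, l, hjl, hl, hk⟩)
    · exact ⟨i, le_rfl, h, fun k h1 h2 => absurd h1 (not_le.2 h2)⟩
    · refine ⟨l, ?_, hl, fun k h1 h2 => ?_⟩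
      · rw [Fin.le_def] at hjl ⊢
        omega
      · rcases h1.eq_or_lt with rfl | hlt
        · exact h
        · refine hk k ?_ h2
          rw [Fin.lt_def] at hlt
          rw [Fin.le_def]
          omega

theorem LTL.sat_congr {n : ℕ} {W W' : Fin n → Name → Prop} (φ : LTL)
    (h : ∀ i, ∀ t ∈ φ.tasks, W i t ↔ W' i t) (i : Fin n) : φ.Sat W i ↔ φ.Sat W' i := by
  induction φ generalizing i with
  | tt => rfl
  | task t => exact h i t (by simp [LTL.tasks])
  | neg φ ih => exact not_congr (ih h i)
  | and φ ψ ih1 ih2 =>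
    exact and_congr (ih1 (fun i t ht => h i t (by simp [LTL.tasks, ht])) i)
      (ih2 (fun i t ht => h i t (by simp [LTL.tasks, ht])) i)
  | next φ ih =>
    exact exists_congr fun j => and_congr_right fun _ => ih h j
  | untl φ ψ ih1 ih2 =>
    have h1 := ih1 fun i t ht => h i t (by simp [LTL.tasks, ht])
    have h2 := ih2 fun i t ht => h i t (by simp [LTL.tasks, ht])
    simp only [LTL.Sat, h1, h2]

/-- The truth values of formulas at the first of a list of instants (all false on the empty
list). -/
def traceVal : List (Name → Bool) → LTL → Bool
  | [] => fun _ => false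
  | a :: L => stepVal true a (traceVal L)

/-- Backward evaluation is correct. The all-false values on the empty list encode that beyond the
last instant every `next` fails and no until is fulfilled. -/
theorem traceVal_drop_iff (L : List (Name → Bool)) (φ : LTL) (i : Fin L.length) :
    traceVal (L.drop i) φ = true ↔ φ.Sat (fun i t => L[i] t = true) i := by
  have hd : ∀ i : Fin L.length, L.drop i = L[i] :: L.drop (i.val + 1) :=
    fun i => List.drop_eq_getElem_cons i.2
  induction φ generalizing i with
  | tt =>
    rw [hd]
    simp [traceVal, stepVal, LTL.Sat]
  | task t =>
    rw [hd]
    simp [traceVal, stepVal, LTL.Sat]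
  | neg φ ih =>
    have := ih i
    rw [hd] at this ⊢
    simp only [traceVal, stepVal, LTL.Sat, ← this]
    simp
  | and φ ψ ih1 ih2 =>
    have h1 := ih1 i
    have h2 := ih2 i
    rw [hd] at h1 h2 ⊢
    simp only [traceVal, stepVal, LTL.Sat, ← h1, ← h2]
    simp
  | next φ ih =>
    rw [hd]
    simp only [traceVal, stepVal, LTL.Sat, Bool.true_and]
    by_cases hi : i.val + 1 < L.length
    · refine (ih ⟨i.val + 1, hi⟩).trans ?_
      constructor
      · exact fun h => ⟨_, rfl, h⟩
      · rintro ⟨j, hj, h⟩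
        obtain rfl : j = ⟨i.val + 1, hi⟩ := Fin.ext hj
        exact h
    · rw [List.drop_of_length_le (by omega)]
      simp only [traceVal, Bool.false_eq_true, false_iff, not_exists, not_and]
      intro j hj
      omega
  | untl φ ψ ih1 ih2 =>
    -- Until refers to itself at the following instant, so an inner induction on the distance to the
    -- last instant is needed.
    obtain ⟨k, hk⟩ : ∃ k, i.val + k + 1 = L.length := ⟨L.length - (i.val + 1), by omega⟩
    induction k generalizing i with
    | zero =>
      have h1 : _ ↔ _ := ih1 i
      have h2 : _ ↔ _ := ih2 i
      rw [LTL.sat_untl_iff, ← h1, ← h2, hd, List.drop_of_length_le (by omega)]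
      simp only [traceVal, stepVal, Bool.true_and, Bool.and_false, Bool.or_false]
      constructor
      · exact Or.inl
      · rintro (h | ⟨_, j, hj, _⟩)
        · exact h
        · omega
    | succ k ih =>
      have h1 : _ ↔ _ := ih1 i
      have h2 : _ ↔ _ := ih2 i
      have hlt : i.val + 1 < L.length := by omega
      have h3 : _ ↔ _ := ih ⟨i.val + 1, hlt⟩ (by simp only; omega)
      rw [LTL.sat_untl_iff, ← h1, ← h2, hd]
      simp only [traceVal, stepVal, Bool.true_and, Bool.or_eq_true, Bool.and_eq_true]
      refine or_congr Iff.rfl (and_congr Iff.rfl ?_)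
      rw [h3]
      constructor
      · exact fun h => ⟨_, rfl, h⟩
      · rintro ⟨j, hj, h⟩
        obtain rfl : j = ⟨i.val + 1, hlt⟩ := Fin.ext hj
        exact h

theorem stepVal_false (a : Name → Bool) (h : LTL → Bool) : stepVal false a h = fun _ => false := by
  funext φ
  cases φ <;> rfl

/-! ### Runs on annotated words -/

variable {S T : Type}

/-- A letter: the current task name and what to do with it. -/
abbrev Letter (S : Type) : Type := Name × Mode S

/-- An annotated word, and the abstraction of the purpose (once it is known). -/
abbrev RunSt (S T : Type) : Type := List (Cell S) × Option T

noncomputable def readLetter (O : Oracle S T) (s : RunSt S T) (l : Letter S) : RunSt S T :=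
  ((pass O s.2 l.2 l.1 s.1).out, some (O.tr (pass O s.2 l.2 l.1 s.1).name))

noncomputable def accLetter (O : Oracle S T) (s : RunSt S T) (l : Letter S) : Bool :=
  (pass O s.2 l.2 l.1 s.1).accepts l.2

/-- Some letter is accepted when the letters are read one after the other. -/
noncomputable def accepts (O : Oracle S T) : List (Letter S) → RunSt S T → Bool
  | [], _ => false
  | l :: ls, s => accLetter O s l || accepts O ls (readLetter O s l)

theorem accepts_append (O : Oracle S T) (l l' : List (Letter S)) (s : RunSt S T) :
    accepts O (l ++ l') s = (accepts O l s || accepts O l' (l.foldl (readLetter O) s)) := by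
  induction l generalizing s with
  | nil => simp [accepts]
  | cons a l ih => simp [accepts, ih, Bool.or_assoc]

/-- The subject in charge of `X` if `X` is a duty task. -/
def Proc.chargeOf (p : Proc) (τ : Name → Option S) (X : Name) : Option S :=
  if X ∈ p.dutyTasks then τ X else none

theorem readLetter_cells (O : Oracle S T) (p : Proc) (τ : Name → Option S) (h : LTL → Bool)
    (pn : Option T) (l : Letter S) :
    readLetter O (p.cells τ h, pn) l
      = (p.cells (reassign l.2 l.1 τ) (stepVal l.2.isEval (performed O pn l.2 l.1
          (p.chargeOf (reassign l.2 l.1 τ) l.1)) h), some (O.tr p.name)) := by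
  obtain ⟨q, hq⟩ := pass_cells O pn l.2 l.1 τ h p
  simp [readLetter, hq, Proc.chargeOf]

theorem accLetter_cells (O : Oracle S T) (p : Proc) (τ : Name → Option S) (h : LTL → Bool)
    (pn : Option T) (l : Letter S) :
    accLetter O (p.cells τ h, pn) l = true ↔
      l.2.isEval = true ∧
      (∀ c ∈ p.sod, pairOk true (reassign l.2 l.1 τ c.1) (reassign l.2 l.1 τ c.2) = true) ∧
      (∀ c ∈ p.bod, pairOk false (reassign l.2 l.1 τ c.1) (reassign l.2 l.1 τ c.2) = true) ∧
      ∀ φ ∈ p.constraints, stepVal l.2.isEval (performed O pn l.2 l.1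
          (p.chargeOf (reassign l.2 l.1 τ) l.1)) h φ = true := by
  obtain ⟨q, hq⟩ := pass_cells O pn l.2 l.1 τ h p
  simp only [accLetter, hq, Proc.chargeOf, PassSt.accepts, Bool.and_eq_true, List.all_eq_true,
    decide_eq_true_eq, List.isEmpty_nil, and_true, and_assoc]

theorem reassign_eval {m : Mode S} (hm : m.isEval = true) (X : Name) (τ : Name → Option S) :
    reassign m X τ = τ := by
  funext x
  cases m <;> simp_all [reassign, Mode.reassign, Mode.isEval]

/-! ### The oracle of a static database -/

abbrev StaticDB.Subject (I : StaticDB) : Type := {x // x ∈ I.adom .subject}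

/-- A bound on the length of the tasks and purposes in the database. -/
def StaticDB.nameBound (I : StaticDB) : ℕ := (I.adom .task ∪ I.adom .purpose).sup List.length

/-- One bit more than the longest known name is kept, so that no longer name is cut down to a known
one. -/
abbrev StaticDB.Trunc (I : StaticDB) : Type := {x : Name // x.length ≤ I.nameBound + 1}

instance (I : StaticDB) : Finite I.Trunc := (List.finite_length_le Bool _).to_subtype

def StaticDB.trunc (I : StaticDB) (x : Name) : I.Trunc :=
  ⟨x.take (I.nameBound + 1), List.length_take_le _ _⟩

/-- The task can be performed for the purpose, by the given subject (if any is given). -/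
def StaticDB.Performable (I : StaticDB) (purpose t : Name) (d : Option I.Subject) : Prop :=
  ∃ sub owner, (Request.mk [] sub t owner purpose).Allowed I ∧ ∀ s, d = some s → sub = s.1

open Classical in
-- `perf` is a finite table, so it can be built into the control of a machine.
noncomputable def StaticDB.oracle (I : StaticDB) : Oracle I.Subject I.Trunc where
  nil := I.trunc []
  cons b x := I.trunc (b :: x.1)
  perf c c' d := decide (∃ purpose t, I.trunc purpose = c ∧ I.trunc t = c' ∧
    I.Performable purpose t d)

theorem StaticDB.oracle_tr (I : StaticDB) (x : Name) : I.oracle.tr x = I.trunc x := by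
  induction x with
  | nil => rfl
  | cons b x ih =>
    change I.trunc (b :: (I.oracle.tr x).1) = _
    rw [ih]
    apply Subtype.ext
    simp [StaticDB.trunc, List.take_take]

/-- A name within the bound is not cut, and the length of its truncation shows that the other one is
not cut either. Otherwise both are too long to be known. -/
theorem StaticDB.eq_or_long_of_trunc_eq {I : StaticDB} {x y : Name} (h : I.trunc x = I.trunc y) :
    x = y ∨ (x ∉ I.adom .task ∪ I.adom .purpose ∧ y ∉ I.adom .task ∪ I.adom .purpose) := by
  have h' : x.take (I.nameBound + 1) = y.take (I.nameBound + 1) := congrArg Subtype.val h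
  have hlen := congrArg List.length h'
  rw [List.length_take, List.length_take] at hlen
  have key : ∀ z : Name, z ∈ I.adom .task ∪ I.adom .purpose → z.length ≤ I.nameBound :=
    fun z hz => Finset.le_sup (f := List.length) hz
  by_cases hx : x.length ≤ I.nameBound
  · left
    rwa [List.take_of_length_le (by omega), List.take_of_length_le (by omega)] at h'
  · right
    exact ⟨fun hz => hx (key x hz), fun hz => by have := key y hz; omega⟩

/-- An unknown task uses no object, so its requirement is vacuous. If a task does use an object, an
unknown purpose makes it inaccessible, and known names are determined by their truncations. -/
theorem StaticDB.Performable.of_trunc_eq {I : StaticDB} {c c' t t' : Name}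
    {d : Option I.Subject} (hc : I.trunc c = I.trunc c') (ht : I.trunc t = I.trunc t')
    (h : I.Performable c t d) : I.Performable c' t' d := by
  obtain ⟨sub, owner, ⟨h1, h2, h3⟩, h4⟩ := h
  refine ⟨sub, owner, ⟨h1, h2, fun act obj ha => ?_⟩, h4⟩
  have hmem : t' ∈ I.adom .task ∪ I.adom .purpose :=
    Finset.mem_union_left _ (Finset.mem_image.2 ⟨_, ha, rfl⟩)
  rcases eq_or_long_of_trunc_eq ht with rfl | h
  · obtain ⟨h5, h6⟩ := h3 act obj ha
    refine ⟨?_, h6⟩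
    rcases eq_or_long_of_trunc_eq hc with rfl | h
    · exact h5
    · exact absurd (Finset.mem_union_right _ (Finset.mem_image.2 ⟨_, h5, rfl⟩)) h.1
  · exact absurd hmem h.2

open Classical in
theorem StaticDB.oracle_perf (I : StaticDB) (c t : Name) (d : Option I.Subject) :
    I.oracle.perf (I.trunc c) (I.trunc t) d = true ↔ I.Performable c t d := by
  refine decide_eq_true_iff.trans ⟨?_, fun h => ⟨c, t, rfl, rfl, h⟩⟩
  rintro ⟨c', t', hc, ht, h⟩
  exact h.of_trunc_eq hc ht

/-! ### Soundness of accepting runs -/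

/-- An instant of a trace: nothing is performed, or a performable task. -/
def GoodInstant (I : StaticDB) (p : Proc) (τ : Name → Option I.Subject) (a : Name → Bool) : Prop :=
  (a = fun _ => false) ∨
    ∃ X, (a = fun t => decide (t = X)) ∧ I.Performable p.name X (p.chargeOf τ X)

open Classical in
-- Letters cannot cheat: if `X` is not performable, or the purpose is not known yet, the instant
-- counts as idle.
theorem goodInstant_performed {I : StaticDB} {p : Proc} {τ : Name → Option I.Subject}
    {pn : Option I.Trunc} (hpn : pn = none ∨ pn = some (I.trunc p.name)) (m : Mode I.Subject)
    (X : Name) : GoodInstant I p τ (performed I.oracle pn m X (p.chargeOf τ X)) := by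
  by_cases hp : I.Performable p.name X (p.chargeOf τ X) ∧ m.isPerform = true ∧
    pn = some (I.trunc p.name)
  · refine Or.inr ⟨X, ?_, hp.1⟩
    funext t
    by_cases ht : t = X
    · subst ht
      simpa [performed, hp.2.1, hp.2.2, I.oracle_tr, I.oracle_perf] using hp.1
    · simp [performed, ht]
  · left
    funext t
    rw [Bool.eq_false_iff]
    intro h
    simp only [performed, Bool.and_eq_true, decide_eq_true_eq] at h
    obtain ⟨⟨rfl, hm⟩, h⟩ := h
    rcases hpn with rfl | rfl
    · simp at h
    · simp only [Option.any_some, I.oracle_tr, I.oracle_perf] at h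
      exact hp ⟨h, hm, rfl⟩

theorem mem_dutyTasks_of_mem {p : Proc} {c : Name × Name} (h : c ∈ p.sod ++ p.bod) :
    c.1 ∈ p.dutyTasks ∧ c.2 ∈ p.dutyTasks := by
  simp only [Proc.dutyTasks, List.mem_dedup, List.mem_flatMap]
  exact ⟨⟨c, h, by simp⟩, ⟨c, h, by simp⟩⟩

open Classical in
theorem pairOk_iff {b : Bool} {x y : Option S} :
    pairOk b x y = true ↔ ∃ u v, x = some u ∧ y = some v ∧ if b then u ≠ v else u = v :=
  decide_eq_true_iff

theorem canComplete_of_trace {I : StaticDB} {p : Proc} {τ : Name → Option I.Subject}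
    (a : Name → Bool) (L : List (Name → Bool)) (hL : ∀ b ∈ a :: L, GoodInstant I p τ b)
    (hc : ∀ φ ∈ p.constraints, traceVal (a :: L) φ = true)
    (hsod : ∀ c ∈ p.sod, pairOk true (τ c.1) (τ c.2) = true)
    (hbod : ∀ c ∈ p.bod, pairOk false (τ c.1) (τ c.2) = true) : CanComplete I p := by
  have hduty : ∀ t ∈ p.dutyTasks, ∃ s, τ t = some s := by
    intro t ht
    simp only [Proc.dutyTasks, List.mem_dedup, List.mem_flatMap, List.mem_append, List.mem_cons,
      List.not_mem_nil, or_false] at ht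
    obtain ⟨c, hcm, ht⟩ := ht
    have : ∃ u v, τ c.1 = some u ∧ τ c.2 = some v := by
      rcases hcm with h | h
      · obtain ⟨u, v, h1, h2, _⟩ := pairOk_iff.1 (hsod c h)
        exact ⟨u, v, h1, h2⟩
      · obtain ⟨u, v, h1, h2, _⟩ := pairOk_iff.1 (hbod c h)
        exact ⟨u, v, h1, h2⟩
    obtain ⟨u, v, h1, h2⟩ := this
    rcases ht with rfl | rfl
    · exact ⟨u, h1⟩
    · exact ⟨v, h2⟩
  -- The default value only concerns tasks without a subject, which are no duty tasks by `hduty`.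
  let charge : Name → Name := fun t => ((τ t).map Subtype.val).getD []
  have hcharge : ∀ t s, τ t = some s → charge t = s.1 := fun t s h => by simp [charge, h]
  have hreq : ∀ i : Fin (L.length + 1), ∃ q : Request,
      (∀ t, (q.IsOf p [] ∧ q.task = t) ↔ (a :: L)[i.val] t = true) ∧
      (q.IsOf p [] → q.Allowed I) ∧
      (q.IsOf p [] → q.task ∈ p.dutyTasks → q.sub = charge q.task) := by
    intro i
    rcases hL ((a :: L)[i.val]) (List.getElem_mem _) with h | ⟨X, h, sub, owner, h1, h2⟩
    -- Every instant needs some request, so an idle one is filled with a request of a foreign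
    -- process id.
    · have hno : ¬ (Request.mk [true] [] [] [] []).IsOf p [] := fun h => by
        simpa using h.1
      refine ⟨⟨[true], [], [], [], []⟩, ?_, fun h => absurd h hno, fun h => absurd h hno⟩
      intro t
      rw [h]
      simp [hno]
    · refine ⟨⟨[], sub, X, owner, p.name⟩, ?_, fun _ => h1, fun _ ht => ?_⟩
      · intro t
        rw [h]
        simp [Request.IsOf, eq_comm]
      · obtain ⟨s, hs⟩ := hduty X ht
        rw [hcharge X s hs]
        exact h2 s (by simpa [Proc.chargeOf, show X ∈ p.dutyTasks from ht] using hs)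
  choose run hrun hallow hsub using hreq
  refine ⟨[], L.length, run, charge, ?_, hallow, ?_, hsub, ?_, ?_⟩
  · intro φ hφ
    have h1 := (traceVal_drop_iff (a :: L) φ 0).1 (by simpa using hc φ hφ)
    exact (LTL.sat_congr φ (fun i t _ => hrun i t) 0).2 h1
  · intro t ht
    obtain ⟨s, hs⟩ := hduty t ht
    rw [hcharge t s hs]
    exact s.2
  · intro c hcm
    obtain ⟨u, v, h1, h2, h3⟩ := pairOk_iff.1 (hsod c hcm)
    rw [hcharge _ _ h1, hcharge _ _ h2]
    exact fun h => h3 (Subtype.ext h)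
  · intro c hcm
    obtain ⟨u, v, h1, h2, h3⟩ := pairOk_iff.1 (hbod c hcm)
    rw [hcharge _ _ h1, hcharge _ _ h2]
    exact congrArg Subtype.val h3

/-- Invariant: the values on the word are those of a trace `L` that is good for the current
assignment `τ`. Evaluation letters extend the trace at its front and leave `τ` alone. -/
theorem canComplete_of_accepts {I : StaticDB} {p : Proc} (ls : List (Letter I.Subject))
    (τ : Name → Option I.Subject) (pn : Option I.Trunc)
    (hpn : pn = none ∨ pn = some (I.trunc p.name)) (L : List (Name → Bool))
    (hL : ∀ a ∈ L, GoodInstant I p τ a)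
    (h : accepts I.oracle ls (p.cells τ (traceVal L), pn) = true) : CanComplete I p := by
  induction ls generalizing τ pn L with
  | nil => simp [accepts] at h
  | cons l ls ih =>
    rw [accepts, Bool.or_eq_true, accLetter_cells, readLetter_cells, I.oracle_tr] at h
    cases hm : l.2.isEval with
    | true =>
      rw [reassign_eval hm, hm] at h
      have hL' : ∀ a ∈ performed I.oracle pn l.2 l.1 (p.chargeOf τ l.1) :: L,
          GoodInstant I p τ a := by
        intro a ha
        rcases List.mem_cons.1 ha with rfl | ha
        · exact goodInstant_performed hpn _ _
        · exact hL a ha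
      rcases h with ⟨-, h1, h2, h3⟩ | h
      · exact canComplete_of_trace _ _ hL' h3 h1 h2
      · exact ih τ _ (Or.inr rfl) _ hL' h
    | false =>
      rw [hm, stepVal_false] at h
      -- An assignment letter forgets the trace, whose instants might not respect the new
      -- assignment. It is not accepted itself.
      exact ih _ _ (Or.inr rfl) [] (by simp) (h.resolve_left (by simp))

/-! ### Accepting runs for completable processes -/

theorem length_encodeName (x : Name) : (encodeName x).length = x.length + 1 := by
  induction x <;> simp_all [encodeName]

theorem LTL.length_le_of_mem_tasks {φ : LTL} {t : Name} (h : t ∈ φ.tasks) :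
    t.length ≤ (encodeLTL φ).length := by
  induction φ with
  | tt => simp [LTL.tasks] at h
  | task t =>
    rw [LTL.tasks, Finset.mem_singleton] at h
    simp only [h, encodeLTL, List.length_cons, length_encodeName]
    omega
  | neg φ ih => exact (ih h).trans (Nat.le_succ _)
  | next φ ih => exact (ih h).trans (Nat.le_succ _)
  | and φ ψ ih1 ih2 | untl φ ψ ih1 ih2 =>
    simp only [encodeLTL, List.length_cons, List.length_append]
    rcases Finset.mem_union.1 h with h | h
    · have := ih1 h
      omega
    · have := ih2 h
      omega

theorem length_le_encodeList {β : Type} (e : β → List Sym) {l : List β} {b : β} (h : b ∈ l) :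
    (e b).length ≤ (encodeList e l).length := by
  induction l with
  | nil => simp at h
  | cons a l ih =>
    rcases List.mem_cons.1 h with rfl | h
    · simp only [encodeList, List.length_cons, List.length_append]
      omega
    · have := ih h
      simp only [encodeList, List.length_cons, List.length_append]
      omega

theorem Proc.mem_tasks_iff {p : Proc} {t : Name} :
    t ∈ p.tasks ↔ (∃ φ ∈ p.constraints, t ∈ φ.tasks) ∨ t ∈ p.dutyTasks := by
  have h : ∀ l : List LTL, t ∈ (l.map LTL.tasks).foldr (· ∪ ·) ∅ ↔ ∃ φ ∈ l, t ∈ φ.tasks := by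
    intro l
    induction l <;> simp_all
  simp [Proc.tasks, h]

/-- Bounds the letters of an accepting sequence, and thereby the length of the tape. -/
theorem Proc.length_le_of_mem_tasks {p : Proc} {t : Name} (h : t ∈ p.tasks) :
    t.length ≤ p.encode.length := by
  simp only [Proc.encode, List.length_append]
  rcases Proc.mem_tasks_iff.1 h with ⟨φ, hφ, ht⟩ | ht
  · have h1 := LTL.length_le_of_mem_tasks ht
    have h2 := length_le_encodeList encodeLTL hφ
    omega
  · simp only [Proc.dutyTasks, List.mem_dedup, List.mem_flatMap, List.mem_append, List.mem_cons,
      List.not_mem_nil, or_false] at ht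
    obtain ⟨c, hc, ht⟩ := ht
    have h1 : t.length ≤ (encodePair c).length := by
      simp only [encodePair, List.length_append, length_encodeName]
      rcases ht with rfl | rfl <;> omega
    rcases hc with hc | hc <;> have h2 := length_le_encodeList encodePair hc <;> omega

theorem foldl_assign (O : Oracle S T) (p : Proc) (σ : Name → Option S) (l : List Name)
    (τ : Name → Option S) :
    ∃ τ', (∀ x ∈ l, τ' x = σ x) ∧
      (l.map fun t => (t, Mode.assign (σ t))).foldl (readLetter O)
        (p.cells τ (fun _ => false), some (O.tr p.name))
      = (p.cells τ' (fun _ => false), some (O.tr p.name)) := by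
  -- For the induction it must be added that later assignments do not spoil a correct one, since all
  -- of them follow the same `σ`.
  have h : ∀ (l : List Name) (τ : Name → Option S), ∃ τ', (∀ x, τ x = σ x → τ' x = σ x) ∧
      (∀ x ∈ l, τ' x = σ x) ∧ (l.map fun t => (t, Mode.assign (σ t))).foldl (readLetter O)
        (p.cells τ (fun _ => false), some (O.tr p.name))
      = (p.cells τ' (fun _ => false), some (O.tr p.name)) := by
    intro l
    induction l with
    | nil => exact fun τ => ⟨τ, fun _ h => h, by simp, rfl⟩
    | cons t l ih =>
      intro τ
      obtain ⟨τ', h0, h1, h2⟩ := ih (reassign (.assign (σ t)) t τ)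
      have h3 : ∀ x, τ x = σ x ∨ x = t → reassign (.assign (σ t)) t τ x = σ x := by
        intro x hx
        by_cases hxt : x = t
        · simp [reassign, Mode.reassign, hxt]
        · simpa [reassign, Mode.reassign, hxt] using hx.resolve_right hxt
      refine ⟨τ', fun x hx => h0 x (h3 x (Or.inl hx)), ?_, ?_⟩
      · intro x hx
        rcases List.mem_cons.1 hx with rfl | hx
        · exact h0 x (h3 x (Or.inr rfl))
        · exact h1 x hx
      · rw [List.map_cons, List.foldl_cons, readLetter_cells]
        simpa [Mode.isEval, stepVal_false] using h2
  obtain ⟨τ', -, h1, h2⟩ := h l τ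
  exact ⟨τ', h1, h2⟩

/-- `l` is in temporal order; the letters are read from its last instant to its first. -/
theorem foldl_eval (O : Oracle S T) (p : Proc) (τ : Name → Option S) (l : List (Letter S))
    (hl : ∀ a ∈ l, a.2.isEval = true) :
    l.reverse.foldl (readLetter O) (p.cells τ (fun _ => false), some (O.tr p.name))
      = (p.cells τ (traceVal (l.map fun a =>
          performed O (some (O.tr p.name)) a.2 a.1 (p.chargeOf τ a.1))), some (O.tr p.name)) := by
  induction l with
  | nil => rfl
  | cons a l ih =>
    have ha := hl a (by simp)
    rw [List.reverse_cons, List.foldl_append, ih fun b hb => hl b (by simp [hb])]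
    simp [readLetter_cells, reassign_eval ha, ha, traceVal]

open Classical in
theorem exists_accepts_of_canComplete {I : StaticDB} {p : Proc} (h : CanComplete I p) :
    ∃ ls : List (Letter I.Subject), (∀ l ∈ ls, l.1.length ≤ p.encode.length) ∧
      accepts I.oracle ls (p.encode.map Cell.plain, none) = true := by
  obtain ⟨id, n, run, charge, hc⟩ := h
  let σ : Name → Option I.Subject := fun t =>
    if h : charge t ∈ I.adom .subject then some ⟨charge t, h⟩ else none
  have hσ : ∀ t ∈ p.dutyTasks, ∃ s, σ t = some s ∧ s.1 = charge t := by
    intro t ht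
    exact ⟨⟨charge t, hc.charge_mem t ht⟩, dif_pos _, rfl⟩
  -- Tasks that the process does not mention become idle instants: its constraints cannot see them,
  -- and their names may be arbitrarily long.
  let f : Fin (n + 1) → Letter I.Subject := fun i =>
    if (run i).IsOf p id ∧ (run i).task ∈ p.tasks then ((run i).task, .perform) else ([], .idle)
  have hf : ∀ i, (f i).2.isEval = true := by
    intro i
    simp only [f]
    split_ifs <;> rfl
  obtain ⟨τ, hτ, hfold⟩ := foldl_assign I.oracle p σ p.dutyTasks (reassign (.assign none) []
    (fun _ => none))
  set tr : List (Name → Bool) := List.ofFn fun i =>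
    performed I.oracle (some (I.oracle.tr p.name)) (f i).2 (f i).1 (p.chargeOf τ (f i).1) with htr
  have hper : ∀ i t, t ∈ p.tasks → (((run i).IsOf p id ∧ (run i).task = t) ↔
      performed I.oracle (some (I.oracle.tr p.name)) (f i).2 (f i).1 (p.chargeOf τ (f i).1) t
        = true) := by
    intro i t ht
    by_cases hi : (run i).IsOf p id ∧ (run i).task ∈ p.tasks
    · have hfi : f i = ((run i).task, .perform) := if_pos hi
      have hP : I.Performable p.name (run i).task (p.chargeOf τ (run i).task) := by
        refine ⟨(run i).sub, (run i).owner, ?_, ?_⟩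
        · have := hc.allowed i hi.1
          rw [← hi.1.2]
          exact this
        · intro s hs
          unfold Proc.chargeOf at hs
          split_ifs at hs with hd
          obtain ⟨s', hs', he⟩ := hσ _ hd
          rw [hτ _ hd, hs'] at hs
          rw [hc.charge_eq i hi.1 hd, ← he, Option.some.inj hs]
      simp only [hfi, performed, Mode.isPerform, Option.any_some, I.oracle_tr, Bool.and_true,
        Bool.and_eq_true, decide_eq_true_eq]
      constructor
      · rintro ⟨-, rfl⟩
        exact ⟨rfl, (I.oracle_perf _ _ _).2 hP⟩
      · exact fun h => ⟨hi.1, h.1.symm⟩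
    · have hfi : f i = ([], .idle) := if_neg hi
      simp only [hfi, performed, Mode.isPerform, Bool.and_false, Bool.false_and,
        Bool.false_eq_true, iff_false]
      rintro ⟨h1, rfl⟩
      exact hi ⟨h1, ht⟩
  -- A first dummy pass learns the purpose. Then the duty tasks get their subjects, and the trace is
  -- replayed backwards; the letter of the first instant is the accepting one.
  refine ⟨([], .assign none) :: ((p.dutyTasks.map fun t => (t, .assign (σ t))) ++
    ((List.ofFn fun i : Fin n => f i.succ).reverse ++ [f 0])), ?_, ?_⟩
  · have hlen : ∀ i, (f i).1.length ≤ p.encode.length := by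
      intro i
      simp only [f]
      split_ifs with h
      · exact Proc.length_le_of_mem_tasks h.2
      · simp
    intro l hl
    simp only [List.mem_cons, List.mem_append, List.mem_map, List.mem_reverse, List.mem_ofFn,
      List.not_mem_nil, or_false] at hl
    rcases hl with rfl | ⟨t, ht, rfl⟩ | ⟨i, rfl⟩ | rfl
    · simp
    · exact Proc.length_le_of_mem_tasks (Proc.mem_tasks_iff.2 (Or.inr ht))
    · exact hlen _
    · exact hlen _
  · rw [accepts, Bool.or_eq_true]
    right
    rw [map_plain_encode, readLetter_cells, accepts_append, Bool.or_eq_true]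
    right
    simp only [Mode.isEval, stepVal_false]
    rw [hfold, accepts_append, Bool.or_eq_true]
    right
    rw [foldl_eval _ _ _ _ (by
      intro a ha
      obtain ⟨i, rfl⟩ := List.mem_ofFn.1 ha
      exact hf _)]
    rw [accepts, Bool.or_eq_true]
    left
    rw [accLetter_cells, reassign_eval (hf 0)]
    refine ⟨hf 0, ?_, ?_, ?_⟩
    · intro c hcm
      obtain ⟨h1, h2⟩ := mem_dutyTasks_of_mem (List.mem_append_left p.bod hcm)
      obtain ⟨s1, hs1, he1⟩ := hσ _ h1
      obtain ⟨s2, hs2, he2⟩ := hσ _ h2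
      refine pairOk_iff.2 ⟨s1, s2, (hτ _ h1).trans hs1, (hτ _ h2).trans hs2, ?_⟩
      rw [if_pos rfl]
      rintro rfl
      exact hc.sod c hcm (he1.symm.trans he2)
    · intro c hcm
      obtain ⟨h1, h2⟩ := mem_dutyTasks_of_mem (List.mem_append_right p.sod hcm)
      obtain ⟨s1, hs1, he1⟩ := hσ _ h1
      obtain ⟨s2, hs2, he2⟩ := hσ _ h2
      refine pairOk_iff.2 ⟨s1, s2, (hτ _ h1).trans hs1, (hτ _ h2).trans hs2, ?_⟩
      rw [if_neg (by simp)]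
      exact Subtype.ext (he1.trans ((hc.bod c hcm).trans he2.symm))
    · intro φ hφ
      have h1 := hc.constraints φ hφ
      have htrace : tr = performed I.oracle (some (I.oracle.tr p.name)) (f 0).2 (f 0).1
          (p.chargeOf τ (f 0).1) :: (List.ofFn fun i : Fin n => f i.succ).map fun a =>
            performed I.oracle (some (I.oracle.tr p.name)) a.2 a.1 (p.chargeOf τ a.1) := by
        rw [htr, List.ofFn_succ, List.map_ofFn]
        rfl
      have hl : tr.length = n + 1 := by simp [htr]
      have h2 := (traceVal_drop_iff tr φ ⟨0, by omega⟩).2 ?_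
      · rw [List.drop_zero, htrace] at h2
        rw [hf 0]
        exact h2
      -- `tr.length` equals `n + 1` only propositionally, so satisfaction is transported along this
      -- equation.
      · have h3 : ∀ (k : ℕ) (hk : k = n + 1) (W : Fin k → Name → Prop) (h0 : 0 < k),
            (∀ i, ∀ t ∈ φ.tasks, ((run (i.cast hk)).IsOf p id ∧ (run (i.cast hk)).task = t)
              ↔ W i t) → φ.Sat W ⟨0, h0⟩ := by
          rintro k rfl W h0 hW
          exact (LTL.sat_congr φ hW 0).1 h1
        refine h3 tr.length hl _ _ ?_
        intro i t ht
        rw [hper _ t (Proc.mem_tasks_iff.2 (Or.inl ⟨φ, hφ, ht⟩))]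
        rw [Fin.getElem_fin, List.getElem_of_eq htr, List.getElem_ofFn]
        rfl

theorem mem_completionProblem_of_accepts {I : StaticDB} {w : List Sym}
    {ls : List (Letter I.Subject)}
    (h : accepts I.oracle ls (w.map Cell.plain, none) = true) : w ∈ completionProblem I := by
  have key : ∀ (ls : List (Letter I.Subject)) (s : RunSt I.Subject I.Trunc),
      accepts I.oracle ls s = true → ∃ p : Proc, p.encode = s.1.map Cell.sym := by
    intro ls
    induction ls with
    | nil => simp [accepts]
    | cons l ls ih =>
      intro s hs
      rw [accepts, Bool.or_eq_true] at hs
      rcases hs with hs | hs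
      · exact exists_encode_of_accepts hs
      · obtain ⟨p, hp⟩ := ih _ hs
        exact ⟨p, hp.trans (pass_out_sym _ _ _ _ _)⟩
  obtain ⟨p, hp⟩ := key _ _ h
  have hw : p.encode = w := by
    rw [hp, List.map_map]
    exact List.map_id w
  refine ⟨p, hw, ?_⟩
  rw [← hw, map_plain_encode] at h
  exact canComplete_of_accepts ls _ none (Or.inl rfl) [] (by simp) h

end PurposeAware

/-! ### Exponentially long tapes as certificates -/

namespace PurposeAware

variable {S T : Type}

/-! ### Finiteness of the alphabets -/

instance : Finite Sym :=
  Finite.of_injective (β := Fin 11) (fun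
    | .zero => 0 | .one => 1 | .endName => 2 | .tt => 3 | .task => 4 | .neg => 5 | .and => 6
    | .next => 7 | .untl => 8 | .item => 9 | .endList => 10)
    (by intro a b h; cases a <;> cases b <;> first | rfl | exact absurd h (by decide))

instance [Finite S] : Finite (Mode S) :=
  Finite.of_injective (β := Option S ⊕ Bool) (fun
    | .assign o => Sum.inl o | .idle => Sum.inr false | .perform => Sum.inr true)
    (by rintro (_ | _ | _) (_ | _ | _) h <;> simp_all)

instance [Finite S] : Finite (Cell S) :=
  Finite.of_injective (fun x => (x.sym, x.val, x.sub))
    (by rintro ⟨_, _, _⟩ ⟨_, _, _⟩ h; simp_all)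

/-! ### Letters written on a tape -/

/-- The tape alphabet: letters are written as the bits of the name, followed by the mode. -/
abbrev TapeSym (S : Type) : Type := Bool ⊕ Mode S

def Letter.encode (l : Letter S) : List (TapeSym S) := l.1.map Sum.inl ++ [Sum.inr l.2]

/-- Reading the letters from a tape; `X` consists of the bits of the next letter that have been
read already.  The result tells whether some letter is accepted. -/
noncomputable def runTape (O : Oracle S T) : List (TapeSym S) → Name → RunSt S T → Bool
  | [], _, _ => false
  | Sum.inl b :: c, X, s => runTape O c (X ++ [b]) s
  | Sum.inr m :: c, X, s => accLetter O s (X, m) || runTape O c [] (readLetter O s (X, m))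

theorem exists_accepts_of_runTape {O : Oracle S T} {c : List (TapeSym S)} {X : Name}
    {s : RunSt S T} (h : runTape O c X s = true) : ∃ ls, accepts O ls s = true := by
  induction c generalizing X s with
  | nil => simp [runTape] at h
  | cons a c ih =>
    cases a with
    | inl b => exact ih h
    | inr m =>
      rw [runTape, Bool.or_eq_true] at h
      rcases h with h | h
      · exact ⟨[(X, m)], by simp [accepts, h]⟩
      · obtain ⟨ls, hls⟩ := ih h
        exact ⟨(X, m) :: ls, by simp [accepts, hls]⟩

theorem runTape_map_inl (O : Oracle S T) (x X : Name) (c : List (TapeSym S)) (s : RunSt S T) :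
    runTape O (x.map Sum.inl ++ c) X s = runTape O c (X ++ x) s := by
  induction x generalizing X with
  | nil => simp
  | cons b x ih => simp [runTape, ih]

/-- Acceptance is remembered, so whatever follows on the tape does no harm; hence tapes can be
padded to one common length. -/
theorem runTape_flatMap_encode {O : Oracle S T} {ls : List (Letter S)} {s : RunSt S T}
    (h : accepts O ls s = true) (c : List (TapeSym S)) :
    runTape O (ls.flatMap Letter.encode ++ c) [] s = true := by
  induction ls generalizing s with
  | nil => simp [accepts] at h
  | cons l ls ih =>
    rw [accepts, Bool.or_eq_true] at h
    rw [List.flatMap_cons, Letter.encode, List.append_assoc, List.append_assoc, runTape_map_inl,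
      List.nil_append, List.singleton_append, runTape, Bool.or_eq_true]
    rcases h with h | h
    · exact Or.inl h
    · exact Or.inr (ih h)

theorem length_flatMap_encode_le {n : ℕ} {ls : List (Letter S)} (h : ∀ l ∈ ls, l.1.length ≤ n) :
    (ls.flatMap Letter.encode).length ≤ ls.length * (n + 1) := by
  induction ls with
  | nil => simp
  | cons l ls ih =>
    have h1 := ih fun a ha => h a (by simp [ha])
    have h2 := h l (by simp)
    simp only [List.flatMap_cons, List.length_append, Letter.encode, List.length_map,
      List.length_cons, List.length_nil, Nat.add_mul]
    omega

/-! ### Short accepting runs -/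

/-- The runs on annotated words of length `n` as an automaton. -/
noncomputable def runDFA (O : Oracle S T) (n : ℕ) :
    DFA (Letter S) (List.Vector (Cell S) n × Option T) where
  step s l := (⟨(readLetter O (s.1.1, s.2) l).1, (length_pass_out _ _ _ _ _).trans s.1.2⟩,
    (readLetter O (s.1.1, s.2) l).2)
  -- Only the transitions matter, for the sake of the loop in `evalFrom_split`; the start state and
  -- the accepting set are placeholders.
  start := (List.Vector.replicate n (.plain .tt), none)
  accept := ∅

theorem runDFA_evalFrom (O : Oracle S T) (n : ℕ) (ls : List (Letter S))
    (s : List.Vector (Cell S) n × Option T) :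
    (((runDFA O n).evalFrom s ls).1.1, ((runDFA O n).evalFrom s ls).2)
      = ls.foldl (readLetter O) (s.1.1, s.2) := by
  induction ls generalizing s with
  | nil => rfl
  | cons l ls ih => exact ih ((runDFA O n).step s l)

theorem accepts_iff (O : Oracle S T) (ls : List (Letter S)) (s : RunSt S T) :
    accepts O ls s = true ↔ ∃ (l₁ : List (Letter S)) (a : Letter S) (l₂ : List (Letter S)),
      ls = l₁ ++ a :: l₂ ∧ accLetter O (l₁.foldl (readLetter O) s) a = true := by
  induction ls generalizing s with
  | nil => simp [accepts]
  | cons l ls ih =>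
    rw [accepts, Bool.or_eq_true, ih]
    constructor
    · rintro (h | ⟨l₁, a, l₂, rfl, h⟩)
      · exact ⟨[], l, ls, rfl, h⟩
      · exact ⟨l :: l₁, a, l₂, rfl, h⟩
    · rintro ⟨_ | ⟨b, l₁⟩, a, l₂, he, h⟩
      · obtain ⟨rfl, rfl⟩ := List.cons.inj he
        exact Or.inl h
      · obtain ⟨rfl, rfl⟩ := List.cons.inj he
        exact Or.inr ⟨l₁, a, l₂, rfl, h⟩

/-- In a shortest sequence leading to an accepting letter no state repeats before that letter, and
the states are pairs of an annotated word and a purpose. -/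
theorem exists_short_accepts [Finite S] [Finite T] {O : Oracle S T} {n : ℕ} {s : RunSt S T}
    (hs : s.1.length = n) {ls : List (Letter S)} (hls : ∀ l ∈ ls, l.1.length ≤ n)
    (h : accepts O ls s = true) :
    ∃ ls : List (Letter S), (∀ l ∈ ls, l.1.length ≤ n) ∧ accepts O ls s = true ∧
      ls.length ≤ Nat.card (Cell S) ^ n * Nat.card (Option T) := by
  classical
  have := Fintype.ofFinite (Cell S)
  have := Fintype.ofFinite T
  have hcard : Fintype.card (List.Vector (Cell S) n × Option T)
      = Nat.card (Cell S) ^ n * Nat.card (Option T) := by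
    rw [Fintype.card_prod, card_vector, Nat.card_eq_fintype_card, Nat.card_eq_fintype_card]
  rw [← hcard]
  let P : ℕ → Prop := fun k => ∃ (l₁ : List (Letter S)) (a : Letter S), l₁.length = k ∧
    (∀ l ∈ l₁ ++ [a], l.1.length ≤ n) ∧ accLetter O (l₁.foldl (readLetter O) s) a = true
  have hP : ∃ k, P k := by
    obtain ⟨l₁, a, l₂, rfl, ha⟩ := (accepts_iff O ls s).1 h
    refine ⟨_, l₁, a, rfl, fun l hl => hls l ?_, ha⟩
    simp only [List.mem_append, List.mem_cons, List.not_mem_nil, or_false] at hl ⊢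
    tauto
  obtain ⟨l₁, a, hk, hlen, ha⟩ := Nat.find_spec hP
  refine ⟨l₁ ++ [a], hlen, (accepts_iff O _ s).2 ⟨l₁, a, [], rfl, ha⟩, ?_⟩
  rw [List.length_append, List.length_singleton, Nat.succ_le_iff]
  by_contra hlt
  -- The nonempty loop `y` leads from `q` back to `q` and can be dropped, against minimality.
  obtain ⟨q, x, y, z, rfl, -, hy, h1, h2, h3⟩ := (runDFA O n).evalFrom_split
    (s := (⟨s.1, hs⟩, s.2)) (not_lt.1 hlt) rfl
  have heq : (x ++ y ++ z).foldl (readLetter O) s = (x ++ z).foldl (readLetter O) s := by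
    have e1 := runDFA_evalFrom O n (x ++ y ++ z) (⟨s.1, hs⟩, s.2)
    have e2 := runDFA_evalFrom O n (x ++ z) (⟨s.1, hs⟩, s.2)
    rw [← h3] at e1
    rw [DFA.evalFrom_of_append, h1] at e2
    exact e1.symm.trans e2
  refine Nat.find_min hP (m := (x ++ z).length) ?_ ⟨x ++ z, a, rfl, fun l hl => hlen l ?_, heq ▸ ha⟩
  · rw [← hk]
    have := List.length_pos_iff.2 hy
    simp only [List.length_append]
    omega
  · simp only [List.mem_append, List.mem_cons, List.not_mem_nil, or_false] at hl ⊢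
    tauto

/-- The length of the tape for words of length `n`. -/
noncomputable def tapeLength (S T : Type) (n : ℕ) : ℕ :=
  Nat.card (Option T) * (2 * Nat.card (Cell S)) ^ n

theorem mem_completionProblem_iff (I : StaticDB) (w : List Sym) :
    w ∈ completionProblem I ↔ ∃ c : List (TapeSym I.Subject),
      c.length = tapeLength I.Subject I.Trunc w.length ∧
      runTape I.oracle c [] (w.map Cell.plain, none) = true := by
  constructor
  · rintro ⟨p, rfl, h⟩
    obtain ⟨ls, hls, h⟩ := exists_accepts_of_canComplete h
    obtain ⟨ls, hls, h, hlen⟩ := exists_short_accepts (by simp) hls h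
    have h1 := length_flatMap_encode_le hls
    have h2 : (ls.flatMap Letter.encode).length
        ≤ tapeLength I.Subject I.Trunc p.encode.length := by
      refine h1.trans ?_
      -- A letter takes at most `n + 1 ≤ 2 ^ n` tape symbols, which explains the factor `2` in the
      -- base of `tapeLength`.
      rw [tapeLength, mul_pow, mul_left_comm, mul_comm (Nat.card _), mul_comm (2 ^ _)]
      exact Nat.mul_le_mul hlen Nat.lt_two_pow_self
    -- The padding consists of bits with no mode after them, so it never forms a letter.
    refine ⟨ls.flatMap Letter.encode ++ List.replicate (tapeLength I.Subject I.Trunc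
      p.encode.length - (ls.flatMap Letter.encode).length) (Sum.inl false), ?_, ?_⟩
    · rw [List.length_append, List.length_replicate]
      omega
    · exact runTape_flatMap_encode h _
  · rintro ⟨c, -, h⟩
    obtain ⟨ls, hls⟩ := exists_accepts_of_runTape h
    exact mem_completionProblem_of_accepts hls

/-! ### Counting through all tapes of a given length -/

section Odometer

variable {A : Type} {m : ℕ} (e : A ≃ Fin (m + 1))

/-- The next digit. -/
def nextDigit (a : A) : A := e.symm (e a + 1)

def isLastDigit (a : A) : Bool := decide (e a = Fin.last m)

/-- Adds a carry to a number whose least significant digit comes first. -/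
def increment : Bool → List A → List A × Bool
  | c, [] => ([], c)
  | c, a :: l => ((if c then nextDigit e a else a) :: (increment (c && isLastDigit e a) l).1,
      (increment (c && isLastDigit e a) l).2)

def digitsVal (l : List A) : ℕ := Nat.ofDigits (m + 1) (l.map fun a => (e a : ℕ))

theorem length_increment (c : Bool) (l : List A) : (increment e c l).1.length = l.length := by
  induction l generalizing c with
  | nil => rfl
  | cons a l ih => simp [increment, ih]

theorem digitsVal_cons (a : A) (l : List A) :
    digitsVal e (a :: l) = e a + (m + 1) * digitsVal e l := by
  simp [digitsVal, Nat.ofDigits_cons]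

/-- The carry that drops out counts with weight `(m + 1) ^ l.length`, so it appears exactly on
overflow: this is how the machine notices that all tapes have been tried. -/
theorem digitsVal_increment (c : Bool) (l : List A) :
    digitsVal e (increment e c l).1 + (m + 1) ^ l.length * (increment e c l).2.toNat
      = digitsVal e l + c.toNat := by
  induction l generalizing c with
  | nil => simp [increment, digitsVal]
  | cons a l ih =>
    cases c with
    | false =>
      have := ih false
      simp only [increment, digitsVal_cons, Bool.false_and, List.length_cons, pow_succ,
        Bool.false_eq_true, if_false]
      simp only [Bool.toNat_false, add_zero] at this ⊢
      rw [← this]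
      ring
    | true =>
      by_cases ha : e a = Fin.last m
      · have := ih true
        simp only [increment, digitsVal_cons, Bool.true_and, List.length_cons, pow_succ,
          if_true, isLastDigit, ha, decide_true, nextDigit, Equiv.apply_symm_apply,
          Fin.last_add_one, Fin.val_zero, Fin.val_last]
        simp only [Bool.toNat_true] at this ⊢
        have h2 : m + (m + 1) * digitsVal e l + 1 = (m + 1) * (digitsVal e l + 1) := by ring
        rw [h2, ← this]
        ring
      · have := ih false
        have h1 : ((e a + 1 : Fin (m + 1)) : ℕ) = e a + 1 :=
          Fin.val_add_one_of_lt (Fin.lt_last_iff_ne_last.2 ha)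
        simp only [increment, digitsVal_cons, Bool.true_and, List.length_cons, pow_succ,
          if_true, isLastDigit, ha, decide_false, nextDigit, Equiv.apply_symm_apply, h1]
        simp only [Bool.toNat_true, Bool.toNat_false, add_zero] at this ⊢
        rw [← this]
        ring

theorem digitsVal_lt (l : List A) : digitsVal e l < (m + 1) ^ l.length := by
  induction l with
  | nil => simp [digitsVal]
  | cons a l ih =>
    rw [digitsVal_cons, List.length_cons, pow_succ]
    have := (e a).2
    nlinarith

theorem digitsVal_injective {l l' : List A} (hl : l.length = l'.length)
    (h : digitsVal e l = digitsVal e l') : l = l' := by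
  induction l generalizing l' with
  | nil => exact (List.length_eq_zero_iff.1 hl.symm).symm
  | cons a l ih =>
    obtain _ | ⟨b, l'⟩ := l'
    · simp at hl
    · rw [digitsVal_cons, digitsVal_cons] at h
      have h1 := congrArg (· % (m + 1)) h
      simp only [Nat.add_mul_mod_self_left, Nat.mod_eq_of_lt (e a).2,
        Nat.mod_eq_of_lt (e b).2] at h1
      rw [h1] at h
      have h2 : digitsVal e l = digitsVal e l' :=
        Nat.eq_of_mul_eq_mul_left (Nat.succ_pos m) (Nat.add_left_cancel h)
      rw [ih (by simpa using hl) h2, e.injective (Fin.ext h1)]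

end Odometer

end PurposeAware

/-! ### Bulk operations on stacks -/

namespace StackProg

open Function

variable {K : Type} {Γ : K → Type} {σ : Type} [DecidableEq K] {B : ℕ}
  {Q : σ → (∀ k, List (Γ k)) → Prop} {v : σ} {S : ∀ k, List (Γ k)}

/-- Programs run one after the other. -/
def block : List (StackProg K Γ σ) → StackProg K Γ σ
  | [] => load id
  | P :: l => seq P (block l)

theorem wp_block_nil : Wp B (block []) Q v S ↔ Q v S := wp_load

theorem wp_block_cons {P : StackProg K Γ σ} {l : List (StackProg K Γ σ)} :
    Wp B (block (P :: l)) Q v S ↔ Wp B P (Wp B (block l) Q) v S := wp_seq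

/-- Emptying a stack. -/
theorem wp_clear {k : K} {g : σ → Option (Γ k) → σ} {c : σ → Bool}
    (hc : ∀ v a, c (g v a) = a.isSome) (hg : ∀ v a b, g (g v a) b = g v b)
    (h : Q (g v none) (update S k [])) : Wp B (each k g c (load id)) Q v S := by
  refine wp_each (fun l v' S' => g v' none = g v none ∧ S' = update S k l) (S k) ?_ hc ?_ ?_ ?_
  · rintro l v' S' ⟨-, rfl⟩
    simp
  · rintro a l v' S' ⟨h1, rfl⟩
    exact wp_load.2 ⟨(hg _ _ _).trans h1, by simp⟩
  · rintro v' S' ⟨h1, rfl⟩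
    rwa [h1]
  · exact ⟨rfl, by simp⟩

/-- Moving the contents of a stack onto another one. -/
theorem wp_pour {k j : K} (hkj : k ≠ j) {g : σ → Option (Γ k) → σ} {c : σ → Bool} {f : σ → Γ j}
    (φ : Γ k → Γ j) (hc : ∀ v a, c (g v a) = a.isSome) (hg : ∀ v a b, g (g v a) b = g v b)
    (hf : ∀ v a, f (g v (some a)) = φ a) (hB : (S k).length + (S j).length ≤ B)
    (h : Q (g v none) (update (update S k []) j ((S k).reverse.map φ ++ S j))) :
    Wp B (each k g c (push j f)) Q v S := by
  -- `d` is the part already moved. The register may change only in the component that `g`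
  -- overwrites, which is what comparing the values `g _ none` expresses.
  refine wp_each (fun l v' S' => g v' none = g v none ∧ ∃ d, S k = d ++ l ∧
    S' = update (update S k l) j (d.reverse.map φ ++ S j)) (S k) ?_ hc ?_ ?_ ?_
  · rintro l v' S' ⟨-, d, hd, rfl⟩
    simp [update_of_ne hkj]
  · rintro a l v' S' ⟨h1, d, hd, rfl⟩
    refine wp_push.2 ⟨?_, (hg _ _ _).trans h1, d ++ [a], by simp [hd], ?_⟩
    · simp only [update_of_ne hkj.symm, update_self, List.length_append, List.length_map,
        List.length_reverse]
      have := congrArg List.length hd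
      simp only [List.length_append, List.length_cons] at this
      omega
    · rw [hf]
      funext i
      rcases eq_or_ne i j with rfl | hij
      · simp [update_of_ne hkj.symm]
      · rcases eq_or_ne i k with rfl | hik
        · simp [update_of_ne hij]
        · simp [update_of_ne hij, update_of_ne hik]
  · rintro v' S' ⟨h1, d, hd, rfl⟩
    rw [List.append_nil] at hd
    rwa [h1, ← hd]
  · exact ⟨rfl, [], rfl, by simp⟩

end StackProg

/-! ### The machine: configurations and single cells -/

namespace PurposeAware

open StackProg Function

/-! ### The stacks and the registers of the machine -/

inductive Stk : Type where
  | inp | out | word | word' | tape | tape' | name | name' | vals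
deriving DecidableEq

instance : Finite Stk :=
  Finite.of_injective (β := Fin 9) (fun
    | .inp => 0 | .out => 1 | .word => 2 | .word' => 3 | .tape => 4 | .tape' => 5 | .name => 6
    | .name' => 7 | .vals => 8)
    (by intro a b h; cases a <;> cases b <;> first | rfl | exact absurd h (by decide))

noncomputable instance : Fintype Stk := Fintype.ofFinite _

abbrev StkSym (S : Type) : Stk → Type
  | .inp => Sym
  | .out => Bool
  | .word => Cell S
  | .word' => Cell S
  | .tape => TapeSym S
  | .tape' => TapeSym S
  | .name => Bool
  | .name' => Bool
  | .vals => Bool × Bool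

variable {S T : Type}

instance [Finite S] : ∀ k, Finite (StkSym S k)
  | .inp => inferInstanceAs (Finite Sym)
  | .out => inferInstanceAs (Finite Bool)
  | .word => inferInstanceAs (Finite (Cell S))
  | .word' => inferInstanceAs (Finite (Cell S))
  | .tape => inferInstanceAs (Finite (TapeSym S))
  | .tape' => inferInstanceAs (Finite (TapeSym S))
  | .name => inferInstanceAs (Finite Bool)
  | .name' => inferInstanceAs (Finite Bool)
  | .vals => inferInstanceAs (Finite (Bool × Bool))

/-- Normal form for stack contents; the `update` lemmas below always return to it. -/
def stks (a : List Sym) (b : List Bool) (u u' : List (Cell S)) (c c' : List (TapeSym S))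
    (x x' : List Bool) (V : List (Bool × Bool)) : ∀ k, List (StkSym S k)
  | .inp => a
  | .out => b
  | .word => u
  | .word' => u'
  | .tape => c
  | .tape' => c'
  | .name => x
  | .name' => x'
  | .vals => V

section Stacks

variable (a a₁ : List Sym) (b b₁ : List Bool) (u u' u₁ : List (Cell S))
  (c c' c₁ : List (TapeSym S)) (x x' x₁ : List Bool) (V V₁ : List (Bool × Bool))

theorem stks_out : stks a b u u' c c' x x' V .out = b := rfl
theorem stks_word : stks a b u u' c c' x x' V .word = u := rfl
theorem stks_word' : stks a b u u' c c' x x' V .word' = u' := rfl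
theorem stks_tape : stks a b u u' c c' x x' V .tape = c := rfl
theorem stks_tape' : stks a b u u' c c' x x' V .tape' = c' := rfl
theorem stks_name : stks a b u u' c c' x x' V .name = x := rfl
theorem stks_name' : stks a b u u' c c' x x' V .name' = x' := rfl
theorem stks_vals : stks a b u u' c c' x x' V .vals = V := rfl

theorem update_inp : update (stks a b u u' c c' x x' V) .inp a₁
    = stks a₁ b u u' c c' x x' V := by
  funext k; cases k <;> rfl
theorem update_out : update (stks a b u u' c c' x x' V) .out b₁
    = stks a b₁ u u' c c' x x' V := by
  funext k; cases k <;> rfl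
theorem update_word : update (stks a b u u' c c' x x' V) .word u₁
    = stks a b u₁ u' c c' x x' V := by
  funext k; cases k <;> rfl
theorem update_word' : update (stks a b u u' c c' x x' V) .word' u₁
    = stks a b u u₁ c c' x x' V := by
  funext k; cases k <;> rfl
theorem update_tape : update (stks a b u u' c c' x x' V) .tape c₁
    = stks a b u u' c₁ c' x x' V := by
  funext k; cases k <;> rfl
theorem update_tape' : update (stks a b u u' c c' x x' V) .tape' c₁
    = stks a b u u' c c₁ x x' V := by
  funext k; cases k <;> rfl
theorem update_name : update (stks a b u u' c c' x x' V) .name x₁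
    = stks a b u u' c c' x₁ x' V := by
  funext k; cases k <;> rfl
theorem update_name' : update (stks a b u u' c c' x x' V) .name' x₁
    = stks a b u u' c c' x x₁ V := by
  funext k; cases k <;> rfl
theorem update_vals : update (stks a b u u' c c' x x' V) .vals V₁
    = stks a b u u' c c' x x' V₁ := by
  funext k; cases k <;> rfl

end Stacks

/-- The registers that matter throughout the computation. -/
structure Glob (S T : Type) : Type where
  sym : Option Sym
  tape : Option (TapeSym S)
  purpose : Option T
  mode : Mode S
  acc : Bool
  carry : Bool
  fin : Bool

/-- The registers used while a letter is read. -/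
structure Loc (S T : Type) : Type where
  cell : Option (Cell S)
  bit : Option Bool
  r1 : Option (Bool × Bool)
  r2 : Option (Bool × Bool)
  ctl : Ctl S
  cmp : Bool
  cur : T

abbrev Reg (S T : Type) : Type := Glob S T × Loc S T

instance : Finite Phase :=
  Finite.of_injective (β := Fin 7 × Bool) (fun
    | .start => (0, false) | .list b => (1, b) | .snd b => (2, b) | .fst b => (3, b)
    | .form => (4, false) | .leaf => (5, false) | .fail => (6, false))
    (by rintro (_ | _ | _ | _ | _ | _ | _) (_ | _ | _ | _ | _ | _ | _) h <;> simp_all)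

instance [Finite S] : Finite (Ctl S) :=
  Finite.of_injective (fun x => (x.phase, x.duty, x.partner, x.ok))
    (by rintro ⟨⟩ ⟨⟩ h; simp_all)

instance [Finite S] [Finite T] : Finite (Glob S T) :=
  Finite.of_injective (fun x => (x.sym, x.tape, x.purpose, x.mode, x.acc, x.carry, x.fin))
    (by rintro ⟨⟩ ⟨⟩ h; simp_all)

instance [Finite S] [Finite T] : Finite (Loc S T) :=
  Finite.of_injective (fun x => (x.cell, x.bit, x.r1, x.r2, x.ctl, x.cmp, x.cur))
    (by rintro ⟨⟩ ⟨⟩ h; simp_all)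

def setSym (v : Reg S T) (a : Option Sym) : Reg S T := ({ v.1 with sym := a }, v.2)
def setTape (v : Reg S T) (a : Option (TapeSym S)) : Reg S T := ({ v.1 with tape := a }, v.2)
def setCell (v : Reg S T) (a : Option (Cell S)) : Reg S T := (v.1, { v.2 with cell := a })
def setBit (v : Reg S T) (a : Option Bool) : Reg S T := (v.1, { v.2 with bit := a })
def setR1 (v : Reg S T) (a : Option (Bool × Bool)) : Reg S T := (v.1, { v.2 with r1 := a })
def setR2 (v : Reg S T) (a : Option (Bool × Bool)) : Reg S T := (v.1, { v.2 with r2 := a })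

def hasSym (v : Reg S T) : Bool := v.1.sym.isSome
def hasTape (v : Reg S T) : Bool := v.1.tape.isSome
def hasCell (v : Reg S T) : Bool := v.2.cell.isSome
def hasBit (v : Reg S T) : Bool := v.2.bit.isSome
def hasR1 (v : Reg S T) : Bool := v.2.r1.isSome

def getCell (v : Reg S T) : Cell S := v.2.cell.getD (.plain .tt)
def getTape (v : Reg S T) : TapeSym S := v.1.tape.getD (Sum.inl false)
def getBit (v : Reg S T) : Bool := v.2.bit.getD false

abbrev MProg (S T : Type) : Type := StackProg Stk (StkSym S) (Reg S T)

/-! ### Reading a cell -/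

/-- Moves the bits of the current name that have been compared back to their stack. -/
def restore : MProg S T := each .name' setBit hasBit (push .name getBit)

/-- Names arrive last bit first, so `X` is kept with its last bit on top. Compared bits wait on
`.name'`; a mismatch, or running out of bits of `X`, clears `cmp` for the rest of the name. -/
def bitProg (O : Oracle S T) : MProg S T :=
  block [pop .name setBit,
    ite hasBit (push .name' getBit) (load id),
    load fun v => (v.1, { v.2 with
      ctl := v.2.ctl.readBit
      cmp := v.2.cmp && decide (v.2.bit = (getCell v).sym.bit)
      cur := O.cons ((getCell v).sym.bit.getD false) v.2.cur })]

def popR1 (k : ℕ) : MProg S T :=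
  ite (fun v => decide (k ≤ (getCell v).sym.pops)) (pop .vals setR1) (load id)

def popR2 (k : ℕ) : MProg S T :=
  ite (fun v => decide (k ≤ (getCell v).sym.pops)) (pop .vals setR2) (load id)

noncomputable def actOf (O : Oracle S T) (v : Reg S T) : Ctl S × Cell S × Option (Bool × Bool) :=
  act O v.1.purpose v.1.mode v.2.cmp v.2.cur v.2.r1 v.2.r2 v.2.ctl (getCell v)

/-- The name has ended: it equals `X` iff all comparisons succeeded and no bit of `X` is left, which
the `peek` tests before `X` is restored. -/
noncomputable def symProg (O : Oracle S T) : MProg S T :=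
  block [peek .name setBit,
    load fun v => (v.1, { v.2 with cmp := v.2.cmp && v.2.bit.isNone, r1 := none, r2 := none }),
    restore,
    popR1 1,
    popR2 2,
    load fun v => (v.1, { v.2 with
      ctl := (actOf O v).1
      cell := some (actOf O v).2.1
      r1 := (actOf O v).2.2
      cmp := true
      cur := O.nil }),
    ite hasR1 (push .vals fun v => v.2.r1.getD (false, false)) (load id)]

noncomputable def cellProg (O : Oracle S T) : MProg S T :=
  block [ite (fun v => (getCell v).sym.bit.isSome) (bitProg O) (symProg O), push .word' getCell]

/-- The local registers and the two stacks for the current task name `X` reflect the state `s`. -/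
structure Matches (O : Oracle S T) (X : Name) (l : Loc S T) (s : PassSt S) (x x' : List Bool) :
    Prop where
  ctl : l.ctl = s.ctl
  cur : l.cur = O.tr s.name
  cmp : l.cmp = decide (s.name.reverse = X.reverse.take s.name.length)
  name : x = X.reverse.drop s.name.length
  name' : x' = (X.reverse.take s.name.length).reverse

theorem wp_restore {B : ℕ} {Q} {v : Reg S T} {a b u u' c c'} {x x' : List Bool} {V}
    (hB : x'.length + x.length ≤ B)
    (h : Q (setBit v none) (stks a b u u' c c' (x'.reverse ++ x) [] V)) :
    Wp B restore Q v (stks a b u u' c c' x x' V) := by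
  refine wp_pour (by decide) id (fun _ _ => rfl) (fun _ _ _ => rfl) (fun _ _ => rfl) ?_ ?_
  · exact hB
  · simpa only [update_name', update_name, stks_name', stks_name, List.map_id] using h

/-- One comparison step: agreement so far together with agreement of the next bit. -/
theorem append_singleton_eq_take_succ {α : Type} (r l : List α) (b : α) :
    r ++ [b] = l.take (r.length + 1) ↔ r = l.take r.length ∧ l[r.length]? = some b := by
  rw [List.take_add_one]
  constructor
  · intro h
    cases hl : l[r.length]? with
    | none =>
      rw [hl] at h
      have := congrArg List.length h
      simp only [List.length_append, List.length_singleton, List.length_take, Option.toList_none,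
        List.length_nil] at this
      omega
    | some c =>
      rw [hl, Option.toList_some] at h
      have h1 := List.append_inj' h rfl
      exact ⟨h1.1, by rw [List.singleton_inj.1 h1.2]⟩
  · rintro ⟨h1, h2⟩
    rw [h2, Option.toList_some, ← h1]

theorem Matches.length_le {O : Oracle S T} {X : Name} {l : Loc S T} {s : PassSt S}
    {x x' : List Bool} (h : Matches O X l s x x') : x'.length + x.length = X.length := by
  rw [h.name, h.name', List.length_reverse, List.length_take, List.length_drop,
    List.length_reverse]
  omega

theorem Matches.restored {O : Oracle S T} {X : Name} {l : Loc S T} {s : PassSt S}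
    {x x' : List Bool} (h : Matches O X l s x x') : x'.reverse ++ x = X.reverse := by
  rw [h.name, h.name', List.reverse_reverse, List.take_append_drop]

theorem wp_popR1 {B : ℕ} {Q} {v : Reg S T} {a b u u' c c'} {x x' : List Bool} {V} {k : ℕ}
    (hv : v.2.r1 = none) :
    Wp B (popR1 k) Q v (stks a b u u' c c' x x' V) ↔
    Q (setR1 v (if k ≤ (getCell v).sym.pops then V.head? else none))
      (stks a b u u' c c' x x' (if k ≤ (getCell v).sym.pops then V.tail else V)) := by
  simp only [popR1, wp_ite, decide_eq_true_eq]
  split_ifs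
  · rw [wp_pop, update_vals, stks_vals]
  · rw [wp_load, ← hv]
    rfl

theorem wp_popR2 {B : ℕ} {Q} {v : Reg S T} {a b u u' c c'} {x x' : List Bool} {V} {k : ℕ}
    (hv : v.2.r2 = none) :
    Wp B (popR2 k) Q v (stks a b u u' c c' x x' V) ↔
    Q (setR2 v (if k ≤ (getCell v).sym.pops then V.head? else none))
      (stks a b u u' c c' x x' (if k ≤ (getCell v).sym.pops then V.tail else V)) := by
  simp only [popR2, wp_ite, decide_eq_true_eq]
  split_ifs
  · rw [wp_pop, update_vals, stks_vals]
  · rw [wp_load, ← hv]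
    rfl

/-- The program simulates `passStep`. Since `hvals` bounds the stack after the step, the only push
onto `.vals` is within the bound. -/
theorem wp_cellProg {O : Oracle S T} {B : ℕ} {Q} {X : Name} {g : Glob S T} {l : Loc S T}
    {s : PassSt S} {cell : Cell S} {x x' : List Bool} {a b u c c'} (hM : Matches O X l s x x')
    (hX : X.length ≤ B) (hout : s.out.length < B)
    (hvals : (passStep O g.purpose g.mode X cell s).vals.length ≤ B)
    (h : ∀ l' x x', Matches O X l' (passStep O g.purpose g.mode X cell s) x x' →
      Q (g, l') (stks a b u (passStep O g.purpose g.mode X cell s).out c c' x x'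
        (passStep O g.purpose g.mode X cell s).vals)) :
    Wp B (cellProg O) Q (setCell (g, l) (some cell)) (stks a b u s.out c c' x x' s.vals) := by
  have hlen := hM.length_le
  simp only [cellProg, wp_block_cons, wp_ite]
  have hget : getCell (setCell (g, l) (some cell)) = cell := rfl
  rw [hget]
  split_ifs with hb
  · obtain ⟨bit, hbit⟩ := Option.isSome_iff_exists.1 hb
    have hstep : passStep O g.purpose g.mode X cell s
        = ⟨s.ctl.readBit, bit :: s.name, s.vals, cell :: s.out⟩ := by
      simp [passStep, hbit]
    rw [hstep] at h
    simp only at h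
    have hM' : Matches O X { l with
          cell := some cell, bit := x.head?
          ctl := l.ctl.readBit
          cmp := l.cmp && decide (x.head? = some bit), cur := O.cons bit l.cur }
        ⟨s.ctl.readBit, bit :: s.name, s.vals, cell :: s.out⟩ x.tail
        (x.head?.toList ++ x') := by
      constructor
      · simp [hM.ctl]
      · simp [hM.cur, Oracle.tr]
      · simp only [hM.cmp, List.reverse_cons, List.length_cons]
        have := append_singleton_eq_take_succ s.name.reverse X.reverse bit
        rw [List.length_reverse] at this
        rw [decide_eq_decide.2 this, hM.name, List.head?_drop, Bool.decide_and]
      · simp [hM.name, List.tail_drop]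
      · simp only [hM.name, hM.name', List.length_cons, List.head?_drop]
        rw [List.take_add_one, List.reverse_append]
        cases X.reverse[s.name.length]? <;> rfl
    have := h _ _ _ hM'
    simp only [bitProg, wp_block_cons, wp_block_nil, wp_ite, wp_pop, wp_load, wp_push,
      stks_name, update_name, stks_word', update_word', stks_name', update_name']
    cases x with
    | nil =>
      simp only [List.head?_nil, setBit, setCell, hasBit, Option.isSome_none, Bool.false_eq_true,
        if_false, id_eq, getCell, Option.getD_some, List.tail_nil, hbit]
      exact ⟨hout, this⟩
    | cons y x =>
      simp only [List.head?_cons, setBit, setCell, hasBit, Option.isSome_some, if_true, getBit,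
        getCell, Option.getD_some, List.tail_cons, hbit]
      refine ⟨?_, hout, this⟩
      rw [List.length_cons] at hlen
      omega
  · rw [Bool.not_eq_true, Option.isSome_eq_false_iff, Option.isNone_iff_eq_none] at hb
    -- If nothing of `X` is left, taking as many bits of `X` as were read takes all of it, so the
    -- prefix comparison has become equality.
    have hcmp : (l.cmp && x.head?.isNone) = decide (s.name = X) := by
      rw [hM.cmp, Bool.eq_iff_iff]
      simp only [Bool.and_eq_true, decide_eq_true_eq, Option.isNone_iff_eq_none,
        List.head?_eq_none_iff]
      rw [hM.name, List.drop_eq_nil_iff]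
      constructor
      · rintro ⟨h1, h2⟩
        rw [List.take_of_length_le h2] at h1
        exact List.reverse_injective h1
      · rintro rfl
        simp
    simp only [passStep, hb] at h hvals
    simp only [symProg, wp_block_cons, wp_peek, wp_load, stks_name]
    refine wp_restore (by omega) ?_
    rw [hM.restored, wp_block_cons, wp_popR1 rfl, wp_block_cons, wp_popR2 rfl, wp_block_cons,
      wp_load]
    simp only [wp_block_cons, wp_block_nil, setBit, setCell, setR1, setR2, getCell, actOf, Option.getD_some, hcmp, hM.cur,
      hM.ctl, wp_ite, hasR1, wp_push, wp_load, id_eq, stks_vals, update_vals, stks_word',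
      update_word']
    generalize act O g.purpose g.mode (decide (s.name = X)) (O.tr s.name) _ _ s.ctl cell = A
      at h hvals ⊢
    have hM' : ∀ (bit : Option Bool) (r2 : Option (Bool × Bool)), Matches O X
        ⟨some A.2.1, bit, A.2.2, r2, A.1, true, O.nil⟩
        ⟨A.1, [], A.2.2.toList ++ (if 2 ≤ cell.sym.pops then
          (if 1 ≤ cell.sym.pops then s.vals.tail else s.vals).tail else
          if 1 ≤ cell.sym.pops then s.vals.tail else s.vals), A.2.1 :: s.out⟩ X.reverse [] := by
      intro bit r2
      constructor <;> simp [Oracle.tr]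
    have := h _ _ _ (hM' none (if 2 ≤ cell.sym.pops then
          (if 1 ≤ cell.sym.pops then s.vals.tail else s.vals).head? else none))
    cases hA : A.2.2 with
    | none =>
      rw [hA] at this
      rw [if_neg (by simp)]
      exact ⟨hout, this⟩
    | some r =>
      rw [hA] at this hvals
      rw [if_pos (by simp)]
      refine ⟨?_, hout, this⟩
      simp only [Option.toList_some, List.singleton_append, List.length_cons] at hvals
      exact hvals

end PurposeAware

/-! ### The machine: one letter, one tape, the next tape -/

namespace PurposeAware

open StackProg Function

variable {S T : Type}

/-! ### Reading a letter -/

/-- The word lies with its last cell on top, so popping reads it from right to left; pouring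
`.word'` back restores this orientation. The evaluation stack is emptied explicitly because an
ill-formed word may leave values behind. -/
noncomputable def passProg (O : Oracle S T) : MProg S T :=
  block [load fun v => (v.1, { v.2 with ctl := Ctl.init, cmp := true, cur := O.nil }),
    each .word setCell hasCell (cellProg O),
    peek .vals setR1,
    load fun v => ({ v.1 with
      acc := v.1.acc || PassSt.accepts v.1.mode ⟨v.2.ctl, [], v.2.r1.toList, []⟩
      purpose := some v.2.cur }, v.2),
    restore,
    each .vals setR1 hasR1 (load id),
    each .word' setCell hasCell (push .word getCell)]

theorem wp_passProg {O : Oracle S T} {B : ℕ} {Q} {X : Name} {g : Glob S T} {l : Loc S T}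
    {u : List (Cell S)} {a b c c'} (hX : X.length ≤ B) (hu : u.length ≤ B)
    (h : ∀ l', Q ({ g with
        acc := g.acc || accLetter O (u, g.purpose) (X, g.mode)
        purpose := (readLetter O (u, g.purpose) (X, g.mode)).2 }, l')
      (stks a b (readLetter O (u, g.purpose) (X, g.mode)).1.reverse [] c c' X.reverse [] [])) :
    Wp B (passProg O) Q (g, l) (stks a b u.reverse [] c c' X.reverse [] []) := by
  simp only [passProg, wp_block_cons, wp_load]
  refine wp_each (fun r v' S' => ∃ d l' x x', u = r.reverse ++ d ∧ v' = (g, l') ∧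
    S' = stks a b r (pass O g.purpose g.mode X d).out c c' x x' (pass O g.purpose g.mode X d).vals ∧
    Matches O X l' (pass O g.purpose g.mode X d) x x') u.reverse ?_ (fun _ _ => rfl) ?_ ?_ ?_
  · rintro r v' S' ⟨d, l', x, x', -, -, rfl, -⟩
    rfl
  · rintro cell r v' S' ⟨d, l', x, x', rfl, rfl, rfl, hM⟩
    rw [List.length_append, List.length_reverse, List.length_cons] at hu
    rw [update_word]
    refine wp_cellProg hM hX ?_ ?_ fun l'' y y' hM' => ?_
    · rw [length_pass_out]
      omega
    · have := length_pass_vals O g.purpose g.mode X (cell :: d)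
      rw [List.length_cons] at this
      exact this.trans (by omega)
    · exact ⟨cell :: d, l'', y, y', by simp, rfl, rfl, hM'⟩
  · rintro v' S' ⟨d, l', x, x', hd, rfl, rfl, hM⟩
    rw [List.reverse_nil, List.nil_append] at hd
    subst hd
    rw [wp_block_cons, wp_peek, wp_block_cons, wp_load, wp_block_cons]
    refine wp_restore (hM.length_le.trans_le hX) ?_
    rw [hM.restored, wp_block_cons]
    refine wp_clear (fun _ _ => rfl) (fun _ _ _ => rfl) ?_
    rw [update_vals, wp_block_cons]
    refine wp_pour (by decide) id (fun _ _ => rfl) (fun _ _ _ => rfl) (fun _ _ => rfl) ?_ ?_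
    · simp only [stks_word', stks_word, length_pass_out]
      simpa using hu
    · rw [wp_block_nil, update_word', update_word, stks_word', stks_word, List.append_nil,
        List.map_id]
      -- Acceptance only asks whether the evaluation stack is empty, so its top entry suffices.
      have hacc : PassSt.accepts g.mode ⟨l'.ctl, [],
          (pass O g.purpose g.mode X u).vals.head?.toList, []⟩
          = accLetter O (u, g.purpose) (X, g.mode) := by
        rw [hM.ctl]
        simp only [accLetter, PassSt.accepts]
        cases (pass O g.purpose g.mode X u).vals <;> rfl
      rw [← hacc, readLetter, ← hM.cur] at h
      exact h _
  · refine ⟨[], _, X.reverse, [], by simp, rfl, rfl, ?_⟩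
    constructor <;> simp [pass, PassSt.init, Oracle.tr]

/-! ### Reading a tape -/

def getMode (v : Reg S T) : Mode S := Sum.elim (fun _ => .idle) id (getTape v)

def getTapeBit (v : Reg S T) : Bool := Sum.elim id (fun _ => false) (getTape v)

noncomputable def runProg (O : Oracle S T) : MProg S T :=
  block [each .tape setTape hasTape
      (block [push .tape' getTape,
        ite (fun v => (getTape v).isLeft) (push .name getTapeBit)
          (block [load fun v => ({ v.1 with mode := getMode v }, v.2),
            passProg O,
            each .name setBit hasBit (load id)])]),
    -- The tape may end in the middle of a letter, leaving bits of a name to be removed.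
    each .name setBit hasBit (load id)]

theorem wp_runProg {O : Oracle S T} {B : ℕ} {Q} {g : Glob S T} {l : Loc S T}
    {u : List (Cell S)} {a b} {t : List (TapeSym S)} (ht : t.length ≤ B) (hu : u.length ≤ B)
    (h : ∀ g' l' u', u'.map Cell.sym = (u.map Cell.sym).reverse → g'.acc = (g.acc || runTape O t [] (u, g.purpose)) →
      g'.carry = g.carry →
      Q (g', l') (stks a b u' [] [] t.reverse [] [] [])) :
    Wp B (runProg O) Q (g, l) (stks a b u.reverse [] t [] [] [] []) := by
  simp only [runProg, wp_block_cons]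
  -- Invariant: what has been accepted so far or will be accepted on the rest `r` of the tape is the
  -- verdict on the whole tape.
  refine wp_each (fun r v' S' => ∃ d g' l' X u₁, t = d ++ r ∧ v' = (g', l') ∧
    g'.carry = g.carry ∧ X.length ≤ d.length ∧ u₁.map Cell.sym = u.map Cell.sym ∧
    (g'.acc || runTape O r X (u₁, g'.purpose)) = (g.acc || runTape O t [] (u, g.purpose)) ∧
    S' = stks a b u₁.reverse [] r d.reverse X.reverse [] []) t ?_ (fun _ _ => rfl) ?_ ?_ ?_
  · rintro r v' S' ⟨d, g', l', X, u₁, -, -, -, -, -, -, rfl⟩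
    rfl
  · rintro y r v' S' ⟨d, g', l', X, u₁, rfl, rfl, hcarry, hX, hu₁, hrun, rfl⟩
    rw [List.length_append, List.length_cons] at ht
    simp only [wp_block_cons, wp_push, wp_ite, update_tape, stks_tape', update_tape']
    refine ⟨by rw [List.length_reverse]; omega, ?_⟩
    have hget : getTape (setTape (g', l') (some y)) = y := rfl
    rw [hget]
    cases y with
    | inl bit =>
      rw [if_pos (show (Sum.inl bit : TapeSym S).isLeft = true from rfl), wp_block_nil]
      refine ⟨by rw [stks_name, List.length_reverse]; omega, d ++ [Sum.inl bit],
        { g' with tape := some (Sum.inl bit) }, l', X ++ [bit], u₁, by simp, rfl, hcarry,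
        by simpa using hX, hu₁, ?_, ?_⟩
      · rw [← hrun]
        rfl
      · simp only [stks_name, update_name, List.reverse_append, List.reverse_cons,
          List.reverse_nil, List.nil_append, List.singleton_append]
        rfl
    | inr m =>
      rw [if_neg (by simp), wp_load, wp_block_cons]
      have hlen : u₁.length = u.length := by simpa using congrArg List.length hu₁
      refine wp_passProg (hX.trans (by omega)) (hlen.trans_le hu) fun l'' => ?_
      rw [wp_block_cons]
      refine wp_clear (fun _ _ => rfl) (fun _ _ _ => rfl) ?_
      rw [wp_block_nil, wp_block_nil, update_name]
      refine ⟨d ++ [Sum.inr m], _, _, [], (readLetter O (u₁, g'.purpose) (X, m)).1, by simp,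
        rfl, hcarry, by simp, ?_, ?_, ?_⟩
      · exact (pass_out_sym _ _ _ _ _).trans hu₁
      · rw [← hrun, runTape, ← Bool.or_assoc]
        rfl
      · simp only [List.reverse_append, List.reverse_cons, List.reverse_nil, List.nil_append,
          List.singleton_append]
        rfl
  · rintro v' S' ⟨d, g', l', X, u₁, hd, rfl, hcarry, hX, hu₁, hrun, rfl⟩
    rw [List.append_nil] at hd
    subst hd
    rw [wp_block_cons]
    refine wp_clear (fun _ _ => rfl) (fun _ _ _ => rfl) ?_
    rw [wp_block_nil, update_name]
    refine h _ _ _ ?_ ?_ hcarry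
    · rw [List.map_reverse, hu₁]
    · rw [← hrun, runTape, Bool.or_false]
      rfl
  · exact ⟨[], g, l, [], u, rfl, rfl, rfl, le_rfl, rfl, rfl, rfl⟩

/-! ### The next tape -/

/-- After a run the tape lies reversed on `.tape'`. Its last symbol, then on top, serves as the
least significant digit, and moving the digits back restores the order. -/
def incProg {m : ℕ} (e : TapeSym S ≃ Fin (m + 1)) : MProg S T :=
  each .tape' setTape hasTape
    (block [push .tape fun v => if v.1.carry then nextDigit e (getTape v) else getTape v,
      load fun v => ({ v.1 with carry := v.1.carry && isLastDigit e (getTape v) }, v.2)])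

theorem wp_incProg {B m : ℕ} (e : TapeSym S ≃ Fin (m + 1)) {Q} {g : Glob S T} {l : Loc S T}
    {t : List (TapeSym S)} {a b u u' x x' V} (ht : t.length ≤ B)
    (h : Q ({ g with tape := none, carry := (increment e g.carry t).2 }, l)
      (stks a b u u' (increment e g.carry t).1.reverse [] x x' V)) :
    Wp B (incProg e) Q (g, l) (stks a b u u' [] t x x' V) := by
  refine wp_each (fun r v' S' => ∃ d o k, v' = ({ g with tape := o, carry := k }, l) ∧
    d.length + r.length = t.length ∧
    d.reverse ++ (increment e k r).1 = (increment e g.carry t).1 ∧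
    (increment e k r).2 = (increment e g.carry t).2 ∧
    S' = stks a b u u' d r x x' V) t ?_ (fun _ _ => rfl) ?_ ?_ ?_
  · rintro r v' S' ⟨d, o, k, -, -, -, -, rfl⟩
    rfl
  · rintro y r v' S' ⟨d, o, k, rfl, hlen, h1, h2, rfl⟩
    rw [List.length_cons] at hlen
    simp only [wp_block_cons, wp_block_nil, wp_push, wp_load, update_tape', stks_tape,
      update_tape]
    refine ⟨by omega, _, some y, k && isLastDigit e y, rfl, ?_, ?_, ?_, rfl⟩
    · rw [List.length_cons]
      omega
    · rw [← h1, increment, List.reverse_cons, List.append_assoc]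
      rfl
    · rw [← h2, increment]
  · rintro v' S' ⟨d, o, k, rfl, hlen, h1, h2, rfl⟩
    simp only [increment, List.append_nil] at h1 h2
    rw [← h1, ← h2, List.reverse_reverse] at h
    exact h
  · exact ⟨[], g.tape, g.carry, rfl, by simp, rfl, rfl, rfl⟩

end PurposeAware

/-! ### The machine: exhaustive search -/

namespace PurposeAware

open StackProg Function

variable {S T : Type}

/-! ### Trying all tapes of a given length -/

/-- A run leaves annotations behind; the next tape has to start from the bare word and an unknown
purpose. The carry is set for the increment to come. -/
def resetProg : MProg S T :=
  block [each .word setCell hasCell (push .word' fun v => .plain (getCell v).sym),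
    each .word' setCell hasCell (push .word getCell),
    load fun v => ({ v.1 with purpose := none, carry := true }, v.2)]

theorem wp_resetProg {B : ℕ} {Q} {g : Glob S T} {l : Loc S T} {u : List (Cell S)} {w : List Sym}
    {a b t t' x x' V} (hw : u.map Cell.sym = w.reverse) (hB : w.length ≤ B)
    (h : ∀ l', Q ({ g with purpose := none, carry := true }, l')
      (stks a b (w.map Cell.plain).reverse [] t t' x x' V)) :
    Wp B resetProg Q (g, l) (stks a b u [] t t' x x' V) := by
  have hlen : u.length = w.length := by simpa using congrArg List.length hw
  rw [resetProg, wp_block_cons]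
  refine wp_pour (by decide) (fun y => Cell.plain y.sym) (fun _ _ => rfl) (fun _ _ _ => rfl)
    (fun _ _ => rfl) ?_ ?_
  · simp [stks_word, stks_word', hlen, hB]
  rw [update_word, update_word', wp_block_cons]
  refine wp_pour (by decide) id (fun _ _ => rfl) (fun _ _ _ => rfl) (fun _ _ => rfl) ?_ ?_
  · simp [stks_word, stks_word', hlen, hB]
  rw [update_word', update_word, wp_block_cons, wp_load, wp_block_nil]
  have : List.map id (stks a b [] ((stks a b u [] t t' x x' V .word).reverse.map
      (fun y => Cell.plain y.sym) ++ stks a b u [] t t' x x' V .word') t t' x x' V .word').reverse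
      ++ stks a b [] ((stks a b u [] t t' x x' V .word).reverse.map
      (fun y => Cell.plain y.sym) ++ stks a b u [] t t' x x' V .word') t t' x x' V .word
      = (w.map Cell.plain).reverse := by
    rw [stks_word, stks_word, stks_word', stks_word', List.append_nil, List.append_nil,
      List.map_id, ← List.map_reverse, List.reverse_reverse, ← List.map_reverse, ← hw,
      List.map_map]
    rfl
  rw [this]
  exact h _

noncomputable def searchProg (O : Oracle S T) {m : ℕ} (e : TapeSym S ≃ Fin (m + 1)) :
    MProg S T :=
  loop (fun v => !v.1.fin) (block [resetProg, runProg O, incProg e,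
    load fun v => ({ v.1 with fin := v.1.acc || v.1.carry }, v.2)])

/-- Some tape of length `n` leads to acceptance of the word `w`. -/
def AcceptedWithin (O : Oracle S T) (w : List Sym) (n : ℕ) : Prop :=
  ∃ c : List (TapeSym S), c.length = n ∧ runTape O c [] (w.map Cell.plain, none) = true

open Classical in
theorem wp_searchProg {O : Oracle S T} {B m n : ℕ} (e : TapeSym S ≃ Fin (m + 1)) {Q}
    {g : Glob S T} {l : Loc S T} {u : List (Cell S)} {w : List Sym} {t : List (TapeSym S)} {a b}
    (hw : u.map Cell.sym = w.reverse) (hwB : w.length ≤ B) (ht : t.length = n) (hn : n ≤ B)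
    (hfin : g.fin = false) (hacc : g.acc = false) (ht0 : digitsVal e t.reverse = 0)
    (h : ∀ g' l' u' t', g'.acc = decide (AcceptedWithin O w n) →
      Q (g', l') (stks a b u' [] t' [] [] [] [])) :
    Wp B (searchProg O e) Q (g, l) (stks a b u [] t [] [] [] []) := by
  -- While the search goes on, all tapes below the current one have been rejected, and the variant
  -- `k` counts the tapes not yet rejected, the current one included.
  refine wp_loop (fun k v σ => ∃ g l u t, v = (g, l) ∧ σ = stks a b u [] t [] [] [] [] ∧
    u.map Cell.sym = w.reverse ∧ t.length = n ∧
    (g.fin = true → g.acc = decide (AcceptedWithin O w n)) ∧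
    (g.fin = false → g.acc = false ∧ k + digitsVal e t.reverse = (m + 1) ^ n ∧
      ∀ c : List (TapeSym S), c.length = n → digitsVal e c.reverse < digitsVal e t.reverse →
        runTape O c [] (w.map Cell.plain, none) = false)) ?_ ?_ ((m + 1) ^ n) ?_
  · rintro k v σ ⟨g, l, u, t, rfl, rfl, hu, ht, -, hk⟩ hc
    obtain ⟨hacc, hk, hbelow⟩ := hk (by simpa using hc)
    rw [wp_block_cons]
    refine wp_resetProg hu hwB fun l' => ?_
    rw [wp_block_cons]
    refine wp_runProg (ht.trans_le hn) (by simpa using hwB) fun g' l'' u' hu' hacc' hcarry => ?_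
    rw [wp_block_cons]
    refine wp_incProg e (by simpa [ht] using hn) ?_
    rw [wp_block_cons, wp_load, wp_block_nil]
    rw [hacc, Bool.false_or] at hacc'
    have hval := digitsVal_increment e g'.carry t.reverse
    have hlen := length_increment e g'.carry t.reverse
    rw [hcarry] at hval hlen ⊢
    simp only [List.length_reverse, ht, Bool.toNat_true] at hval hlen
    have hlt := digitsVal_lt e t.reverse
    rw [List.length_reverse, ht] at hlt
    have hsame : ∀ c : List (TapeSym S), c.length = n →
        digitsVal e c.reverse = digitsVal e t.reverse → c = t := fun c hc h =>
      List.reverse_injective (digitsVal_injective e (by simp [hc, ht]) h)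
    refine ⟨if (g'.acc || (increment e true t.reverse).2) = true then 0 else k - 1, ?_, _, _, _, _,
      rfl, rfl, ?_, ?_, fun hf => ?_, fun hf => ?_⟩
    · split_ifs <;> omega
    · rw [hu', List.map_map]
      exact congrArg List.reverse (List.map_id w)
    · rw [List.length_reverse, hlen]
    · simp only [Bool.or_eq_true] at hf
      rw [hacc', eq_comm]
      by_cases hr : runTape O t [] (w.map Cell.plain, none) = true
      · rw [hr]
        exact decide_eq_true ⟨t, ht, hr⟩
      · rw [hacc'] at hf
        -- Overflow without acceptance: `t` was the greatest tape, so every tape has been rejected.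
        have hcar := hf.resolve_left hr
        rw [hcar, Bool.toNat_true] at hval
        rw [Bool.not_eq_true] at hr
        rw [hr]
        refine decide_eq_false ?_
        rintro ⟨c, hc, hrc⟩
        have hclt := digitsVal_lt e c.reverse
        rw [List.length_reverse, hc] at hclt
        rcases lt_or_ge (digitsVal e c.reverse) (digitsVal e t.reverse) with h1 | h1
        · rw [hbelow c hc h1] at hrc
          exact Bool.noConfusion hrc
        · rw [hsame c hc (by omega), hr] at hrc
          exact Bool.noConfusion hrc
    · simp only [Bool.or_eq_false_iff] at hf
      rw [hf.2, Bool.toNat_false] at hval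
      simp only [hf.1, hf.2, List.reverse_reverse]
      refine ⟨trivial, ?_, fun c hc h1 => ?_⟩
      · simp only [Bool.or_self, Bool.false_eq_true, if_false]
        omega
      · rcases lt_or_ge (digitsVal e c.reverse) (digitsVal e t.reverse) with h2 | h2
        · exact hbelow c hc h2
        · rw [hsame c hc (by omega), ← hacc', hf.1]
  · rintro k v σ ⟨g, l, u, t, rfl, rfl, hu, ht, hk, -⟩ hc
    exact h _ _ _ _ (hk (by simpa using hc))
  · refine ⟨g, l, u, t, rfl, rfl, hw, ht, by simp [hfin], fun _ => ⟨hacc, by rw [ht0, add_zero],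
      fun c _ h => ?_⟩⟩
    rw [ht0] at h
    exact absurd h (Nat.not_lt_zero _)

/-! ### Preparing the tape -/

theorem wp_rep_push_tape {B n : ℕ} {Q} {v : Reg S T} {f : TapeSym S} {a b u u' t t' x x' V}
    (hB : t.length + n ≤ B)
    (h : Q v (stks a b u u' (List.replicate n f ++ t) t' x x' V)) :
    Wp B (rep n (push .tape fun _ => f)) Q v (stks a b u u' t t' x x' V) := by
  refine wp_rep (fun k v' S' => v' = v ∧ ∃ j, j + k = n ∧
    S' = stks a b u u' (List.replicate j f ++ t) t' x x' V) n ?_ ?_ ?_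
  · rintro k v' S' ⟨rfl, j, hj, rfl⟩
    rw [wp_push, update_tape, stks_tape]
    refine ⟨?_, rfl, j + 1, by omega, rfl⟩
    rw [List.length_append, List.length_replicate]
    omega
  · rintro v' S' ⟨rfl, j, rfl, rfl⟩
    exact h
  · exact ⟨rfl, 0, by simp, rfl⟩

/-- Multiplies the length of the tape by `q`. -/
def scaleProg (q : ℕ) (f : TapeSym S) : MProg S T :=
  block [each .tape setTape hasTape (push .tape' getTape),
    each .tape' setTape hasTape (rep q (push .tape fun _ => f))]

theorem wp_scaleProg {B q n : ℕ} {Q} {g : Glob S T} {l : Loc S T} {f : TapeSym S}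
    {a b u u' x x' V} (hn : n ≤ B) (hB : n * q ≤ B)
    (h : Q ({ g with tape := none }, l)
      (stks a b u u' (List.replicate (n * q) f) [] x x' V)) :
    Wp B (scaleProg q f) Q (g, l) (stks a b u u' (List.replicate n f) [] x x' V) := by
  rw [scaleProg, wp_block_cons]
  refine wp_pour (by decide) id (fun _ _ => rfl) (fun _ _ _ => rfl) (fun _ _ => rfl) ?_ ?_
  · simpa [stks_tape, stks_tape'] using hn
  rw [update_tape, update_tape', stks_tape, stks_tape', List.append_nil, List.map_id,
    List.reverse_replicate, wp_block_cons]
  refine wp_each (fun r v' S' => ∃ j k o, j + k = n ∧ r = List.replicate k f ∧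
    v' = ({ g with tape := o }, l) ∧
    S' = stks a b u u' (List.replicate (j * q) f) r x x' V) (List.replicate n f) ?_
    (fun _ _ => rfl) ?_ ?_ ?_
  · rintro r v' S' ⟨j, k, o, -, -, -, rfl⟩
    rfl
  · rintro y r v' S' ⟨j, k, o, rfl, hr, rfl, rfl⟩
    obtain _ | k := k
    · simp at hr
    obtain ⟨rfl, rfl⟩ := List.cons.inj hr
    rw [update_tape']
    refine wp_rep_push_tape ?_ ⟨j + 1, k, some y, by omega, rfl, rfl, ?_⟩
    · rw [List.length_replicate]
      refine le_trans ?_ hB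
      rw [← Nat.succ_mul]
      exact Nat.mul_le_mul_right _ (by omega)
    · rw [← List.replicate_add, add_comm q, Nat.succ_mul]
  · rintro v' S' ⟨j, k, o, rfl, hr, rfl, rfl⟩
    obtain _ | k := k
    · rw [wp_block_nil]
      exact h
    · simp [List.replicate_succ] at hr
  · exact ⟨0, n, none, by simp, rfl, rfl, by simp⟩

/-- The tape gets length `r` at first and is multiplied by `q` for each input symbol, which yields
`r * q ^ n` without any arithmetic on numbers. The input is turned into plain cells on the way. -/
def setupProg (r q : ℕ) (f : TapeSym S) : MProg S T :=
  block [rep r (push .tape fun _ => f),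
    each .inp setSym hasSym
      (block [push .word fun v => .plain (v.1.sym.getD .tt), scaleProg q f])]

theorem wp_setupProg {B r q : ℕ} {Q} {g : Glob S T} {l : Loc S T} {f : TapeSym S} {w : List Sym}
    (hq : 1 ≤ q) (hw : w.length ≤ B) (hB : r * q ^ w.length ≤ B)
    (h : ∀ g', g'.fin = g.fin → g'.acc = g.acc → Q (g', l)
      (stks [] [] (w.map Cell.plain).reverse [] (List.replicate (r * q ^ w.length) f)
        [] [] [] [])) :
    Wp B (setupProg r q f) Q (g, l) (stks w [] [] [] [] [] [] [] []) := by
  have hmono : ∀ k ≤ w.length, r * q ^ k ≤ B := fun k hk =>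
    (Nat.mul_le_mul_left _ (Nat.pow_le_pow_right hq hk)).trans hB
  rw [setupProg, wp_block_cons]
  refine wp_rep_push_tape (by simpa using hmono 0 (Nat.zero_le _)) ?_
  rw [wp_block_cons]
  refine wp_each (fun s v' S' => ∃ d g', w = d ++ s ∧ v' = (g', l) ∧ g'.fin = g.fin ∧
    g'.acc = g.acc ∧ S' = stks s [] (d.map Cell.plain).reverse []
      (List.replicate (r * q ^ d.length) f) [] [] [] []) w ?_ (fun _ _ => rfl) ?_ ?_ ?_
  · rintro s v' S' ⟨d, g', -, -, -, -, rfl⟩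
    rfl
  · rintro y s v' S' ⟨d, g', rfl, rfl, hf, ha, rfl⟩
    rw [List.length_append, List.length_cons] at hmono hw
    rw [update_inp, wp_block_cons, wp_push, update_word, stks_word, wp_block_cons]
    refine ⟨?_, ?_⟩
    · rw [List.length_reverse, List.length_map]
      omega
    · refine wp_scaleProg (hmono _ (by omega)) ?_ ?_
      · rw [mul_assoc, ← pow_succ]
        exact hmono _ (by omega)
      · rw [wp_block_nil]
        refine ⟨d ++ [y], _, by simp, rfl, hf, ha, ?_⟩
        rw [List.length_append, List.length_singleton, pow_succ, mul_assoc, List.map_append,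
          List.reverse_append]
        rfl
  · rintro v' S' ⟨d, g', hd, rfl, hf, ha, rfl⟩
    rw [List.append_nil] at hd
    subst hd
    rw [wp_block_nil]
    exact h _ hf ha
  · exact ⟨[], g, rfl, rfl, rfl, rfl, by simp⟩

/-! ### The machine -/

noncomputable def decideProg (O : Oracle S T) (r q : ℕ) {m : ℕ} (e : TapeSym S ≃ Fin (m + 1)) :
    MProg S T :=
  block [setupProg r q (e.symm 0),
    searchProg O e,
    -- A halting configuration may contain nothing but the answer.
    each .word setCell hasCell (load id),
    each .tape setTape hasTape (load id),
    push .out fun v => v.1.acc]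

theorem digitsVal_replicate_zero {A : Type} {m : ℕ} (e : A ≃ Fin (m + 1)) (n : ℕ) :
    digitsVal e (List.replicate n (e.symm 0)) = 0 := by
  induction n with
  | zero => rfl
  | succ n ih => simp [List.replicate_succ, digitsVal_cons, ih]

open Classical in
theorem wp_decideProg {O : Oracle S T} {B r q m : ℕ} (e : TapeSym S ≃ Fin (m + 1)) {Q}
    {g : Glob S T} {l : Loc S T} {w : List Sym} (hq : 1 ≤ q) (hw : w.length ≤ B) (h0 : 0 < B)
    (hB : r * q ^ w.length ≤ B) (hfin : g.fin = false) (hacc : g.acc = false)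
    (h : ∀ v, Q v (stks [] [decide (AcceptedWithin O w (r * q ^ w.length))] [] [] [] [] [] [] [])) :
    Wp B (decideProg O r q e) Q (g, l) (stks w [] [] [] [] [] [] [] []) := by
  rw [decideProg, wp_block_cons]
  refine wp_setupProg hq hw hB fun g' hf ha => ?_
  rw [wp_block_cons]
  refine wp_searchProg e (w := w) ?_ hw (List.length_replicate ..) hB (hf.trans hfin)
    (ha.trans hacc) ?_ fun g'' l'' u'' t'' hr => ?_
  · rw [List.map_reverse, List.map_map]
    exact congrArg List.reverse (List.map_id w)
  · rw [List.reverse_replicate, digitsVal_replicate_zero]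
  rw [wp_block_cons]
  refine wp_clear (fun _ _ => rfl) (fun _ _ _ => rfl) ?_
  rw [update_word, wp_block_cons]
  refine wp_clear (fun _ _ => rfl) (fun _ _ _ => rfl) ?_
  rw [update_tape, wp_block_cons, wp_push, update_out, stks_out, wp_block_nil]
  refine ⟨h0, ?_⟩
  rw [← hr] at h
  exact h _

theorem card_mul_tapeLength_le (k n : ℕ) :
    k * (tapeLength S T n + n + 1) ≤
      2 ^ (Polynomial.C (k + Nat.card (Option T) + 1) +
        Polynomial.C (2 * Nat.card (Cell S) + 1) * Polynomial.X).eval n := by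
  simp only [Polynomial.eval_add, Polynomial.eval_C, Polynomial.eval_mul, Polynomial.eval_X]
  have h1 := Nat.lt_two_pow_self (n := Nat.card (Option T))
  have h2 : (2 * Nat.card (Cell S)) ^ n ≤ 2 ^ (2 * Nat.card (Cell S) * n) := by
    rw [pow_mul]
    exact Nat.pow_le_pow_left Nat.lt_two_pow_self.le n
  have h3 := Nat.mul_le_mul h1.le h2
  rw [← tapeLength, ← pow_add] at h3
  generalize Nat.card (Option T) = c at h3 ⊢
  generalize 2 * Nat.card (Cell S) = d at h3 ⊢
  have h4 : n + 1 ≤ 2 ^ n := Nat.lt_two_pow_self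
  have h5 : tapeLength S T n + n + 1 ≤ 2 ^ (c + d * n + n + 1) := by
    have h6 : 2 ^ (c + d * n) ≤ 2 ^ (c + d * n + n) := Nat.pow_le_pow_right (by decide) (by omega)
    have h7 : 2 ^ n ≤ 2 ^ (c + d * n + n) := Nat.pow_le_pow_right (by decide) (by omega)
    rw [pow_succ]
    omega
  refine (Nat.mul_le_mul Nat.lt_two_pow_self.le h5).trans_eq ?_
  rw [← pow_add]
  congr 1
  ring

theorem inEXPSPACE_of_acceptedWithin [Finite S] [Finite T] (O : Oracle S T) (L : Language Sym)
    (hL : ∀ w, w ∈ L ↔ AcceptedWithin O w (tapeLength S T w.length)) : InEXPSPACE L := by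
  classical
  obtain ⟨m, ⟨e⟩⟩ := Finite.exists_equiv_fin (TapeSym S)
  obtain _ | m := m
  · exact (e (Sum.inl false)).elim0
  have hq : 1 ≤ 2 * Nat.card (Cell S) := by
    have : Nonempty (Cell S) := ⟨.plain .tt⟩
    have := Nat.card_pos (α := Cell S)
    omega
  refine StackProg.inEXPSPACE (decideProg O (Nat.card (Option T)) (2 * Nat.card (Cell S)) e)
    (k₀ := .inp) (k₁ := .out)
    (⟨none, none, none, .idle, false, false, false⟩,
      ⟨none, none, none, none, Ctl.init, false, O.nil⟩)
    -- The bound leaves room for the tape, the word, and one symbol of output.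
    (Equiv.refl Sym) (Equiv.refl Bool) L (fun n => tapeLength S T n + n + 1)
    (fun n => by omega) _ (card_mul_tapeLength_le _) fun w => ?_
  have h1 : update (fun k => ([] : List (StkSym S k))) .inp (w.map (Equiv.refl Sym).symm)
      = stks w [] [] [] [] [] [] [] [] := by
    rw [show w.map (Equiv.refl Sym).symm = w from List.map_id w]
    funext k
    cases k <;> rfl
  rw [h1]
  refine wp_decideProg e hq (by omega) (by omega) (by rw [← tapeLength]; omega) rfl rfl fun v => ?_
  rw [← tapeLength]
  funext k
  cases k <;> simp [stks, hL]

theorem completionProblem_inEXPSPACE (I : StaticDB) : InEXPSPACE (completionProblem I) :=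
  inEXPSPACE_of_acceptedWithin I.oracle _ (mem_completionProblem_iff I)

end PurposeAware

/-! ### Completion and satisfiability -/

namespace PurposeAware

open Function

/-! ### The formulas hold exactly in the traces of successful runs -/

section Semantics

variable {D : Srt → Set Name} {n : ℕ} {T : Fin n → Instance}

theorem Term.eval_subst (x : Var) (c : Name) (v : Var → Name) (a : Term) :
    (a.subst x c).eval v = a.eval (update v x c) := by
  cases a with
  | const d => rfl
  | var y =>
    rw [Term.subst]
    split_ifs with h
    · subst h
      simp [Term.eval]
    · simp [Term.eval, update_of_ne h]

theorem Fml.sat_subst (x : Var) (c : Name) (φ : Fml) (v : Var → Name) (i : Fin n) :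
    (φ.subst x c).Sat D T v i ↔ φ.Sat D T (update v x c) i := by
  induction φ generalizing v i with
  | tt => rfl
  | rel r args => simp [Fml.subst, Fml.Sat, Term.eval_subst]
  | eq a b => simp [Fml.subst, Fml.Sat, Term.eval_subst]
  | neg φ ih => simp [Fml.subst, Fml.Sat, ih]
  | and φ ψ ih ih' => simp [Fml.subst, Fml.Sat, ih, ih']
  | next φ ih => simp [Fml.subst, Fml.Sat, ih]
  | untl φ ψ ih ih' => simp [Fml.subst, Fml.Sat, ih, ih']
  | ex s y φ ih =>
    simp only [Fml.subst, Fml.Sat]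
    refine exists_congr fun d => and_congr_right fun _ => ?_
    split_ifs with h
    · rw [h, update_idem]
    · rw [ih, update_comm h]

theorem Fml.sat_bigAnd (l : List Fml) (v : Var → Name) (i : Fin n) :
    (Fml.bigAnd l).Sat D T v i ↔ ∀ φ ∈ l, φ.Sat D T v i := by
  induction l with
  | nil => simp [Fml.bigAnd, Fml.Sat]
  | cons φ l ih =>
    rw [List.forall_mem_cons, ← ih]
    rfl

theorem Fml.sat_always (φ : Fml) (v : Var → Name) (i : Fin n) :
    (Fml.always φ).Sat D T v i ↔ ∀ j, i ≤ j → φ.Sat D T v j := by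
  simp only [Fml.always, Fml.eventually, Fml.Sat]
  constructor
  · intro h j hij
    by_contra hj
    exact h ⟨j, hij, hj, fun _ _ _ => trivial⟩
  · rintro h ⟨j, hij, hj, -⟩
    exact hj (h j hij)

theorem Fml.sat_all (s : Srt) (x : Var) (φ : Fml) (v : Var → Name) (i : Fin n) :
    (Fml.all s x φ).Sat D T v i ↔ ∀ d ∈ D s, φ.Sat D T (update v x d) i := by
  simp [Fml.all, Fml.Sat]

theorem Fml.sat_imp (φ ψ : Fml) (v : Var → Name) (i : Fin n) :
    (Fml.imp φ ψ).Sat D T v i ↔ (φ.Sat D T v i → ψ.Sat D T v i) := by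
  simp [Fml.imp, Fml.Sat]

/-- The valuation in which the subjects in charge of the tasks in `l` are given by `charge`. -/
def putInCharge (l : List Name) (charge : Name → Name) (v : Var → Name) : Var → Name
  | .subOf t => if t ∈ l then charge t else v (.subOf t)
  | x => v x

theorem putInCharge_cons (t : Name) (l : List Name) (charge : Name → Name) (v : Var → Name) :
    putInCharge (t :: l) charge v = putInCharge l charge (update v (.subOf t) (charge t)) := by
  funext x
  cases x with
  | subOf s =>
    simp only [putInCharge, List.mem_cons]
    by_cases hs : s ∈ l
    · simp [hs]
    · by_cases hst : s = t
      · subst hst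
        simp [hs]
      · rw [update_of_ne (by simpa using hst)]
        simp [hs, hst]
  | _ => rfl

theorem putInCharge_congr {l : List Name} {charge charge' : Name → Name}
    (h : ∀ t ∈ l, charge t = charge' t) (v : Var → Name) :
    putInCharge l charge v = putInCharge l charge' v := by
  funext x
  cases x with
  | subOf s =>
    simp only [putInCharge]
    split_ifs with hs
    · exact h s hs
    · rfl
  | _ => rfl

/-- The quantifier prefix is replaced by one choice function. The quantifiers stand in front of all
temporal operators, so the choice does not depend on the instant. -/
theorem Fml.sat_foldr_ex (l : List Name) (ψ : Fml) (v : Var → Name) (i : Fin n) :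
    (l.foldr (fun t φ => Fml.ex .subject (.subOf t) φ) ψ).Sat D T v i ↔
      ∃ charge : Name → Name, (∀ t ∈ l, charge t ∈ D .subject) ∧
        ψ.Sat D T (putInCharge l charge v) i := by
  induction l generalizing v with
  | nil =>
    have : ∀ charge, putInCharge [] charge v = v := by
      intro charge
      funext x
      cases x <;> rfl
    simp [this]
  | cons t l ih =>
    simp only [List.foldr_cons, Fml.Sat, ih, List.forall_mem_cons]
    constructor
    · rintro ⟨d, hd, charge, hc, h⟩
      classical
      -- If the variable of `t` is quantified again further inside, the inner value counts.
      refine ⟨fun s => if s ∈ l then charge s else d, ⟨?_, fun s hs => ?_⟩, ?_⟩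
      · beta_reduce
        split_ifs with ht
        · exact hc t ht
        · exact hd
      · beta_reduce
        rw [if_pos hs]
        exact hc s hs
      · rw [putInCharge_cons, putInCharge_congr (charge' := charge) fun s hs => if_pos hs]
        split_ifs with ht
        · convert h using 1
          funext x
          cases x with
          | subOf s =>
            simp only [putInCharge]
            split_ifs with hs
            · rfl
            · have hst : s ≠ t := fun h => hs (h ▸ ht)
              rw [update_of_ne (by simpa using hst), update_of_ne (by simpa using hst)]
          | _ => rfl
        · exact h
    · rintro ⟨charge, ⟨ht, hc⟩, h⟩
      exact ⟨charge t, ht, charge, hc, by rwa [← putInCharge_cons]⟩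

end Semantics

/-- The tuple of the relation `request` for a request. -/
def Request.tuple (q : Request) : Fin 5 → Name := ![q.pid, q.sub, q.task, q.owner, q.purpose]

def Request.ofTuple (a : Fin 5 → Name) : Request := ⟨a 0, a 1, a 2, a 3, a 4⟩

theorem Request.tuple_ofTuple (a : Fin 5 → Name) : (Request.ofTuple a).tuple = a := by
  funext k
  fin_cases k <;> rfl

/-- An instance that agrees with the static database about the constants of the problem. -/
def StaticDB.Agrees (I : StaticDB) (p : Proc) (A : Instance) : Prop :=
  ∀ r ∈ staticRels, ∀ a : Fin r.arity → Name, (∀ k, a k ∈ constants I p (r.sort k)) →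
    (A r a ↔ I.Holds r a)

theorem StaticDB.sat_toFml (I : StaticDB) (p : Proc) {D : Srt → Set Name} {n : ℕ}
    {T : Fin n → Instance} (v : Var → Name) (i : Fin n) :
    (I.toFml (constants I p)).Sat D T v i ↔ I.Agrees p (T i) := by
  classical
  simp only [StaticDB.toFml, Fml.sat_bigAnd, List.mem_flatMap, List.mem_map, Finset.mem_toList,
    Fintype.mem_piFinset, StaticDB.Agrees]
  constructor
  · intro h r hr a ha
    have := h _ ⟨r, hr, a, ha, rfl⟩
    split_ifs at this with hI
    · exact iff_of_true this hI
    · exact iff_of_false this hI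
  · rintro h _ ⟨r, hr, a, ha, rfl⟩
    have := h r hr a ha
    split_ifs with hI
    · exact this.2 hI
    · exact fun h' => hI (this.1 h')

section Atoms

variable {I : StaticDB} {p : Proc} {A : Instance}

theorem StaticDB.Agrees.uses (hA : I.Agrees p A) {act t obj : Name} (ht : t ∈ p.tasks)
    (hact : act ∈ I.adom .action) (hobj : obj ∈ I.adom .object) :
    A .uses (![act, t, obj] : Fin 3 → Name) ↔ (act, t, obj) ∈ I.uses := by
  refine hA .uses (by simp [staticRels]) (![act, t, obj] : Fin 3 → Name) fun k => ?_
  change Fin 3 at k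
  fin_cases k
  · exact hact
  · exact Finset.mem_union_right _ ht
  · exact hobj

theorem StaticDB.Agrees.accessibleFor (hA : I.Agrees p A) {o obj : Name}
    (ho : o ∈ I.adom .owner) (hobj : obj ∈ I.adom .object) :
    A .accessibleFor (![o, obj, p.name] : Fin 3 → Name) ↔ (o, obj, p.name) ∈ I.accessibleFor := by
  refine hA .accessibleFor (by simp [staticRels]) (![o, obj, p.name] : Fin 3 → Name) fun k => ?_
  change Fin 3 at k
  fin_cases k
  · exact ho
  · exact hobj
  · exact Finset.mem_insert_self _ _

theorem StaticDB.Agrees.auth (hA : I.Agrees p A) {sub act obj : Name} (hsub : sub ∈ I.adom .subject)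
    (hact : act ∈ I.adom .action) (hobj : obj ∈ I.adom .object) :
    A .auth (![sub, act, obj] : Fin 3 → Name) ↔ I.Auth sub act obj := by
  refine hA .auth (by simp [staticRels]) (![sub, act, obj] : Fin 3 → Name) fun k => ?_
  change Fin 3 at k
  fin_cases k
  · exact hsub
  · exact hact
  · exact hobj

end Atoms

/-- The request belongs to the instance `id` of `p`, complies with the policies, and is made by the
subject in charge. -/
def Request.Proper (I : StaticDB) (p : Proc) (id : Name) (charge : Name → Name) (q : Request) :
    Prop :=
  q.IsOf p id ∧ q.Allowed I ∧ (q.task ∈ p.dutyTasks → q.sub = charge q.task)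

section Trace

variable {I : StaticDB} {p : Proc} {id : Name} {n : ℕ} {T : Fin n → Instance} {q : Request}
  {charge : Name → Name} {v : Var → Name} {i : Fin n} {t : Name}

theorem sat_requestFml (hq : ∀ a, T i .request a ↔ a = q.tuple) (hid : v .id = id) (sub : Term) :
    (requestFml p sub t).Sat I.range T v i ↔
      q.IsOf p id ∧ q.task = t ∧ q.sub = sub.eval v ∧ q.owner = v .owner := by
  simp only [requestFml, Fml.Sat, hq, Request.IsOf]
  rw [← hid]
  constructor
  · intro h
    have h := fun k : Fin 5 => congrFun h k
    exact ⟨⟨(h 0).symm, (h 4).symm⟩, (h 2).symm, (h 1).symm, (h 3).symm⟩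
  · rintro ⟨⟨h0, h4⟩, h2, h1, h3⟩
    funext k
    change Fin 5 at k
    fin_cases k
    · exact h0.symm
    · exact h1.symm
    · exact h2.symm
    · exact h3.symm
    · exact h4.symm

/-- A `uses` fact only mentions actions and objects of the active domain, so restricting the
quantifiers to it loses nothing. `hs` says that the subject term is not captured by them. -/
theorem sat_policyFml (hA : I.Agrees p (T i)) (ht : t ∈ p.tasks) {sub : Term}
    (hs : ∀ v' : Var → Name, (∀ x, x ≠ .act → x ≠ .obj → v' x = v x) → sub.eval v' = sub.eval v)
    (hsub : sub.eval v ∈ I.adom .subject) (ho : v .owner ∈ I.adom .owner) :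
    (policyFml p sub t).Sat I.range T v i ↔ ∀ act obj, (act, t, obj) ∈ I.uses →
      (v .owner, obj, p.name) ∈ I.accessibleFor ∧ I.Auth (sub.eval v) act obj := by
  have key : ∀ act ∈ I.adom .action, ∀ obj ∈ I.adom .object,
      ((Fml.imp (.rel .uses (![.var .act, .const t, .var .obj] : Fin 3 → Term))
        (.and (.rel .accessibleFor (![.var .owner, .var .obj, .const p.name] : Fin 3 → Term))
        (.rel .auth (![sub, .var .act, .var .obj] : Fin 3 → Term)))).Sat I.range T
        (update (update v .act act) .obj obj) i ↔ ((act, t, obj) ∈ I.uses →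
          (v .owner, obj, p.name) ∈ I.accessibleFor ∧ I.Auth (sub.eval v) act obj)) := by
    intro act hact obj hobj
    rw [Fml.sat_imp, Fml.Sat, Fml.Sat, Fml.Sat, Fml.Sat, ← hA.uses ht hact hobj,
      ← hA.accessibleFor ho hobj, ← hA.auth hsub hact hobj]
    have e : sub.eval (update (update v .act act) .obj obj) = sub.eval v :=
      hs _ fun x h1 h2 => by rw [update_of_ne h2, update_of_ne h1]
    refine imp_congr (iff_of_eq (congrArg _ ?_)) (and_congr (iff_of_eq (congrArg _ ?_))
      (iff_of_eq (congrArg _ ?_)))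
    all_goals
      funext k
      change Fin 3 at k
      fin_cases k <;> first | exact e | rfl
  simp only [policyFml, Fml.sat_all]
  constructor
  · intro h act obj hu
    have hact : act ∈ I.adom .action :=
      Finset.mem_union_right _ (Finset.mem_image.2 ⟨_, hu, rfl⟩)
    have hobj : obj ∈ I.adom .object := Finset.mem_union_left _
      (Finset.mem_union_right _ (Finset.mem_image.2 ⟨_, hu, rfl⟩))
    exact (key act hact obj hobj).1 (h act hact obj hobj) hu
  · intro h act hact obj hobj
    exact (key act hact obj hobj).2 (h act obj)

theorem sat_requestedFml (hq : ∀ a, T i .request a ↔ a = q.tuple) (hid : v .id = id) :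
    (requestedFml p t).Sat I.range T v i ↔
      q.IsOf p id ∧ q.task = t ∧ q.sub ∈ I.adom .subject ∧ q.owner ∈ I.adom .owner := by
  simp only [requestedFml, Fml.Sat]
  constructor
  · rintro ⟨s, hs, o, ho, h⟩
    obtain ⟨h1, h2, h3, h4⟩ := (sat_requestFml (id := id) hq (by simp [hid]) _).1 h
    have h3 : q.sub = s := by simpa [Term.eval] using h3
    have h4 : q.owner = o := by simpa using h4
    exact ⟨h1, h2, h3 ▸ hs, h4 ▸ ho⟩
  · rintro ⟨h1, h2, h3, h4⟩
    exact ⟨q.sub, h3, q.owner, h4, (sat_requestFml hq (by simp [hid]) _).2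
      ⟨h1, h2, by simp [Term.eval], by simp⟩⟩

/-- For a duty task the across-state variable already holds the subject in charge; for any other
task the quantifiers must pick subject and owner from the unique request. -/
theorem sat_performFml (hA : I.Agrees p (T i)) (hq : ∀ a, T i .request a ↔ a = q.tuple)
    (hid : v .id = id) (hv : ∀ t ∈ p.dutyTasks, v (.subOf t) = charge t)
    (hc : ∀ t ∈ p.dutyTasks, charge t ∈ I.adom .subject) (ht : t ∈ p.tasks) :
    (performFml p t).Sat I.range T v i ↔ q.Proper I p id charge ∧ q.task = t := by
  rw [performFml]
  split_ifs with hd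
  · simp only [Fml.Sat]
    have e : ∀ o, update v .owner o (.subOf t) = charge t := fun o => by
      rw [update_of_ne (by simp), hv t hd]
    have pol : ∀ o ∈ I.adom .owner, _ := fun o ho =>
      sat_policyFml (v := update v .owner o) (sub := .var (.subOf t)) hA ht
      (fun v' h => h _ (by simp) (by simp))
      (by rw [Term.eval, e]; exact hc t hd) (by simpa using ho)
    simp only [Term.eval, e, update_self] at pol
    constructor
    · rintro ⟨o, ho, h, h'⟩
      obtain ⟨h1, h2, h3, h4⟩ := (sat_requestFml (id := id) hq (by simp [hid]) _).1 h
      rw [Term.eval, e] at h3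
      rw [update_self] at h4
      subst h4
      refine ⟨⟨h1, ⟨h3 ▸ hc t hd, ho, ?_⟩, fun _ => h2 ▸ h3⟩, h2⟩
      rw [h1.2, h2, h3]
      exact (pol _ ho).1 h'
    · rintro ⟨⟨h1, ⟨h2, h3, h4⟩, h5⟩, rfl⟩
      refine ⟨q.owner, h3, (sat_requestFml hq (by simp [hid]) _).2
        ⟨h1, rfl, ?_, by simp⟩, (pol _ h3).2 ?_⟩
      · rw [Term.eval, e, h5 hd]
      · rw [← h5 hd, ← h1.2]
        exact h4
  · simp only [Fml.Sat]
    have pol : ∀ s ∈ I.adom .subject, ∀ o ∈ I.adom .owner, _ := fun s hs o ho =>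
      sat_policyFml (v := update (update v .sub s) .owner o) (sub := .var .sub) hA ht
      (fun v' h => h _ (by simp) (by simp)) (by simpa [Term.eval] using hs) (by simpa using ho)
    have e : ∀ s o, update (update v .sub s) .owner o .sub = s := fun s o => by simp
    simp only [Term.eval, e, update_self] at pol
    constructor
    · rintro ⟨s, hs, o, ho, h, h'⟩
      obtain ⟨h1, h2, h3, h4⟩ := (sat_requestFml (id := id) hq (by simp [hid]) _).1 h
      rw [Term.eval, e] at h3
      rw [update_self] at h4
      subst h3 h4
      refine ⟨⟨h1, ⟨hs, ho, ?_⟩, fun h => absurd (h2 ▸ h) hd⟩, h2⟩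
      rw [h1.2, h2]
      exact (pol _ hs _ ho).1 h'
    · rintro ⟨⟨h1, ⟨h2, h3, h4⟩, h5⟩, rfl⟩
      refine ⟨q.sub, h2, q.owner, h3, (sat_requestFml hq (by simp [hid]) _).2
        ⟨h1, rfl, ?_, by simp⟩, (pol _ h2 _ h3).2 ?_⟩
      · rw [Term.eval, e]
      · rw [← h1.2]
        exact h4

end Trace

section Translate

variable {D : Srt → Set Name} {p : Proc} {n : ℕ} {T : Fin n → Instance} {v : Var → Name}
  {W : Fin n → Name → Prop}

/-- If every performed task is requested, then the translation is at least as strong as the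
constraint. -/
theorem sat_of_sat_translate (φ : LTL)
    (hP : ∀ t ∈ φ.tasks, ∀ i, (performFml p t).Sat D T v i → W i t)
    (hR : ∀ t ∈ φ.tasks, ∀ i, W i t → (requestedFml p t).Sat D T v i) (i : Fin n) :
    ((translate p true φ).Sat D T v i → φ.Sat W i) ∧
      (φ.Sat W i → (translate p false φ).Sat D T v i) := by
  induction φ generalizing i with
  | tt => exact ⟨id, id⟩
  | task t => exact ⟨hP t (by simp [LTL.tasks]) i, hR t (by simp [LTL.tasks]) i⟩
  | neg φ ih => exact ⟨fun h h' => h ((ih hP hR i).2 h'), fun h h' => h ((ih hP hR i).1 h')⟩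
  | and φ ψ ih ih' =>
    simp only [LTL.tasks, Finset.mem_union] at hP hR
    have h1 := ih (fun t ht => hP t (.inl ht)) (fun t ht => hR t (.inl ht)) i
    have h2 := ih' (fun t ht => hP t (.inr ht)) (fun t ht => hR t (.inr ht)) i
    exact ⟨fun h => ⟨h1.1 h.1, h2.1 h.2⟩, fun h => ⟨h1.2 h.1, h2.2 h.2⟩⟩
  | next φ ih =>
    exact ⟨fun ⟨j, hj, h⟩ => ⟨j, hj, (ih hP hR j).1 h⟩, fun ⟨j, hj, h⟩ => ⟨j, hj, (ih hP hR j).2 h⟩⟩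
  | untl φ ψ ih ih' =>
    simp only [LTL.tasks, Finset.mem_union] at hP hR
    have h1 := ih (fun t ht => hP t (.inl ht)) (fun t ht => hR t (.inl ht))
    have h2 := ih' (fun t ht => hP t (.inr ht)) (fun t ht => hR t (.inr ht))
    exact ⟨fun ⟨j, hj, h, h'⟩ => ⟨j, hj, (h2 j).1 h, fun k hk hk' => (h1 k).1 (h' k hk hk')⟩,
      fun ⟨j, hj, h, h'⟩ => ⟨j, hj, (h2 j).2 h, fun k hk hk' => (h1 k).2 (h' k hk hk')⟩⟩

/-- When requested and performed tasks coincide, the polarity of an occurrence no longer matters. -/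
theorem sat_translate_iff (φ : LTL)
    (hP : ∀ t ∈ φ.tasks, ∀ i, (performFml p t).Sat D T v i ↔ W i t)
    (hR : ∀ t ∈ φ.tasks, ∀ i, (requestedFml p t).Sat D T v i ↔ W i t) (b : Bool) (i : Fin n) :
    (translate p b φ).Sat D T v i ↔ φ.Sat W i := by
  induction φ generalizing b i with
  | tt => cases b <;> rfl
  | task t =>
    cases b
    · exact hR t (by simp [LTL.tasks]) i
    · exact hP t (by simp [LTL.tasks]) i
  | neg φ ih => cases b <;> exact not_congr (ih hP hR _ i)
  | next φ ih =>
    cases b <;> exact exists_congr fun j => and_congr_right fun _ => ih hP hR _ j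
  | and φ ψ ih ih' =>
    simp only [LTL.tasks, Finset.mem_union] at hP hR
    have h1 := ih (fun t ht => hP t (.inl ht)) (fun t ht => hR t (.inl ht))
    have h2 := ih' (fun t ht => hP t (.inr ht)) (fun t ht => hR t (.inr ht))
    cases b <;> exact and_congr (h1 _ i) (h2 _ i)
  | untl φ ψ ih ih' =>
    simp only [LTL.tasks, Finset.mem_union] at hP hR
    have h1 := ih (fun t ht => hP t (.inl ht)) (fun t ht => hR t (.inl ht))
    have h2 := ih' (fun t ht => hP t (.inr ht)) (fun t ht => hR t (.inr ht))
    cases b <;> exact exists_congr fun j => and_congr_right fun _ => and_congr (h2 _ j)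
      (forall₃_congr fun k _ _ => h1 _ k)

end Translate

theorem sat_completionFml (I : StaticDB) (p : Proc) (id : Name) {n : ℕ}
    {T : Fin (n + 1) → Instance} {v : Var → Name} :
    (completionFml I p id).Sat I.range T v 0 ↔ (∀ i, I.Agrees p (T i)) ∧
      ∃ charge : Name → Name, (∀ t ∈ p.dutyTasks, charge t ∈ I.adom .subject) ∧
        (∀ φ ∈ p.constraints, (translate p true φ).Sat I.range T
          (putInCharge p.dutyTasks charge (update v .id id)) 0) ∧
        (∀ c ∈ p.sod, charge c.1 ≠ charge c.2) ∧ ∀ c ∈ p.bod, charge c.1 = charge c.2 := by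
  rw [completionFml, Fml.Sat, Fml.sat_always, Fml.sat_subst, Psi, Fml.sat_foldr_ex, and_comm]
  simp only [StaticDB.sat_toFml, Fin.zero_le, forall_const]
  refine and_congr_right fun _ => exists_congr fun charge => and_congr_right fun _ => ?_
  simp only [Fml.Sat, Fml.sat_bigAnd, List.forall_mem_map]
  refine and_congr_right fun _ => and_congr (forall₂_congr fun c hc => ?_)
    (forall₂_congr fun c hc => ?_)
  · obtain ⟨h1, h2⟩ := mem_dutyTasks_of_mem (List.mem_append_left _ hc)
    simp [Term.eval, putInCharge, h1, h2]
  · obtain ⟨h1, h2⟩ := mem_dutyTasks_of_mem (List.mem_append_right _ hc)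
    simp [Term.eval, putInCharge, h1, h2]

/-- Process ids can be renamed. -/
theorem Completes.rename {I : StaticDB} {p : Proc} {id : Name} {n : ℕ}
    {run : Fin (n + 1) → Request} {charge : Name → Name} (h : Completes I p id run charge)
    (id' : Name) : ∃ run' : Fin (n + 1) → Request, Completes I p id' run' charge := by
  classical
  -- Foreign ids must stay foreign; `true :: id'` differs from `id'` by its length.
  let f : Request → Request := fun q => { q with pid := if q.pid = id then id' else true :: id' }
  have hf : ∀ q, (f q).IsOf p id' ↔ q.IsOf p id := by
    intro q
    simp only [Request.IsOf, f]
    refine and_congr_left fun _ => ?_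
    split_ifs with hq
    · exact iff_of_true rfl hq
    · exact iff_of_false (List.cons_ne_self _ _) hq
  refine ⟨fun i => f (run i), fun φ hφ => ?_, fun i hi => ?_, h.charge_mem, fun i hi => ?_,
    h.sod, h.bod⟩
  · refine (LTL.sat_congr φ (fun i t _ => ?_) 0).1 (h.constraints φ hφ)
    rw [hf]
  · exact h.allowed i ((hf _).1 hi)
  · exact h.charge_eq i ((hf _).1 hi)

/-- The database instance with the static database `I` and the request `q`. -/
def Request.toInstance (I : StaticDB) (q : Request) : Instance
  | .request, a => a = q.tuple
  | r, a => I.Holds r a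

theorem Request.agrees_toInstance (I : StaticDB) (p : Proc) (q : Request) :
    I.Agrees p (q.toInstance I) := by
  intro r hr a _
  cases r with
  | request => simp [staticRels] at hr
  | _ => rfl

/-- Each request, put beside the true static facts, is an instance. As all relevant requests of the
run comply with the policies, both translations of a task hold exactly when it is performed. -/
theorem Completes.satisfiable {I : StaticDB} {p : Proc} {id : Name} {n : ℕ}
    {run : Fin (n + 1) → Request} {charge : Name → Name} (h : Completes I p id run charge) :
    Satisfiable I.range (completionFml I p id) := by
  have hA := fun i => (run i).agrees_toInstance I p
  have hq : ∀ i a, (run i).toInstance I .request a ↔ a = (run i).tuple := fun i a => Iff.rfl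
  refine ⟨n, fun i => (run i).toInstance I, fun _ => id,
    fun i => ⟨(run i).tuple, rfl, fun _ h => h⟩, (sat_completionFml I p id).2
    ⟨hA, charge, h.charge_mem, fun φ hφ => ?_, h.sod, h.bod⟩⟩
  refine (sat_translate_iff φ (fun t ht i => ?_) (fun t ht i => ?_) true 0).2
    (h.constraints φ hφ)
  · rw [sat_performFml (hA i) (hq i) (id := id) (by simp [putInCharge])
      (fun t ht => by simp [putInCharge, ht]) h.charge_mem
      (Proc.mem_tasks_iff.2 (Or.inl ⟨φ, hφ, ht⟩))]
    exact and_congr_left fun _ => ⟨fun h => h.1, fun hi => ⟨hi, h.allowed i hi, h.charge_eq i hi⟩⟩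
  · rw [sat_requestedFml (hq i) (id := id) (by simp [putInCharge])]
    exact ⟨fun h => ⟨h.1, h.2.1⟩,
      fun hi => ⟨hi.1, hi.2, (h.allowed i hi.1).1, (h.allowed i hi.1).2.1⟩⟩

/-- Negative occurrences speak of any request, so a model may contain relevant requests that break a
policy. Removing them from the process instance only makes the constraints easier to satisfy. -/
theorem canComplete_of_satisfiable {I : StaticDB} {p : Proc} {id : Name}
    (h : Satisfiable I.range (completionFml I p id)) : CanComplete I p := by
  classical
  obtain ⟨n, T, v, hT, h⟩ := h
  obtain ⟨hA, charge, hc, hcon, hsod, hbod⟩ := (sat_completionFml I p id).1 h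
  choose a ha using hT
  let q : Fin (n + 1) → Request := fun i => Request.ofTuple (a i)
  have hq : ∀ i b, T i .request b ↔ b = (q i).tuple := by
    intro i b
    simp only [q, Request.tuple_ofTuple]
    exact ⟨(ha i).2 b, fun hb => hb ▸ (ha i).1⟩
  have hid : putInCharge p.dutyTasks charge (update v .id id) .id = id := by simp [putInCharge]
  have hv : ∀ t ∈ p.dutyTasks,
      putInCharge p.dutyTasks charge (update v .id id) (.subOf t) = charge t :=
    fun t ht => by simp [putInCharge, ht]
  -- An improper request cannot be deleted, since each instant carries one; a change of id makes it
  -- irrelevant.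
  let run : Fin (n + 1) → Request := fun i =>
    if (q i).Proper I p id charge then q i else { q i with pid := true :: id }
  have hrun : ∀ i, (run i).IsOf p id → run i = q i ∧ (q i).Proper I p id charge := by
    intro i hi
    simp only [run] at hi ⊢
    split_ifs at hi ⊢ with hp
    · exact ⟨rfl, hp⟩
    · exact absurd hi.1 (List.cons_ne_self _ _)
  have hrun' : ∀ i, (q i).Proper I p id charge → run i = q i := fun i hi => if_pos hi
  refine ⟨id, n, run, charge, fun φ hφ => ?_, fun i hi => ?_, hc, fun i hi => ?_, hsod, hbod⟩
  · refine (sat_of_sat_translate φ (fun t ht i hP => ?_) (fun t ht i hR => ?_) 0).1 (hcon φ hφ)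
    · obtain ⟨h1, h2⟩ := (sat_performFml (hA i) (hq i) hid hv hc
        (Proc.mem_tasks_iff.2 (Or.inl ⟨φ, hφ, ht⟩))).1 hP
      rw [hrun' i h1]
      exact ⟨h1.1, h2⟩
    · obtain ⟨h1, h2⟩ := hrun i hR.1
      rw [h1] at hR
      exact (sat_requestedFml (hq i) hid).2 ⟨hR.1, hR.2, h2.2.1.1, h2.2.1.2.1⟩
  · obtain ⟨h1, h2⟩ := hrun i hi
    rw [h1]
    exact h2.2.1
  · obtain ⟨h1, h2⟩ := hrun i hi
    rw [h1]
    exact h2.2.2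

theorem canComplete_iff_satisfiable (I : StaticDB) (p : Proc) (id : Name) :
    CanComplete I p ↔ Satisfiable I.range (completionFml I p id) := by
  refine ⟨?_, canComplete_of_satisfiable⟩
  rintro ⟨id', n, run, charge, h⟩
  obtain ⟨run', h'⟩ := h.rename id
  exact h'.satisfiable

end PurposeAware

theorem mainTheorem2 (I : PurposeAware.StaticDB) :
    PurposeAware.InEXPSPACE (PurposeAware.completionProblem I) ∧
    ∀ (p : PurposeAware.Proc) (id : PurposeAware.Name),
      PurposeAware.CanComplete I p ↔
        PurposeAware.Satisfiable I.range (PurposeAware.completionFml I p id) :=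
  ⟨PurposeAware.completionProblem_inEXPSPACE I, PurposeAware.canComplete_iff_satisfiable I⟩
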